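/- **Setting.** Consider a serial machine with a fast memory of $M \ge 3$ words (real numbers, exact arithmetic) and an unbounded slow memory. Arithmetic ($+,-,\times,\div,\sqrt{\cdot}$) and comparisons act on words in fast memory only. The communication cost of a run is the number of words moved between the two memories. Let $m \ge n$ and let $b$ divide $n$; partition the columns of $\mathbf G \in \mathbb R^{m\times n}$ and $\mathbf V\in\mathbb R^{n\times n}$ into $n/b$ blocks of $b$ columns. One sweep of one-sided Jacobi SVD does the following for every pair $1\le I<J\le n/b$, in any prescribed order: form $\hat{\mathbf A}=\mathbf G(:,[I,J])^T\mathbf G(:,[I,J])\in\mathbb R^{2b\times 2b}$; if $\hat{\mathbf A}$ is far enough from diagonal (by an arbitrary criterion depending on $\hat{\mathbf A}$, supplied as a black box whose evaluation is charged one pass over $\hat{\mathbf A}$, i.e. $(2b)^2$ words), compute its (approximate) eigenvector matrix $\hat{\mathbf V}$ with a black-box diagonalization method; optionally, for any prescribed set of pairs, compute an LU factorization with partial pivoting $\hat{\mathbf V}(1{:}b,1{:}2b)^T=\mathbf P^T\mathbf L\mathbf U$ and replace $\hat{\mathbf V}$ by $\hat{\mathbf V}\mathbf P^T$; then multiply block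 columns $I,J$ of $\mathbf G$ and of $\mathbf V$ on the right by $\hat{\mathbf V}$. The cost of a sweep also includes forming $\boldsymbol\Sigma=\mathrm{diag}(\|\mathbf G(:,1)\|_2,\dots,\|\mathbf G(:,n)\|_2)$ and $\mathbf U=\mathbf G\boldsymbol\Sigma^\dagger$ at its end. **Statement.** Let $2<\omega_0\le 3$, and suppose that $O(N^{\omega_0})$ Strassen-like matrix multiplication is available: a bilinear algorithm that multiplies $k\times k$ real matrices with $r\le k^{\omega_0}$ products, for some $k\ge 2$ (for instance, classical multiplication if $\omega_0=3$). Let $c>0$. Then there is a constant $C>0$, depending only on this algorithm, $\omega_0$ and $c$, such that for all $M\ge 3$, all $m\ge n$, all $b\mid n$ with $b>\sqrt M/2$, every order of the pairs and every choice of the pairs at which the optional pivoting is executed, there is an implementation of one sweep on the machine with fast memory of size $M$, not depending on the two black boxes, with the following property. For all inputs, every criterion and every diagonalization method that communicates at most $c\,U(2b)$ words on each symmetric $2b\times 2b$ matrix, the implementation carries out the sweep, its communication cost is at most $$C\left(\frac{m n^2 b^{\omega_0-3}}{M^{\omega_0/2-1}}+\left\lceil \frac nb\right\rceil^2U(2b)\right),$$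 and it performs at most $C\,mn^2b^{\omega_0-3}$ arithmetic operations and comparisons outside the black boxes, as is to be expected when $O(N^{\omega_0})$ matrix multiplication is used. -/

import Mathlib

open scoped Matrix

noncomputable section

/-- A Strassen-like matrix multiplication algorithm: a bilinear algorithm that multiplies two
`k × k` matrices with `r` products, to be applied recursively to block matrices.
`k = 2`, `r = 8` is classical multiplication, `k = 2`, `r = 7` is Strassen's algorithm. Run
recursively, it needs `O(N ^ ω₀)` operations for every `ω₀ > 2` with `r ≤ k ^ ω₀`. -/
structure StrassenLike where
  k : ℕ
  r : ℕ
  two_le_k : 2 ≤ k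
  α : Fin r → Matrix (Fin k) (Fin k) ℝ
  β : Fin r → Matrix (Fin k) (Fin k) ℝ
  γ : Fin r → Matrix (Fin k) (Fin k) ℝ
  mul_eq : ∀ (A B : Matrix (Fin k) (Fin k) ℝ) (i j : Fin k),
    (A * B) i j =
      ∑ t, γ t i j * ((∑ p, ∑ q, α t p q * A p q) * (∑ p, ∑ q, β t p q * B p q))

/-! ### The serial two-level memory machine -/

/-- Contents of the memory: `M` words of fast memory, and an unbounded slow memory organised in
arrays, `slow a i j` being the word in row `i` and column `j` of array number `a`. -/
structure Mem (M : ℕ) where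
  fast : Fin M → ℝ
  slow : ℕ → ℕ → ℕ → ℝ

/-- Array `a` of the slow memory holds the matrix `X` (in its upper left corner). -/
def Mem.Holds {M p q : ℕ} (s : Mem M) (a : ℕ) (X : Matrix (Fin p) (Fin q) ℝ) : Prop :=
  ∀ (i : Fin p) (j : Fin q), s.slow a i j = X i j

/-- Overwrite a word of fast memory. -/
def Mem.setFast {M : ℕ} (s : Mem M) (d : Fin M) (x : ℝ) : Mem M :=
  { s with fast := Function.update s.fast d x }

/-- Overwrite a word of slow memory. -/
def Mem.setSlow {M : ℕ} (s : Mem M) (a i j : ℕ) (x : ℝ) : Mem M :=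
  { s with slow := fun a' i' j' => if a' = a ∧ i' = i ∧ j' = j then x else s.slow a' i' j' }

/-- The `N × N` matrix stored in array `a`. -/
def Mem.read {M : ℕ} (s : Mem M) (N a : ℕ) : Matrix (Fin N) (Fin N) ℝ :=
  Matrix.of fun i j => s.slow a i j

/-- Overwrite array `a` by an `N × N` matrix; the previous contents of fast memory are lost. -/
def Mem.write {M N : ℕ} (s : Mem M) (a : ℕ) (X : Matrix (Fin N) (Fin N) ℝ) : Mem M where
  fast := fun _ => 0
  slow := fun a' i j =>
    if h : a' = a ∧ i < N ∧ j < N then X ⟨i, h.2.1⟩ ⟨j, h.2.2⟩ else s.slow a' i j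

/-- Binary arithmetic operations. -/
inductive BinOp where
  | add
  | sub
  | mul
  | div

def BinOp.eval : BinOp → ℝ → ℝ → ℝ
  | .add, x, y => x + y
  | .sub, x, y => x - y
  | .mul, x, y => x * y
  | .div, x, y => x / y

/-- Programs of the machine with `M` words of fast memory. Arithmetic and comparisons act on fast
memory only; `load` and `store` move one word between slow and fast memory. `diag src dst` calls
the black-box diagonalization method on the matrix in array `src` and puts its matrix of
(approximate) eigenvectors into array `dst`. `test src` branches on the black-box criterion
"is far enough from diagonal" for the matrix in array `src`. -/
inductive Prog (M : ℕ) where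
  | halt : Prog M
  | load (a i j : ℕ) (d : Fin M) (next : Prog M) : Prog M
  | store (x : Fin M) (a i j : ℕ) (next : Prog M) : Prog M
  | const (c : ℝ) (d : Fin M) (next : Prog M) : Prog M
  | arith (op : BinOp) (x y d : Fin M) (next : Prog M) : Prog M
  | sqrt (x d : Fin M) (next : Prog M) : Prog M
  | branch (x y : Fin M) (ifLess ifNot : Prog M) : Prog M
  | diag (src dst : ℕ) (next : Prog M) : Prog M
  | test (src : ℕ) (ifFar ifNot : Prog M) : Prog M

/-- A black-box method for the (exact or approximate) diagonalization of `N × N` symmetric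
matrices: the matrix of eigenvectors it returns, and the number of words it communicates.
Nothing is assumed about the accuracy of `vecs`. -/
structure Diagonalizer (N : ℕ) where
  vecs : Matrix (Fin N) (Fin N) ℝ → Matrix (Fin N) (Fin N) ℝ
  words : Matrix (Fin N) (Fin N) ℝ → ℕ

/-- The result of running a program: the final memory, the number of words moved between slow
and fast memory, and the number of arithmetic operations and comparisons
(those made inside the black boxes are not counted). -/
structure Outcome (M : ℕ) where
  mem : Mem M
  words : ℕ
  flops : ℕ

/-- Add `w` moved words and `f` operations to an outcome. -/
def Outcome.charge {M : ℕ} (w f : ℕ) (R : Outcome M) : Outcome M :=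
  { R with words := w + R.words, flops := f + R.flops }

open Classical in
/-- Execution of a program. A call of the diagonalization method is charged the words which that
method communicates, an evaluation of the criterion one pass over the `N × N` matrix; both may
use all of fast memory, whose contents are lost. -/
def Prog.run {M N : ℕ} (D : Diagonalizer N) (far : Matrix (Fin N) (Fin N) ℝ → Prop) :
    Prog M → Mem M → Outcome M
  | .halt, s => ⟨s, 0, 0⟩
  | .load a i j d p, s => (p.run D far (s.setFast d (s.slow a i j))).charge 1 0
  | .store x a i j p, s => (p.run D far (s.setSlow a i j (s.fast x))).charge 1 0
  | .const c d p, s => (p.run D far (s.setFast d c)).charge 0 1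
  | .arith op x y d p, s =>
      (p.run D far (s.setFast d (op.eval (s.fast x) (s.fast y)))).charge 0 1
  | .sqrt x d p, s => (p.run D far (s.setFast d (Real.sqrt (s.fast x)))).charge 0 1
  | .branch x y p q, s =>
      (if s.fast x < s.fast y then p.run D far s else q.run D far s).charge 0 1
  | .diag src dst p, s =>
      (p.run D far (s.write dst (D.vecs (s.read N src)))).charge (D.words (s.read N src)) 0
  | .test src p q, s =>
      (if far (s.read N src) then p.run D far { s with fast := fun _ => 0 }
        else q.run D far { s with fast := fun _ => 0 }).charge (N ^ 2) 0

/-! ### One sweep of the one-sided Jacobi SVD algorithm -/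

/-- The column indices of block columns `I` and `J` (blocks of `b` columns), `2b` in number. -/
def pairCol {n b : ℕ} (I J : Fin (n / b)) (c : Fin (2 * b)) : Fin n :=
  ⟨if (c : ℕ) < b then I * b + c else J * b + (c - b), by
    have hc := c.2
    have h1 : (I + 1 : ℕ) * b ≤ n :=
      (Nat.mul_le_mul_right b I.2).trans (Nat.div_mul_le_self n b)
    have h2 : (J + 1 : ℕ) * b ≤ n :=
      (Nat.mul_le_mul_right b J.2).trans (Nat.div_mul_le_self n b)
    rw [add_mul, one_mul] at h1 h2
    split_ifs <;> omega⟩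

/-- `A = Pᵀ L U` is an LU factorization with partial pivoting of the tall matrix `A`: `P` is the
matrix of the permutation `σ`, `L` is unit lower trapezoidal with entries of modulus at most `1`,
and `U` is upper triangular. -/
def IsLUPP {p q : ℕ} (A : Matrix (Fin p) (Fin q) ℝ) (σ : Equiv.Perm (Fin p))
    (L : Matrix (Fin p) (Fin q) ℝ) (U : Matrix (Fin q) (Fin q) ℝ) : Prop :=
  A = (σ.permMatrix ℝ)ᵀ * L * U ∧
  (∀ (i : Fin p) (j : Fin q), (i : ℕ) = j → L i j = 1) ∧
  (∀ (i : Fin p) (j : Fin q), (i : ℕ) < j → L i j = 0) ∧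
  (∀ i j, |L i j| ≤ 1) ∧
  (∀ i j, j < i → U i j = 0)

/-- `B` arises from `A` by multiplying block columns `I` and `J` on the right by `W`. -/
def MulBlockCols {p n b : ℕ} (I J : Fin (n / b)) (W : Matrix (Fin (2 * b)) (Fin (2 * b)) ℝ)
    (A B : Matrix (Fin p) (Fin n) ℝ) : Prop :=
  B.submatrix id (pairCol I J) = A.submatrix id (pairCol I J) * W ∧
  ∀ j, j ∉ Set.range (pairCol I J) → ∀ i, B i j = A i j

/-- `W` is a block rotation that the algorithm may use for the subproblem `A`: the matrix `Q` of
eigenvectors found by the diagonalization method or, if the optional pivoting is executed,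
`Q Pᵀ` with `P` from an LU factorization with partial pivoting of the transpose of the first
`b` rows of `Q`. -/
def IsRotation {b : ℕ} (D : Diagonalizer (2 * b)) (pivot : Bool)
    (A W : Matrix (Fin (2 * b)) (Fin (2 * b)) ℝ) : Prop :=
  if pivot then
    ∃ σ L U,
      IsLUPP ((D.vecs A).submatrix (Fin.castLE (by omega : b ≤ 2 * b)) id)ᵀ σ L U ∧
      W = D.vecs A * (σ.permMatrix ℝ)ᵀ
  else W = D.vecs A

/-- One pass through the body of the main loop, for the pair `p = (I, J)`, from the matrices
`S = (G, V)` to `T = (G', V')`. -/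
def Step {m n b : ℕ} (D : Diagonalizer (2 * b))
    (far : Matrix (Fin (2 * b)) (Fin (2 * b)) ℝ → Prop) (pivot : Bool)
    (p : Fin (n / b) × Fin (n / b))
    (S T : Matrix (Fin m) (Fin n) ℝ × Matrix (Fin n) (Fin n) ℝ) : Prop :=
  let X := S.1.submatrix id (pairCol p.1 p.2)
  let A := Xᵀ * X
  (far A ∧ ∃ W, IsRotation D pivot A W ∧
    MulBlockCols p.1 p.2 W S.1 T.1 ∧ MulBlockCols p.1 p.2 W S.2 T.2) ∨
  (¬ far A ∧ T = S)

/-- Every pair `I < J` of block indices occurs exactly once in the list. -/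
def IsSweepOrder {q : ℕ} (order : List (Fin q × Fin q)) : Prop :=
  order.Nodup ∧ ∀ p, p ∈ order ↔ p.1 < p.2

/-- The main loop over a list of pairs of block indices, from `(G, V)` to `(G', V')`. -/
def Sweep {m n b : ℕ} (D : Diagonalizer (2 * b))
    (far : Matrix (Fin (2 * b)) (Fin (2 * b)) ℝ → Prop)
    (pivot : Fin (n / b) × Fin (n / b) → Bool) :
    List (Fin (n / b) × Fin (n / b)) →
    Matrix (Fin m) (Fin n) ℝ × Matrix (Fin n) (Fin n) ℝ →
    Matrix (Fin m) (Fin n) ℝ × Matrix (Fin n) (Fin n) ℝ → Prop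
  | [], S, T => T = S
  | p :: ps, S, T => ∃ R, Step D far (pivot p) p S R ∧ Sweep D far pivot ps R T

/-- The Euclidean norms of the columns. -/
def colNorm {m n : ℕ} (G : Matrix (Fin m) (Fin n) ℝ) (j : Fin n) : ℝ :=
  Real.sqrt (∑ i, G i j ^ 2)

/-- `Σ = diag(‖G(:,1)‖, …, ‖G(:,n)‖)`. -/
def sigmaFactor {m n : ℕ} (G : Matrix (Fin m) (Fin n) ℝ) : Matrix (Fin n) (Fin n) ℝ :=
  Matrix.diagonal (colNorm G)

/-- `U = G Σ†`. The pseudoinverse of a diagonal matrix inverts its nonzero entries and keeps the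
zeros, as `x⁻¹` does. -/
def leftFactor {m n : ℕ} (G : Matrix (Fin m) (Fin n) ℝ) : Matrix (Fin m) (Fin n) ℝ :=
  G * Matrix.diagonal fun j => (colNorm G j)⁻¹

/-- The outcome `R` is that of one sweep from `(G, V)`, followed by the computation of `U` and
`Σ`: arrays `0`, `1`, `2`, `3` hold the new `G`, the new `V`, and `U` and `Σ`. -/
def Outcome.IsSweep {M m n b : ℕ} (R : Outcome M) (D : Diagonalizer (2 * b))
    (far : Matrix (Fin (2 * b)) (Fin (2 * b)) ℝ → Prop)
    (pivot : Fin (n / b) × Fin (n / b) → Bool)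
    (order : List (Fin (n / b) × Fin (n / b)))
    (G : Matrix (Fin m) (Fin n) ℝ) (V : Matrix (Fin n) (Fin n) ℝ) : Prop :=
  ∃ (G₁ : Matrix (Fin m) (Fin n) ℝ) (V₁ : Matrix (Fin n) (Fin n) ℝ),
    Sweep D far pivot order (G, V) (G₁, V₁) ∧
    R.mem.Holds 0 G₁ ∧ R.mem.Holds 1 V₁ ∧
    R.mem.Holds 2 (leftFactor G₁) ∧ R.mem.Holds 3 (sigmaFactor G₁)

end

noncomputable section

namespace JacobiIO

/-! There are at most (n/b)² pairs, and outside the black boxes the work of a pair is essentially a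
number of square matrix products. The Gram matrix is a sum of products over chunks of 2b rows, the
rotation of G and V acts on chunks of 2b rows, and pivoted LU is rearranged into products as well.
With ε = ω₀/2 − 1, a product of q × q matrices moves O(q²(1 + (q²/M)^ε)) words. Since b > √M/2 gives
(2b)² ≥ M, the power term dominates, so a pair costs O((m/b) b² (b²/M)^ε). Multiplied by (n/b)² this
is the first term of the bound, and the black boxes give the second. The operation count is the same
computation with M replaced by 1 (`sweep_bound`).

Multiplication recurses on blocks, streaming the linear combinations through fast memory, until all
scratch words of a subproblem fit into fast memory; from there on each word is loaded and stored
once (`fin_mul`, `cost_mul`, `mul_recurrence`).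

LU recurses on the columns of a panel. Instead of the lower part L₂ of L, the program keeps T =
L₂L₁⁻¹, the multipliers that eliminate the rows below. The Schur complement is then y − T y_top, and
the T of a panel arises from those of its halves by one further product, so no triangular system is
ever solved (`Elim.combine`, `eliminate_spec`, `elim_recurrence`). Rows are never exchanged in
memory: a program is a decision tree, so each branch knows the permutation found so far and
addresses the rows through it.

Programs are written as `Comp`, whose operands live in slow memory. Correctness is proved for this
semantics alone. Costs come from two compilations, one moving the operands of every operation
(`Bdd.cost_slow`), the other moving the whole working set once in and once out (`Bdd.cost_fast`).
`Cost` fixes the machine code before the black boxes, the continuation and the contents of fast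
memory are given, so the pieces can be spliced with the black-box instructions (`exists_step`).

Arrays 0 to 3 are those of the statement. Array 4 holds the Gram matrix, 5 the eigenvectors, 6 the
panel to be factored, 7 two temporaries, and arrays from 10 on are scratch for multiplication. -/

/-- Addresses of slow memory: array, row, column. -/
abbrev Addr := ℕ × ℕ × ℕ

/-- Contents of slow memory. -/
abbrev Store := Addr → ℝ

/-- The memory with the given fast and slow parts. -/
def memOf {M : ℕ} (f : Fin M → ℝ) (st : Store) : Mem M := ⟨f, fun a i j => st (a, i, j)⟩

theorem memOf_setFast {M : ℕ} (f : Fin M → ℝ) (st : Store) (d : Fin M) (x : ℝ) :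
    (memOf f st).setFast d x = memOf (Function.update f d x) st := rfl

theorem memOf_setSlow {M : ℕ} (f : Fin M → ℝ) (st : Store) (a i j : ℕ) (x : ℝ) :
    (memOf f st).setSlow a i j x = memOf f (Function.update st (a, i, j) x) := by
  simp only [Mem.setSlow, memOf, Mem.mk.injEq, true_and]
  funext a' i' j'
  simp [Function.update_apply, Prod.mk.injEq]

theorem charge_charge {M : ℕ} (w f w' f' : ℕ) (R : Outcome M) :
    (R.charge w' f').charge w f = R.charge (w + w') (f + f') := by
  simp [Outcome.charge, add_assoc]

theorem charge_zero {M : ℕ} (R : Outcome M) : R.charge 0 0 = R := by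
  simp [Outcome.charge]

/-! ### Programs acting on slow memory -/

/-- Elementary assignments `d := f x y`. -/
inductive Op where
  | const (c : ℝ)
  | lin (c c' : ℝ)
  | bin (op : BinOp)
  | sqrt

def Op.eval : Op → ℝ → ℝ → ℝ
  | .const c, _, _ => c
  | .lin c c', x, y => x * c + y * c'
  | .bin op, x, y => op.eval x y
  | .sqrt, x, _ => Real.sqrt x

/-- Programs whose operations act on words of slow memory, with a result in `α` that is known to
the control flow. They are compiled to `Prog M` in different ways. -/
inductive Comp (α : Type) where
  | pure (a : α) : Comp α
  | op (o : Op) (x y d : Addr) (next : Comp α) : Comp α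
  | branch (x y : Addr) (ifLess ifNot : Comp α) : Comp α

namespace Comp

variable {α β ι : Type}

def exec : Comp α → Store → α × Store
  | .pure a, st => (a, st)
  | .op o x y d c, st => c.exec (Function.update st d (o.eval (st x) (st y)))
  | .branch x y c c', st => if st x < st y then c.exec st else c'.exec st

/-- The result. -/
def val (c : Comp α) (st : Store) : α := (c.exec st).1

/-- The final contents of slow memory. -/
def fin (c : Comp α) (st : Store) : Store := (c.exec st).2

def bind : Comp α → (α → Comp β) → Comp β
  | .pure a, f => f a
  | .op o x y d c, f => .op o x y d (c.bind f)
  | .branch x y c c', f => .branch x y (c.bind f) (c'.bind f)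

theorem exec_bind (c : Comp α) (f : α → Comp β) (st : Store) :
    (c.bind f).exec st = (f (c.val st)).exec (c.fin st) := by
  induction c generalizing st with
  | pure a => rfl
  | op o x y d c ih => exact ih _
  | branch x y c c' ih ih' =>
    simp only [bind, exec, val, fin]
    split_ifs with h
    · exact ih st
    · exact ih' st

@[simp] theorem val_bind (c : Comp α) (f : α → Comp β) (st : Store) :
    (c.bind f).val st = (f (c.val st)).val (c.fin st) := by
  rw [val, exec_bind]; rfl

@[simp] theorem fin_bind (c : Comp α) (f : α → Comp β) (st : Store) :
    (c.bind f).fin st = (f (c.val st)).fin (c.fin st) := by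
  rw [fin, exec_bind]; rfl

@[simp] theorem val_pure (a : α) (st : Store) : (pure a).val st = a := rfl

@[simp] theorem fin_pure (a : α) (st : Store) : (pure a).fin st = st := rfl

/-- A single assignment. -/
def step (o : Op) (x y d : Addr) : Comp Unit := .op o x y d (.pure ())

@[simp] theorem fin_step (o : Op) (x y d : Addr) (st : Store) :
    (step o x y d).fin st = Function.update st d (o.eval (st x) (st y)) := rfl

/-- Sequential composition. -/
def andThen (c : Comp Unit) (c' : Comp α) : Comp α := c.bind fun _ => c'

@[simp] theorem fin_andThen (c : Comp Unit) (c' : Comp α) (st : Store) :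
    (c.andThen c').fin st = c'.fin (c.fin st) := by
  simp [andThen]

@[simp] theorem val_andThen (c : Comp Unit) (c' : Comp α) (st : Store) :
    (c.andThen c').val st = c'.val (c.fin st) := by
  simp [andThen]

def forEach : List ι → (ι → Comp Unit) → Comp Unit
  | [], _ => .pure ()
  | i :: l, body => (body i).andThen (forEach l body)

/-- Execute the body for all elements of a finite set, in some order. -/
def forAll (s : Finset ι) (body : ι → Comp Unit) : Comp Unit := forEach s.toList body

/-- The invariant depends on the set T of indices already treated, and the step is required for
every T that omits i. Hence the unspecified order in which `forAll` enumerates a finite set plays no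
role. -/
theorem forEach_inv [DecidableEq ι] (P : Finset ι → Store → Prop) (body : ι → Comp Unit) (l : List ι)
    (hl : l.Nodup) (T : Finset ι) (hT : ∀ i ∈ l, i ∉ T) (st : Store) (h0 : P T st)
    (hstep : ∀ i ∈ l, ∀ T st, i ∉ T → P T st → P (insert i T) ((body i).fin st)) :
    P (T ∪ l.toFinset) ((forEach l body).fin st) := by
  induction l generalizing T st with
  | nil => simpa [forEach] using h0
  | cons i l ih =>
    rw [List.nodup_cons] at hl
    have h1 := hstep i (by simp) T st (hT i (by simp)) h0
    have := ih hl.2 (insert i T) (fun j hj => by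
      rw [Finset.mem_insert, not_or]
      exact ⟨fun e => hl.1 (e ▸ hj), hT j (by simp [hj])⟩) _ h1
      (fun j hj => hstep j (by simp [hj]))
    simp only [forEach, fin_andThen]
    convert this using 1
    ext j; simp

theorem forAll_inv [DecidableEq ι] (P : Finset ι → Store → Prop) (body : ι → Comp Unit) (s : Finset ι)
    (st : Store) (h0 : P ∅ st)
    (hstep : ∀ i ∈ s, ∀ T st, i ∉ T → P T st → P (insert i T) ((body i).fin st)) :
    P s ((forAll s body).fin st) := by
  have := forEach_inv P body s.toList s.nodup_toList ∅ (by simp) st h0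
    (fun i hi => hstep i (by simpa using hi))
  simpa [forAll] using this

/-- A loop whose iterations write to distinct words, each computed from words that the other
iterations do not change. -/
theorem forAll_parallel (s : Finset ι) (body : ι → Comp Unit) (C : ι → Addr)
    (g : ι → Store → ℝ) (X : Set Addr) (hC : Set.InjOn C s)
    (hX : ∀ i ∈ s, C i ∉ X)
    (hbody : ∀ i ∈ s, ∀ st, (body i).fin st (C i) = g i st)
    (hframe : ∀ i ∈ s, ∀ st a, a ≠ C i → a ∉ X → (body i).fin st a = st a)
    (hg : ∀ i ∈ s, ∀ st st' : Store,
      (∀ a ∉ X, (∀ j ∈ s, j ≠ i → a ≠ C j) → st a = st' a) → g i st = g i st')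
    (st : Store) :
    (∀ i ∈ s, (forAll s body).fin st (C i) = g i st) ∧
    (∀ a ∉ X, (∀ i ∈ s, a ≠ C i) → (forAll s body).fin st a = st a) := by
  classical
  have := forAll_inv (fun T st' => T ⊆ s →
    (∀ i ∈ T, st' (C i) = g i st) ∧ (∀ a ∉ X, (∀ i ∈ T, a ≠ C i) → st' a = st a)) body s st
    (by simp) ?_
  · exact this subset_rfl
  · intro i hi T st' hiT hP hT
    have hTs : T ⊆ s := (Finset.subset_insert i T).trans hT
    obtain ⟨h1, h2⟩ := hP hTs
    constructor
    · intro j hj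
      rw [Finset.mem_insert] at hj
      by_cases e : j = i
      · subst e
        rw [hbody j hi]
        apply hg j hi
        intro a haX ha
        exact h2 a haX fun l hl => ha l (hTs hl) (fun e => hiT (e ▸ hl))
      · have hj := hj.resolve_left e
        rw [hframe i hi _ _ (fun e' => e (hC (hTs hj) hi e')) (hX j (hTs hj)), h1 j hj]
    · intro a haX ha
      rw [hframe i hi _ _ (ha i (by simp)) haX]
      exact h2 a haX fun l hl => ha l (by simp [hl])

/-! ### Resources -/

/-- The program touches only words in `S` and executes at most `n` operations. -/
def Bdd (S : Set Addr) : Comp α → ℕ → Prop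
  | .pure _, _ => True
  | .op _ _ _ _ _, 0 => False
  | .op _ x y d c, n + 1 => x ∈ S ∧ y ∈ S ∧ d ∈ S ∧ c.Bdd S n
  | .branch _ _ _ _, 0 => False
  | .branch x y c c', n + 1 => x ∈ S ∧ y ∈ S ∧ c.Bdd S n ∧ c'.Bdd S n

theorem Bdd.mono {S S' : Set Addr} (hS : S ⊆ S') {c : Comp α} {n n' : ℕ} (hn : n ≤ n')
    (h : c.Bdd S n) : c.Bdd S' n' := by
  induction c generalizing n n' with
  | pure a => trivial
  | op o x y d c ih =>
    cases n with
    | zero => exact h.elim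
    | succ n =>
      obtain ⟨n', rfl⟩ : ∃ l, n' = l + 1 := ⟨n' - 1, by omega⟩
      exact ⟨hS h.1, hS h.2.1, hS h.2.2.1, ih (by omega) h.2.2.2⟩
  | branch x y c c' ih ih' =>
    cases n with
    | zero => exact h.elim
    | succ n =>
      obtain ⟨n', rfl⟩ : ∃ l, n' = l + 1 := ⟨n' - 1, by omega⟩
      exact ⟨hS h.1, hS h.2.1, ih (by omega) h.2.2.1, ih' (by omega) h.2.2.2⟩

theorem Bdd.bind {S : Set Addr} {c : Comp α} {f : α → Comp β} {n n' : ℕ}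
    (h : c.Bdd S n) (h' : ∀ a, (f a).Bdd S n') : (c.bind f).Bdd S (n + n') := by
  induction c generalizing n with
  | pure a => exact (h' a).mono subset_rfl (by omega)
  | op o x y d c ih =>
    cases n with
    | zero => exact h.elim
    | succ n =>
      rw [Nat.succ_add]
      exact ⟨h.1, h.2.1, h.2.2.1, ih h.2.2.2⟩
  | branch x y c c' ih ih' =>
    cases n with
    | zero => exact h.elim
    | succ n =>
      rw [Nat.succ_add]
      exact ⟨h.1, h.2.1, ih h.2.2.1, ih' h.2.2.2⟩

theorem Bdd.andThen {S : Set Addr} {c : Comp Unit} {c' : Comp α} {n n' : ℕ}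
    (h : c.Bdd S n) (h' : c'.Bdd S n') : (c.andThen c').Bdd S (n + n') :=
  h.bind fun _ => h'

theorem bdd_step {S : Set Addr} (o : Op) {x y d : Addr} (hx : x ∈ S) (hy : y ∈ S) (hd : d ∈ S) :
    (step o x y d).Bdd S 1 := ⟨hx, hy, hd, trivial⟩

theorem bdd_pure {S : Set Addr} (a : α) : (pure a).Bdd S 0 := trivial

theorem bdd_forEach {S : Set Addr} {body : ι → Comp Unit} {n : ℕ} (l : List ι)
    (h : ∀ i ∈ l, (body i).Bdd S n) : (forEach l body).Bdd S (l.length * n) := by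
  induction l with
  | nil => trivial
  | cons i l ih =>
    have := (h i (by simp)).andThen (ih fun j hj => h j (by simp [hj]))
    exact this.mono subset_rfl (by simp [add_mul, add_comm])

theorem bdd_forAll {S : Set Addr} {body : ι → Comp Unit} {n : ℕ} (s : Finset ι)
    (h : ∀ i ∈ s, (body i).Bdd S n) : (forAll s body).Bdd S (s.card * n) := by
  have := bdd_forEach s.toList (S := S) (body := body) (n := n) (by simpa using h)
  simpa [forAll] using this

/-- The program can be run on the machine with `M` words of fast memory, with at most `W` words
moved and at most `F` operations. -/
def Cost (M : ℕ) (c : Comp α) (W F : ℕ) : Prop :=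
  ∃ comp : (α → Prog M) → Prog M, ∀ {N : ℕ} (D : Diagonalizer N)
    (far : Matrix (Fin N) (Fin N) ℝ → Prop) (k : α → Prog M) (f : Fin M → ℝ) (st : Store),
    ∃ w ≤ W, ∃ t ≤ F, ∃ f' : Fin M → ℝ, (comp k).run D far (memOf f st) =
      ((k (c.val st)).run D far (memOf f' (c.fin st))).charge w t

theorem Cost.mono {M : ℕ} {c : Comp α} {W F W' F' : ℕ} (h : c.Cost M W F) (hW : W ≤ W')
    (hF : F ≤ F') : c.Cost M W' F' := by
  obtain ⟨comp, h⟩ := h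
  refine ⟨comp, fun D far k f st => ?_⟩
  obtain ⟨w, hw, t, ht, f', h⟩ := h D far k f st
  exact ⟨w, hw.trans hW, t, ht.trans hF, f', h⟩

theorem cost_pure {M : ℕ} (a : α) : (pure a).Cost M 0 0 :=
  ⟨fun k => k a, fun _ _ _ f _ => ⟨0, le_rfl, 0, le_rfl, f, (charge_zero _).symm⟩⟩

/-- The result of a computation is known at each leaf of its decision tree, so a separate
compilation of `g a` can be chosen for every `a` and grafted there as the continuation. -/
theorem Cost.bind {M : ℕ} {c : Comp α} {g : α → Comp β} {W F W' F' : ℕ} (h : c.Cost M W F)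
    (h' : ∀ a, (g a).Cost M W' F') : (c.bind g).Cost M (W + W') (F + F') := by
  obtain ⟨comp, h⟩ := h
  choose comp' h' using h'
  refine ⟨fun k => comp fun a => comp' a k, fun D far k f st => ?_⟩
  obtain ⟨w, hw, t, ht, f', h⟩ := h D far (fun a => comp' a k) f st
  obtain ⟨w', hw', t', ht', f'', h'⟩ := h' (c.val st) D far k f' (c.fin st)
  refine ⟨w + w', by omega, t + t', by omega, f'', ?_⟩
  rw [h, h', charge_charge, val_bind, fin_bind]

theorem Cost.andThen {M : ℕ} {c : Comp Unit} {c' : Comp α} {W F W' F' : ℕ} (h : c.Cost M W F)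
    (h' : c'.Cost M W' F') : (c.andThen c').Cost M (W + W') (F + F') :=
  h.bind fun _ => h'

theorem cost_forEach {M : ℕ} {body : ι → Comp Unit} {W F : ℕ} (l : List ι)
    (h : ∀ i ∈ l, (body i).Cost M W F) :
    (forEach l body).Cost M (l.length * W) (l.length * F) := by
  induction l with
  | nil => simpa [forEach] using cost_pure ()
  | cons i l ih =>
    have := (h i (by simp)).andThen (ih fun j hj => h j (by simp [hj]))
    exact this.mono (by simp [add_mul, add_comm]) (by simp [add_mul, add_comm])

theorem cost_forAll {M : ℕ} {body : ι → Comp Unit} {W F : ℕ} (s : Finset ι)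
    (h : ∀ i ∈ s, (body i).Cost M W F) :
    (forAll s body).Cost M (s.card * W) (s.card * F) := by
  have := cost_forEach (M := M) s.toList (body := body) (W := W) (F := F) (by simpa using h)
  simpa [forAll] using this

end Comp

/-! ### Compilation to the machine, with operands in slow or in fast memory -/

/-- Machine code for `d := o x y` in fast memory, with temporary words `t₀`, `t₁`. -/
def Op.code {M : ℕ} (o : Op) (x y d t₀ t₁ : Fin M) (next : Prog M) : Prog M :=
  match o with
  | .const c => .const c d next
  | .lin c c' => .const c t₀ <| .arith .mul x t₀ t₀ <| .const c' t₁ <| .arith .mul y t₁ t₁ <|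
      .arith .add t₀ t₁ d next
  | .bin op => .arith op x y d next
  | .sqrt => .sqrt x d next

/-- Neither `t₁ ≠ x` nor `d ≠ t₀` is assumed: in a linear combination `x` has been consumed before
`t₁` is written. Three registers therefore suffice, which is all that M ≥ 3 provides. The bound 5 is
the length of the code for a linear combination. -/
theorem Op.run_code {M N : ℕ} (o : Op) {x y d t₀ t₁ : Fin M} (hx : t₀ ≠ x) (hy : t₀ ≠ y)
    (hy' : t₁ ≠ y) (ht : t₀ ≠ t₁) (D : Diagonalizer N)
    (far : Matrix (Fin N) (Fin N) ℝ → Prop) (next : Prog M) (f : Fin M → ℝ) (st : Store) :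
    ∃ t ≤ 5, ∃ f' : Fin M → ℝ, f' d = o.eval (f x) (f y) ∧
      (∀ a, a ≠ d → a ≠ t₀ → a ≠ t₁ → f' a = f a) ∧
      (o.code x y d t₀ t₁ next).run D far (memOf f st) =
        (next.run D far (memOf f' st)).charge 0 t := by
  cases o with
  | const c =>
    refine ⟨1, by norm_num, Function.update f d c, by simp [Op.eval],
      fun a h _ _ => by simp [h], rfl⟩
  | bin op =>
    refine ⟨1, by norm_num, Function.update f d (op.eval (f x) (f y)), by simp [Op.eval],
      fun a h _ _ => by simp [h], rfl⟩
  | sqrt =>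
    refine ⟨1, by norm_num, Function.update f d (Real.sqrt (f x)), by simp [Op.eval],
      fun a h _ _ => by simp [h], rfl⟩
  | lin c c' =>
    let f₁ := Function.update f t₀ c
    let f₂ := Function.update f₁ t₀ (f₁ x * f₁ t₀)
    let f₃ := Function.update f₂ t₁ c'
    let f₄ := Function.update f₃ t₁ (f₃ y * f₃ t₁)
    refine ⟨5, le_rfl, Function.update f₄ d (f₄ t₀ + f₄ t₁), ?_, ?_, ?_⟩
    rotate_left 2
    · simp only [Op.code, Prog.run, memOf_setFast, charge_charge]
      rfl
    · simp [f₁, f₂, f₃, f₄, Op.eval, hx.symm, hy.symm, hy'.symm, ht]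
    · intro a h h' h''
      simp [f₁, f₂, f₃, f₄, h, h', h'']

theorem run_load {M N : ℕ} (D : Diagonalizer N) (far : Matrix (Fin N) (Fin N) ℝ → Prop)
    (p : Prog M) (a : Addr) (d : Fin M) (f : Fin M → ℝ) (st : Store) :
    (Prog.load a.1 a.2.1 a.2.2 d p).run D far (memOf f st) =
      (p.run D far (memOf (Function.update f d (st a)) st)).charge 1 0 := rfl

theorem run_store {M N : ℕ} (D : Diagonalizer N) (far : Matrix (Fin N) (Fin N) ℝ → Prop)
    (p : Prog M) (a : Addr) (x : Fin M) (f : Fin M → ℝ) (st : Store) :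
    (Prog.store x a.1 a.2.1 a.2.2 p).run D far (memOf f st) =
      (p.run D far (memOf f (Function.update st a (f x)))).charge 1 0 := by
  rw [Prog.run, memOf_setSlow]; rfl

theorem run_branch {M N : ℕ} (D : Diagonalizer N) (far : Matrix (Fin N) (Fin N) ℝ → Prop)
    (p q : Prog M) (x y : Fin M) (f : Fin M → ℝ) (st : Store) :
    (Prog.branch x y p q).run D far (memOf f st) =
      (if f x < f y then p.run D far (memOf f st) else q.run D far (memOf f st)).charge 0 1 := by
  rw [Prog.run]; congr 1

namespace Comp

variable {α : Type}

/-- Compilation that moves the operands of every operation. -/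
def compileSlow {M : ℕ} (r₀ r₁ r₂ : Fin M) : Comp α → (α → Prog M) → Prog M
  | .pure a, k => k a
  | .op o x y d c, k => .load x.1 x.2.1 x.2.2 r₀ <| .load y.1 y.2.1 y.2.2 r₁ <|
      o.code r₀ r₁ r₂ r₂ r₀ <| .store r₂ d.1 d.2.1 d.2.2 (c.compileSlow r₀ r₁ r₂ k)
  | .branch x y c c', k => .load x.1 x.2.1 x.2.2 r₀ <| .load y.1 y.2.1 y.2.2 r₁ <|
      .branch r₀ r₁ (c.compileSlow r₀ r₁ r₂ k) (c'.compileSlow r₀ r₁ r₂ k)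

/-- Every operation loads two operands and stores one result, and nothing in fast memory has to
survive to the next operation. `r₀` and `r₂` double as the temporaries of `Op.code`. -/
theorem Bdd.cost_slow {M : ℕ} (hM : 3 ≤ M) {S : Set Addr} {c : Comp α} {n : ℕ}
    (h : c.Bdd S n) : c.Cost M (3 * n) (5 * n) := by
  let r₀ : Fin M := ⟨0, by omega⟩
  let r₁ : Fin M := ⟨1, by omega⟩
  let r₂ : Fin M := ⟨2, by omega⟩
  refine ⟨c.compileSlow r₀ r₁ r₂, fun D far k => ?_⟩
  induction c generalizing n with
  | pure a => exact fun f st => ⟨0, by omega, 0, by omega, f, (charge_zero _).symm⟩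
  | op o x y d c ih =>
    intro f st
    cases n with
    | zero => exact h.elim
    | succ n =>
      obtain ⟨t, ht, f', hd, -, hrun⟩ := Op.run_code (M := M) o (x := r₀) (y := r₁) (d := r₂)
        (t₀ := r₂) (t₁ := r₀) (by simp [r₀, r₂]) (by simp [r₁, r₂]) (by simp [r₀, r₁])
        (by simp [r₀, r₂]) D far (.store r₂ d.1 d.2.1 d.2.2 (c.compileSlow r₀ r₁ r₂ k))
        (Function.update (Function.update f r₀ (st x)) r₁ (st y)) st
      obtain ⟨w', hw', t', ht', f'', h'⟩ := ih h.2.2.2 f' (Function.update st d (f' r₂))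
      refine ⟨1 + 1 + 0 + 1 + w', by omega, t + 0 + t', by omega, f'', ?_⟩
      have e : Function.update st d (f' r₂) = Function.update st d (o.eval (st x) (st y)) := by
        rw [hd]
        simp [show r₀ ≠ r₁ by simp [r₀, r₁]]
      rw [compileSlow, run_load, run_load, hrun, run_store, h', e, charge_charge, charge_charge,
        charge_charge, charge_charge]
      simp only [zero_add]
      rfl
  | branch x y c c' ih ih' =>
    intro f st
    cases n with
    | zero => exact h.elim
    | succ n =>
      simp only [compileSlow, run_load, run_branch]
      set g := Function.update (Function.update f r₀ (st x)) r₁ (st y) with hg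
      have h0 : g r₀ = st x := by simp [hg, show r₀ ≠ r₁ by simp [r₀, r₁]]
      have h1 : g r₁ = st y := by simp [hg]
      simp only [h0, h1]
      by_cases hxy : st x < st y
      · obtain ⟨w', hw', t', ht', f'', h'⟩ := ih h.2.2.1 g st
        refine ⟨1 + 1 + w', by omega, 1 + t', by omega, f'', ?_⟩
        rw [if_pos hxy, h', charge_charge, charge_charge, charge_charge]
        simp only [Nat.add_zero, Nat.zero_add]
        simp [val, fin, exec, hxy]
      · obtain ⟨w', hw', t', ht', f'', h'⟩ := ih' h.2.2.2 g st
        refine ⟨1 + 1 + w', by omega, 1 + t', by omega, f'', ?_⟩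
        rw [if_neg hxy, h', charge_charge, charge_charge, charge_charge]
        simp [val, fin, exec, hxy]

/-- Compilation for operands that stay in fast memory, at the places given by `e`. -/
def compileFast {M : ℕ} (e : Addr → Fin M) (t₀ t₁ : Fin M) : Comp α → (α → Prog M) → Prog M
  | .pure a, k => k a
  | .op o x y d c, k => o.code (e x) (e y) (e d) t₀ t₁ (c.compileFast e t₀ t₁ k)
  | .branch x y c c', k =>
      .branch (e x) (e y) (c.compileFast e t₀ t₁ k) (c'.compileFast e t₀ t₁ k)

theorem Bdd.fin_eq {S : Set Addr} {c : Comp α} {n : ℕ} (h : c.Bdd S n) (st : Store) {a : Addr}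
    (ha : a ∉ S) : c.fin st a = st a := by
  induction c generalizing n st with
  | pure _ => rfl
  | op o x y d c ih =>
    cases n with
    | zero => exact h.elim
    | succ n =>
      have := ih h.2.2.2 (Function.update st d (o.eval (st x) (st y)))
      rw [show (Comp.op o x y d c).fin st = c.fin _ from rfl, this,
        Function.update_of_ne (ne_of_mem_of_not_mem h.2.2.1 ha).symm]
  | branch x y c c' ih ih' =>
    cases n with
    | zero => exact h.elim
    | succ n =>
      simp only [fin, exec]
      split_ifs
      · exact ih h.2.2.1 st
      · exact ih' h.2.2.2 st

/-- Slow memory stays frozen at `st₀` while fast memory simulates the evolving store `st` on the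
working set `S`; the two stores are unrelated in the induction. -/
theorem run_compileFast {M N : ℕ} {S : Set Addr} (e : Addr → Fin M) (t₀ t₁ : Fin M)
    (he : Set.InjOn e S) (h₀ : ∀ a ∈ S, e a ≠ t₀) (h₁ : ∀ a ∈ S, e a ≠ t₁) (ht : t₀ ≠ t₁)
    (D : Diagonalizer N) (far : Matrix (Fin N) (Fin N) ℝ → Prop) (k : α → Prog M) (st₀ : Store)
    (c : Comp α) (n : ℕ) (h : c.Bdd S n) (f : Fin M → ℝ) (st : Store)
    (hf : ∀ a ∈ S, f (e a) = st a) :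
    ∃ t ≤ 5 * n, ∃ f' : Fin M → ℝ, (∀ a ∈ S, f' (e a) = c.fin st a) ∧
      (c.compileFast e t₀ t₁ k).run D far (memOf f st₀) =
        ((k (c.val st)).run D far (memOf f' st₀)).charge 0 t := by
  induction c generalizing n f st with
  | pure a => exact ⟨0, by omega, f, hf, (charge_zero _).symm⟩
  | op o x y d c ih =>
    cases n with
    | zero => exact h.elim
    | succ n =>
      obtain ⟨t, ht', f', hd, hf', hrun⟩ := o.run_code (d := e d) (h₀ x h.1).symm
        (h₀ y h.2.1).symm (h₁ y h.2.1).symm ht D far (c.compileFast e t₀ t₁ k) f st₀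
      obtain ⟨t', ht'', f'', hf'', hrun'⟩ := ih n h.2.2.2 f'
        (Function.update st d (o.eval (st x) (st y))) (fun a ha => by
          by_cases had : a = d
          · subst had
            rw [hd, hf x h.1, hf y h.2.1, Function.update_self]
          · rw [hf' _ (fun e' => had (he ha h.2.2.1 e')) (h₀ a ha) (h₁ a ha),
              Function.update_of_ne had, hf a ha])
      refine ⟨t + t', by omega, f'', hf'', ?_⟩
      rw [compileFast, hrun, hrun', charge_charge]
      rfl
  | branch x y c c' ih ih' =>
    cases n with
    | zero => exact h.elim
    | succ n =>
      simp only [compileFast, run_branch, hf x h.1, hf y h.2.1]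
      by_cases hxy : st x < st y
      · obtain ⟨t', ht', f'', hf'', h'⟩ := ih n h.2.2.1 f st hf
        refine ⟨1 + t', by omega, f'', by simpa [fin, exec, hxy] using hf'', ?_⟩
        rw [if_pos hxy, h', charge_charge]
        simp [val, exec, hxy]
      · obtain ⟨t', ht', f'', hf'', h'⟩ := ih' n h.2.2.2 f st hf
        refine ⟨1 + t', by omega, f'', by simpa [fin, exec, hxy] using hf'', ?_⟩
        rw [if_neg hxy, h', charge_charge]
        simp [val, exec, hxy]

/-- Load the words in the list to their places in fast memory. -/
def loadAll {M : ℕ} (e : Addr → Fin M) : List Addr → Prog M → Prog M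
  | [], k => k
  | a :: l, k => .load a.1 a.2.1 a.2.2 (e a) (loadAll e l k)

/-- Store the words in the list from their places in fast memory. -/
def storeAll {M : ℕ} (e : Addr → Fin M) : List Addr → Prog M → Prog M
  | [], k => k
  | a :: l, k => .store (e a) a.1 a.2.1 a.2.2 (storeAll e l k)

/-- The disjunction makes the induction work: a word is correct at the end if it is still to be
loaded or is in its place already, and by injectivity of `e` no other load spoils it. -/
theorem run_loadAll {M N : ℕ} {S : Set Addr} (e : Addr → Fin M) (he : Set.InjOn e S)
    (D : Diagonalizer N) (far : Matrix (Fin N) (Fin N) ℝ → Prop) (k : Prog M) (st : Store)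
    (l : List Addr) (hl : ∀ a ∈ l, a ∈ S) (f : Fin M → ℝ) :
    ∃ f' : Fin M → ℝ, (∀ a ∈ S, (a ∈ l ∨ f (e a) = st a) → f' (e a) = st a) ∧
      (loadAll e l k).run D far (memOf f st) =
        (k.run D far (memOf f' st)).charge l.length 0 := by
  induction l generalizing f with
  | nil => exact ⟨f, by simp, (charge_zero _).symm⟩
  | cons a l ih =>
    obtain ⟨f', hf', h⟩ := ih (fun b hb => hl b (by simp [hb])) (Function.update f (e a) (st a))
    refine ⟨f', fun b hb h => hf' b hb ?_, ?_⟩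
    · by_cases hab : b = a
      · right; simp [hab]
      · rcases h with h | h
        · left; simpa [hab] using h
        · right
          rw [Function.update_of_ne (fun e' => hab (he hb (hl a (by simp)) e')), h]
    · simp only [loadAll, Prog.run, memOf_setFast]
      rw [show (memOf f st).slow a.1 a.2.1 a.2.2 = st a from rfl, h, charge_charge]
      simp [add_comm]

theorem run_storeAll {M N : ℕ} (e : Addr → Fin M) (D : Diagonalizer N)
    (far : Matrix (Fin N) (Fin N) ℝ → Prop) (k : Prog M) (f : Fin M → ℝ)
    (l : List Addr) (st : Store) :
    (storeAll e l k).run D far (memOf f st) =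
      (k.run D far (memOf f fun a => if a ∈ l then f (e a) else st a)).charge l.length 0 := by
  induction l generalizing st with
  | nil => simp [storeAll, charge_zero]
  | cons a l ih =>
    simp only [storeAll, Prog.run, memOf_setSlow]
    rw [ih, charge_charge, List.length_cons, add_comm]
    congr 4
    funext b
    by_cases hab : b = a
    · subst hab; simp [memOf]
    · by_cases hb : b ∈ l <;> simp [hab, hb, Function.update_of_ne]

/-- The working set is loaded once and stored once, however many operations act on it. It occupies
the first `S.card` places of fast memory; the two places after them are the temporaries, whence the
`+ 2`. -/
theorem Bdd.cost_fast {M : ℕ} {S : Finset Addr} (hS : S.card + 2 ≤ M) {c : Comp α} {n : ℕ}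
    (h : c.Bdd S n) : c.Cost M (2 * S.card) (5 * n) := by
  classical
  let t₀ : Fin M := ⟨S.card, by omega⟩
  let t₁ : Fin M := ⟨S.card + 1, by omega⟩
  let e : Addr → Fin M := fun a => if ha : a ∈ S then
    Fin.castLE (by omega) (S.equivFin ⟨a, ha⟩) else t₀
  have he' : ∀ a (ha : a ∈ S), (e a : ℕ) = S.equivFin ⟨a, ha⟩ := fun a ha => by simp [e, ha]
  have he : Set.InjOn e (S : Set Addr) := by
    intro a ha b hb hab
    have := congrArg Fin.val hab
    rw [he' a ha, he' b hb] at this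
    simpa using S.equivFin.injective (Fin.ext this)
  have h₀ : ∀ a ∈ (S : Set Addr), e a ≠ t₀ := fun a ha hab => by
    have := congrArg Fin.val hab
    rw [he' a ha] at this
    have := (S.equivFin ⟨a, ha⟩).2
    simp only [t₀] at *; omega
  have h₁ : ∀ a ∈ (S : Set Addr), e a ≠ t₁ := fun a ha hab => by
    have := congrArg Fin.val hab
    rw [he' a ha] at this
    have := (S.equivFin ⟨a, ha⟩).2
    simp only [t₁] at *; omega
  refine ⟨fun k => loadAll e S.toList (c.compileFast e t₀ t₁ fun a => storeAll e S.toList (k a)),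
    fun D far k f st => ?_⟩
  obtain ⟨f₁, hf₁, hr₁⟩ := run_loadAll e he D far
    (c.compileFast e t₀ t₁ fun a => storeAll e S.toList (k a)) st S.toList (by simp) f
  obtain ⟨t, ht, f₂, hf₂, hr₂⟩ := run_compileFast e t₀ t₁ he h₀ h₁ (by simp [t₀, t₁]) D far
    (fun a => storeAll e S.toList (k a)) st c n h f₁ st (fun a ha => hf₁ a ha (by simp_all))
  refine ⟨S.card + 0 + S.card, by omega, t + 0, by omega, f₂, ?_⟩
  rw [hr₁, hr₂, run_storeAll, charge_charge, charge_charge, Finset.length_toList]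
  have e : (fun a => if a ∈ S.toList then f₂ (e a) else st a) = c.fin st := by
    funext a
    by_cases ha : a ∈ S
    · simp [ha, hf₂ a ha]
    · simp [ha, h.fin_eq st (a := a) (by simpa using ha)]
  rw [e, zero_add]

end Comp

/-! ### Recursive bilinear multiplication in scratch memory -/

open JacobiIO.Comp Finset

/-- Scratch words for recursive multiplication: result and operands at level `l`. -/
def sC (l i j : ℕ) : Addr := (10 + 3 * l, i, j)
def sA (l i j : ℕ) : Addr := (11 + 3 * l, i, j)
def sB (l i j : ℕ) : Addr := (12 + 3 * l, i, j)

theorem sum_range_block {E : Type*} [AddCommMonoid E] (n K : ℕ) (f : ℕ → E) :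
    ∑ t ∈ range (n * K), f t = ∑ q ∈ range n, ∑ z ∈ range K, f (q * K + z) := by
  induction n with
  | zero => simp
  | succ n ih => rw [add_mul, one_mul, sum_range_add, ih, sum_range_succ]

/-- There are always m / q + 1 chunks; the last one is short, and empty if q divides m. Truncated
subtraction gives it the right length. -/
theorem sum_range_chunk {E : Type*} [AddCommMonoid E] (m q : ℕ) (hq : 0 < q) (f : ℕ → E) :
    ∑ u ∈ range (m / q + 1), ∑ t ∈ range (min q (m - u * q)), f (u * q + t) =
      ∑ t ∈ range m, f t := by
  have h1 : ∀ u, ∑ t ∈ range (min q (m - u * q)), f (u * q + t) =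
      ∑ t ∈ range q, if u * q + t < m then f (u * q + t) else 0 := fun u => by
    rw [← sum_filter]
    congr 1
    ext t
    simp only [mem_range, mem_filter]
    omega
  simp_rw [h1]
  rw [← sum_range_block (m / q + 1) q fun t => if t < m then f t else 0, ← sum_filter]
  congr 1
  ext t
  have := Nat.lt_div_mul_add hq (a := m)
  simp only [mem_range, mem_filter, add_mul, one_mul]
  omega

/-- `d := ∑ i ∈ s, c i * x i`. -/
def lincomb {ι : Type} (d : Addr) (s : Finset ι) (c : ι → ℝ) (x : ι → Addr) : Comp Unit :=
  (step (.const 0) d d d).andThen (forAll s fun i => step (.lin (c i) 1) (x i) d d)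

theorem fin_lincomb {ι : Type} (d : Addr) (s : Finset ι) (c : ι → ℝ) (x : ι → Addr)
    (hx : ∀ i ∈ s, x i ≠ d) (st : Store) :
    (lincomb d s c x).fin st d = ∑ i ∈ s, c i * st (x i) := by
  classical
  rw [lincomb, fin_andThen]
  refine (forAll_inv (fun T st' => T ⊆ s → st' d = ∑ i ∈ T, c i * st (x i) ∧
    ∀ a, a ≠ d → st' a = st a) _ s _ ?_ ?_ subset_rfl).1
  · intro _
    simp only [fin_step]
    exact ⟨by simp [Op.eval], fun a ha => by simp [ha]⟩
  · intro i hi T st' hiT hP hT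
    obtain ⟨h1, h2⟩ := hP ((subset_insert i T).trans hT)
    simp only [fin_step]
    refine ⟨?_, fun a ha => by simp [ha, h2 a ha]⟩
    rw [sum_insert hiT, ← h1, ← h2 _ (hx i hi)]
    simp [Op.eval, mul_comm]

theorem bdd_lincomb {ι : Type} {S : Set Addr} {d : Addr} {s : Finset ι} {c : ι → ℝ}
    {x : ι → Addr} (hd : d ∈ S) (hx : ∀ i ∈ s, x i ∈ S) :
    (lincomb d s c x).Bdd S (1 + s.card * 1) :=
  (bdd_step _ hd hd hd).andThen (bdd_forAll s fun i hi => bdd_step _ (hx i hi) hd hd)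

theorem fin_lincomb_of_ne {ι : Type} (d : Addr) (s : Finset ι) (c : ι → ℝ) (x : ι → Addr)
    (st : Store) {a : Addr} (ha : a ≠ d) : (lincomb d s c x).fin st a = st a := by
  classical
  rw [lincomb, fin_andThen]
  refine forAll_inv (fun T st' => st' a = st a) _ s _ ?_ ?_
  · simp [ha]
  · intro i hi T st' hiT hP
    simp [ha, hP]

/-- Words `(i, j)` with `i < h` and `j < w`. -/
def box (h w : ℕ) : Finset (ℕ × ℕ) := range h ×ˢ range w

@[simp] theorem mem_box {h w : ℕ} {x : ℕ × ℕ} : x ∈ box h w ↔ x.1 < h ∧ x.2 < w := by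
  simp [box]

@[simp] theorem card_box (h w : ℕ) : (box h w).card = h * w := by simp [box]

section Mul

variable (S : StrassenLike)

/-- Coefficientwise linear combination of the blocks of a matrix. -/
def blockComb (K : ℕ) (c : Matrix (Fin S.k) (Fin S.k) ℝ) (D A : ℕ → ℕ → Addr) : Comp Unit :=
  forAll (box K K) fun x => lincomb (D x.1 x.2) (univ : Finset (Fin S.k × Fin S.k))
    (fun p => c p.1 p.2) (fun p => A (p.1 * K + x.1) (p.2 * K + x.2))

theorem fin_blockComb (K : ℕ) (c : Matrix (Fin S.k) (Fin S.k) ℝ) (D A : ℕ → ℕ → Addr)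
    (hD : ∀ i j i' j', D i j = D i' j' → i = i' ∧ j = j') (hDA : ∀ i j i' j', A i j ≠ D i' j')
    (st : Store) :
    (∀ i j, i < K → j < K → (blockComb S K c D A).fin st (D i j) =
      ∑ p : Fin S.k × Fin S.k, c p.1 p.2 * st (A (p.1 * K + i) (p.2 * K + j))) ∧
    (∀ a, (∀ i j, a ≠ D i j) → (blockComb S K c D A).fin st a = st a) := by
  obtain ⟨h1, h2⟩ := forAll_parallel (box K K) (fun x => lincomb (D x.1 x.2)
    (univ : Finset (Fin S.k × Fin S.k)) (fun p => c p.1 p.2)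
    (fun p => A (p.1 * K + x.1) (p.2 * K + x.2))) (fun x => D x.1 x.2)
    (fun x st => ∑ p : Fin S.k × Fin S.k, c p.1 p.2 * st (A (p.1 * K + x.1) (p.2 * K + x.2))) ∅
    (fun x _ y _ h => Prod.ext (hD _ _ _ _ h).1 (hD _ _ _ _ h).2) (by simp)
    (fun x _ st => fin_lincomb _ _ _ _ (fun p _ => hDA _ _ _ _) st)
    (fun x _ st a ha _ => fin_lincomb_of_ne _ _ _ _ st ha)
    (fun x _ st st' h => sum_congr rfl fun p _ => by
      rw [h _ (by simp) fun y _ _ => hDA _ _ _ _]) st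
  exact ⟨fun i j hi hj => h1 (i, j) (by simp [hi, hj]),
    fun a ha => h2 a (by simp) fun x _ => ha _ _⟩

theorem bdd_blockComb {X : Set Addr} (K : ℕ) (c : Matrix (Fin S.k) (Fin S.k) ℝ)
    (D A : ℕ → ℕ → Addr) (hD : ∀ i j, i < K → j < K → D i j ∈ X)
    (hA : ∀ i j, i < S.k * K → j < S.k * K → A i j ∈ X) :
    (blockComb S K c D A).Bdd X (K ^ 2 * (1 + S.k ^ 2)) := by
  refine (bdd_forAll _ (n := 1 + S.k ^ 2) fun x hx => ?_).mono subset_rfl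
    (by rw [card_box, ← sq])
  rw [mem_box] at hx
  have aux : ∀ (p : Fin S.k) (i : ℕ), i < K → p * K + i < S.k * K := fun p i hi =>
    calc p * K + i < (p + 1) * K := by rw [add_mul]; omega
      _ ≤ S.k * K := Nat.mul_le_mul_right _ p.2
  exact (bdd_lincomb (hD _ _ hx.1 hx.2) fun p _ => hA _ _ (aux _ _ hx.1) (aux _ _ hx.2)).mono
    subset_rfl (by simp [sq])

/-- Recursive multiplication of the `k ^ l × k ^ l` matrices in scratch memory of level `l`. -/
def mul : ℕ → Comp Unit
  | 0 => step (.bin .mul) (sA 0 0 0) (sB 0 0 0) (sC 0 0 0)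
  | l + 1 =>
    (forAll (box (S.k ^ (l + 1)) (S.k ^ (l + 1))) fun x =>
      step (.const 0) (sC (l + 1) x.1 x.2) (sC (l + 1) x.1 x.2) (sC (l + 1) x.1 x.2)).andThen <|
    forAll (univ : Finset (Fin S.r)) fun t =>
      (blockComb S (S.k ^ l) (S.α t) (sA l) (sA (l + 1))).andThen <|
      (blockComb S (S.k ^ l) (S.β t) (sB l) (sB (l + 1))).andThen <|
      (mul l).andThen <|
      forAll ((univ : Finset (Fin S.k × Fin S.k)) ×ˢ box (S.k ^ l) (S.k ^ l)) fun x =>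
        step (.lin (S.γ t x.1.1 x.1.2) 1) (sC l x.2.1 x.2.2)
          (sC (l + 1) (x.1.1 * S.k ^ l + x.2.1) (x.1.2 * S.k ^ l + x.2.2))
          (sC (l + 1) (x.1.1 * S.k ^ l + x.2.1) (x.1.2 * S.k ^ l + x.2.2))

theorem block_index_inj {K p i p' i' : ℕ} (hi : i < K) (hi' : i' < K)
    (h : p * K + i = p' * K + i') : p = p' ∧ i = i' := by
  have hK : 0 < K := by omega
  have h1 := congrArg (· / K) h
  have h2 := congrArg (· % K) h
  simp only [Nat.mul_add_mod_self_right, Nat.mod_eq_of_lt hi, Nat.mod_eq_of_lt hi'] at h2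
  rw [h2] at h
  exact ⟨Nat.eq_of_mul_eq_mul_right hK (Nat.add_right_cancel h), h2⟩

/-- For a fixed inner index z, the entries in position (i, z) of the blocks of A and in position (z,
j) of the blocks of B form scalar k × k matrices. The bilinear identity applies to these, and
summation over z gives block multiplication; no identity over a noncommutative ring is needed. -/
theorem StrassenLike.block_mul_eq (K : ℕ) (A B : ℕ → ℕ → ℝ) (I J : Fin S.k) (i j : ℕ) :
    ∑ t, S.γ t I J * ∑ z ∈ range K,
      (∑ p : Fin S.k × Fin S.k, S.α t p.1 p.2 * A (p.1 * K + i) (p.2 * K + z)) *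
      (∑ p : Fin S.k × Fin S.k, S.β t p.1 p.2 * B (p.1 * K + z) (p.2 * K + j)) =
    ∑ z ∈ range (S.k * K), A (I * K + i) z * B z (J * K + j) := by
  simp_rw [mul_sum (range K)]
  rw [sum_comm, sum_range_block,
    sum_comm (s := range S.k)]
  refine sum_congr (M := ℝ) rfl fun z _ => ?_
  have := S.mul_eq (Matrix.of fun p q => A (p * K + i) (q * K + z))
    (Matrix.of fun p q => B (p * K + z) (q * K + j)) I J
  simp only [Fintype.sum_prod_type]
  rw [← Fin.sum_univ_eq_sum_range (fun q : ℕ => A (I * K + i) (q * K + z) * B (q * K + z) (J * K + j)) S.k]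
  simpa only [Matrix.mul_apply, Matrix.of_apply] using this.symm

/-- The frame condition includes the operands of level l itself (arrays 11 + 3l and 12 + 3l) and all
higher levels. This is what lets the calling level accumulate its r products one after the other. -/
theorem fin_mul (l : ℕ) (st : Store) :
    (∀ i j, i < S.k ^ l → j < S.k ^ l → (mul S l).fin st (sC l i j) =
      ∑ z ∈ range (S.k ^ l), st (sA l i z) * st (sB l z j)) ∧
    (∀ a : Addr, (a.1 < 10 ∨ 10 + 3 * l < a.1) → (mul S l).fin st a = st a) := by
  induction l generalizing st with
  | zero =>
    constructor
    · intro i j hi hj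
      obtain rfl : i = 0 := by simpa using hi
      obtain rfl : j = 0 := by simpa using hj
      simp [mul, Op.eval, BinOp.eval]
    · intro a ha
      have : a ≠ sC 0 0 0 := by
        rintro rfl
        simp [sC] at ha
      simp [mul, this]
  | succ l ih =>
    set K := S.k ^ l with hK
    have hKs : S.k ^ (l + 1) = S.k * K := by rw [pow_succ, mul_comm]
    let A : ℕ → ℕ → ℝ := fun i j => st (sA (l + 1) i j)
    let B : ℕ → ℕ → ℝ := fun i j => st (sB (l + 1) i j)
    have aux : ∀ (p : Fin S.k) (i : ℕ), i < K → p * K + i < S.k * K := fun p i hi =>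
      calc p * K + i < (p + 1) * K := by rw [add_mul]; omega
        _ ≤ S.k * K := Nat.mul_le_mul_right _ p.2
    -- In block coordinates the loop over the r products has a simple invariant: the entry is the
    -- partial sum over the products done so far.
    have key : (∀ I J : Fin S.k, ∀ i j, i < K → j < K →
        (mul S (l + 1)).fin st (sC (l + 1) (I * K + i) (J * K + j)) =
        ∑ t, S.γ t I J * ∑ z ∈ range K,
          (∑ p : Fin S.k × Fin S.k, S.α t p.1 p.2 * A (p.1 * K + i) (p.2 * K + z)) *
          (∑ p : Fin S.k × Fin S.k, S.β t p.1 p.2 * B (p.1 * K + z) (p.2 * K + j))) ∧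
        (∀ a : Addr, (a.1 < 10 ∨ 10 + 3 * (l + 1) < a.1) →
          (mul S (l + 1)).fin st a = st a) := by
      rw [mul, fin_andThen]
      refine forAll_inv (fun T st' => (∀ I J : Fin S.k, ∀ i j, i < K → j < K →
        st' (sC (l + 1) (I * K + i) (J * K + j)) =
        ∑ t ∈ T, S.γ t I J * ∑ z ∈ range K,
          (∑ p : Fin S.k × Fin S.k, S.α t p.1 p.2 * A (p.1 * K + i) (p.2 * K + z)) *
          (∑ p : Fin S.k × Fin S.k, S.β t p.1 p.2 * B (p.1 * K + z) (p.2 * K + j))) ∧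
        (∀ a : Addr, (a.1 < 10 ∨ 10 + 3 * (l + 1) < a.1) → st' a = st a)) _ _ _ ?_ ?_
      · obtain ⟨h1, h2⟩ := forAll_parallel (box (S.k ^ (l + 1)) (S.k ^ (l + 1))) (fun x =>
          step (.const 0) (sC (l + 1) x.1 x.2) (sC (l + 1) x.1 x.2) (sC (l + 1) x.1 x.2))
          (fun x => sC (l + 1) x.1 x.2) (fun _ _ => 0) ∅
          (fun x _ y _ h => by simpa [sC, Prod.ext_iff] using h) (by simp)
          (fun x _ st => by simp [Op.eval]) (fun x _ st a ha _ => by simp [ha])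
          (fun _ _ _ _ _ => rfl) st
        constructor
        · intro I J i j hi hj
          rw [sum_empty]
          exact h1 (I * K + i, J * K + j) (by simpa [hKs] using ⟨aux I i hi, aux J j hj⟩)
        · intro a ha
          refine h2 a (by simp) fun x _ e => ?_
          simp only [e, sC] at ha
          omega
      · intro t _ T st' htT ⟨h1, h2⟩
        simp only [fin_andThen]
        obtain ⟨a1, a2⟩ := fin_blockComb S K (S.α t) (sA l) (sA (l + 1))
          (by simp [sA]) (by simp [sA]) st'
        set st₁ := (blockComb S K (S.α t) (sA l) (sA (l + 1))).fin st'
        obtain ⟨b1, b2⟩ := fin_blockComb S K (S.β t) (sB l) (sB (l + 1))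
          (by simp [sB]) (by simp [sB]) st₁
        set st₂ := (blockComb S K (S.β t) (sB l) (sB (l + 1))).fin st₁
        obtain ⟨c1, c2⟩ := ih st₂
        set st₃ := (mul S l).fin st₂
        obtain ⟨d1, d2⟩ := forAll_parallel
          ((univ : Finset (Fin S.k × Fin S.k)) ×ˢ box K K) (fun x =>
          step (.lin (S.γ t x.1.1 x.1.2) 1) (sC l x.2.1 x.2.2)
            (sC (l + 1) (x.1.1 * K + x.2.1) (x.1.2 * K + x.2.2))
            (sC (l + 1) (x.1.1 * K + x.2.1) (x.1.2 * K + x.2.2)))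
          (fun x => sC (l + 1) (x.1.1 * K + x.2.1) (x.1.2 * K + x.2.2))
          (fun x st => st (sC l x.2.1 x.2.2) * S.γ t x.1.1 x.1.2 +
            st (sC (l + 1) (x.1.1 * K + x.2.1) (x.1.2 * K + x.2.2)) * 1) ∅
          (by
            rintro ⟨⟨I, J⟩, i, j⟩ hx ⟨⟨I', J'⟩, i', j'⟩ hy h
            simp only [sC, Prod.mk.injEq, true_and] at h
            simp only [coe_product, Set.mem_prod, mem_coe, mem_box] at hx hy
            obtain ⟨e1, e2⟩ := block_index_inj hx.2.1 hy.2.1 h.1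
            obtain ⟨e3, e4⟩ := block_index_inj hx.2.2 hy.2.2 h.2
            simp [Fin.ext e1, Fin.ext e3, e2, e4])
          (by simp) (fun x _ st => by simp [Op.eval]) (fun x _ st a ha _ => by simp [ha])
          (by
            rintro ⟨⟨I, J⟩, i, j⟩ hx st st' h
            rw [h (sC l i j) (by simp) (fun y _ _ => by simp [sC]), h (sC (l + 1) _ _) (by simp)]
            rintro ⟨⟨I', J'⟩, i', j'⟩ hy hne h
            simp only [sC, Prod.mk.injEq, true_and] at h
            simp only [mem_product, mem_univ, true_and, mem_box] at hx hy
            obtain ⟨e1, e2⟩ := block_index_inj hx.1 hy.1 h.1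
            obtain ⟨e3, e4⟩ := block_index_inj hx.2 hy.2 h.2
            apply hne
            simp [Fin.ext e1, Fin.ext e3, e2, e4]) st₃
        -- Forming the operands and the recursive product leave the data of level l + 1 and all
        -- arrays below 10 intact, so every round starts from the same operands.
        have frame : ∀ a : Addr, (a.1 < 10 ∨ 12 + 3 * l < a.1) → st₃ a = st' a := by
          intro a ha
          rw [c2 a (by omega), b2 a, a2 a]
          · rintro i j rfl; simp only [sA] at ha; omega
          · rintro i j rfl; simp only [sB] at ha; omega
        constructor
        · intro I J i j hi hj
          refine (d1 ((I, J), (i, j)) (by simp [hi, hj])).trans ?_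
          dsimp only
          rw [frame (sC (l + 1) _ _) (by simp only [sC]; omega),
            h1 I J i j hi hj, sum_insert htT, c1 i j hi hj, mul_one, mul_comm _ (S.γ t I J)]
          congr 2
          refine sum_congr rfl fun z hz => ?_
          rw [mem_range] at hz
          rw [b2 (sA l i z) (by intro i j; simp only [sA, sB, ne_eq, Prod.mk.injEq]; omega),
            a1 i z hi hz, b1 z j hz hj]
          congr 1
          · refine sum_congr rfl fun p _ => ?_
            rw [h2 (sA (l + 1) _ _) (by simp only [sA]; omega)]
          · refine sum_congr rfl fun p _ => ?_
            rw [a2 (sB (l + 1) _ _) (by intro i j; simp only [sA, sB, ne_eq, Prod.mk.injEq]; omega),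
              h2 (sB (l + 1) _ _) (by simp only [sB]; omega)]
        · intro a ha
          rw [d2 a (by simp) (fun x _ e => by simp only [e, sC] at ha; omega),
            frame a (by omega), h2 a ha]
    refine ⟨fun i j hi hj => ?_, key.2⟩
    rw [hKs] at hi hj
    have hK0 : 0 < K := Nat.pos_of_mul_pos_left (by omega : 0 < S.k * K)
    -- Back from block coordinates by division with remainder by K.
    have e := key.1 ⟨i / K, Nat.div_lt_of_lt_mul (by rwa [mul_comm])⟩
      ⟨j / K, Nat.div_lt_of_lt_mul (by rwa [mul_comm])⟩ (i % K) (j % K)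
      (Nat.mod_lt _ hK0) (Nat.mod_lt _ hK0)
    rw [StrassenLike.block_mul_eq] at e
    simpa only [Nat.div_add_mod', hKs] using e

/-- All scratch words of levels `0, …, l`. -/
def scratch : ℕ → Finset Addr
  | 0 => {10, 11, 12} ×ˢ box 1 1
  | l + 1 => scratch l ∪
      {10 + 3 * (l + 1), 11 + 3 * (l + 1), 12 + 3 * (l + 1)} ×ˢ box (S.k ^ (l + 1)) (S.k ^ (l + 1))

theorem level_subset_scratch (l : ℕ) :
    {10 + 3 * l, 11 + 3 * l, 12 + 3 * l} ×ˢ box (S.k ^ l) (S.k ^ l) ⊆ scratch S l := by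
  cases l with
  | zero => simp [scratch]
  | succ l => exact subset_union_right

theorem scratch_mono {l l' : ℕ} (h : l ≤ l') : scratch S l ⊆ scratch S l' := by
  induction h with
  | refl => rfl
  | step _ ih => exact ih.trans subset_union_left

/-- The sizes of the levels grow by a factor k² ≥ 4, so the top level 3k^(2l) dominates: 4 + 3k² ≤
4k². -/
theorem card_scratch (l : ℕ) : (scratch S l).card ≤ 4 * S.k ^ (2 * l) := by
  induction l with
  | zero => exact (card_product _ _).le.trans (by simp)
  | succ l ih =>
    refine (card_union_le _ _).trans ?_
    have h1 : 4 ≤ S.k ^ 2 := by have := S.two_le_k; nlinarith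
    have h2 : ({10 + 3 * (l + 1), 11 + 3 * (l + 1), 12 + 3 * (l + 1)} : Finset ℕ).card ≤ 3 :=
      card_le_three
    have h3 : S.k ^ (2 * (l + 1)) = S.k ^ (2 * l) * S.k ^ 2 := by ring
    have h4 : S.k ^ (l + 1) * S.k ^ (l + 1) = S.k ^ (2 * (l + 1)) := by ring
    rw [card_product, card_box, h4]
    have := Nat.mul_le_mul_left (S.k ^ (2 * l)) h1
    nlinarith [Nat.mul_le_mul_right (S.k ^ (2 * (l + 1))) h2]

theorem mem_scratch {l i j : ℕ} (hi : i < S.k ^ l) (hj : j < S.k ^ l) :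
    sC l i j ∈ scratch S l ∧ sA l i j ∈ scratch S l ∧ sB l i j ∈ scratch S l := by
  refine ⟨?_, ?_, ?_⟩ <;>
    exact level_subset_scratch S l (by simp [sA, sB, sC, hi, hj])

/-- Operations at one level of the recursion, outside the recursive calls. -/
def mulOverhead (l : ℕ) : ℕ :=
  (S.k ^ (l + 1)) ^ 2 + S.r * (2 * ((S.k ^ l) ^ 2 * (1 + S.k ^ 2)) + S.k ^ 2 * (S.k ^ l) ^ 2)

def mulTime : ℕ → ℕ
  | 0 => 1
  | l + 1 => mulOverhead S l + S.r * mulTime l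

/-- The recursion is cut off at the size where the scratch words of all levels up to the present
one, and two temporaries, fit into fast memory. Above that size the linear combinations are streamed
at three words per operation. -/
def mulWords (M : ℕ) : ℕ → ℕ
  | 0 => 3
  | l + 1 => if (scratch S (l + 1)).card + 2 ≤ M then 2 * (scratch S (l + 1)).card else
      3 * mulOverhead S l + S.r * mulWords M l

theorem bdd_mul_parts (l : ℕ) :
    ((forAll (box (S.k ^ (l + 1)) (S.k ^ (l + 1))) fun x =>
      step (.const 0) (sC (l + 1) x.1 x.2) (sC (l + 1) x.1 x.2) (sC (l + 1) x.1 x.2)).Bdd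
      (scratch S (l + 1)) ((S.k ^ (l + 1)) ^ 2)) ∧ ∀ t,
    ((blockComb S (S.k ^ l) (S.α t) (sA l) (sA (l + 1))).Bdd (scratch S (l + 1))
      ((S.k ^ l) ^ 2 * (1 + S.k ^ 2))) ∧
    ((blockComb S (S.k ^ l) (S.β t) (sB l) (sB (l + 1))).Bdd (scratch S (l + 1))
      ((S.k ^ l) ^ 2 * (1 + S.k ^ 2))) ∧
    (forAll ((univ : Finset (Fin S.k × Fin S.k)) ×ˢ box (S.k ^ l) (S.k ^ l)) fun x =>
        step (.lin (S.γ t x.1.1 x.1.2) 1) (sC l x.2.1 x.2.2)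
          (sC (l + 1) (x.1.1 * S.k ^ l + x.2.1) (x.1.2 * S.k ^ l + x.2.2))
          (sC (l + 1) (x.1.1 * S.k ^ l + x.2.1) (x.1.2 * S.k ^ l + x.2.2))).Bdd
      (scratch S (l + 1)) (S.k ^ 2 * (S.k ^ l) ^ 2) := by
  have hl : scratch S l ⊆ scratch S (l + 1) := scratch_mono S (by omega)
  have hKs : S.k ^ (l + 1) = S.k * S.k ^ l := by rw [pow_succ, mul_comm]
  have aux : ∀ (p : Fin S.k) (i : ℕ), i < S.k ^ l → p * S.k ^ l + i < S.k ^ (l + 1) :=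
    fun p i hi =>
    calc p * S.k ^ l + i < (p + 1) * S.k ^ l := by rw [add_mul]; omega
      _ ≤ S.k ^ (l + 1) := hKs ▸ Nat.mul_le_mul_right _ p.2
  refine ⟨?_, fun t => ⟨?_, ?_, ?_⟩⟩
  · refine (bdd_forAll _ (n := 1) fun x hx => ?_).mono subset_rfl (by simp [sq])
    rw [mem_box] at hx
    have := (mem_scratch S hx.1 hx.2).1
    exact bdd_step _ this this this
  · exact bdd_blockComb S _ _ _ _ (fun i j hi hj => hl (mem_scratch S hi hj).2.1)
      (fun i j hi hj => (mem_scratch S (hKs ▸ hi) (hKs ▸ hj)).2.1)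
  · exact bdd_blockComb S _ _ _ _ (fun i j hi hj => hl (mem_scratch S hi hj).2.2)
      (fun i j hi hj => (mem_scratch S (hKs ▸ hi) (hKs ▸ hj)).2.2)
  · refine (bdd_forAll _ (n := 1) fun x hx => ?_).mono subset_rfl (by simp [sq])
    simp only [mem_product, mem_univ, true_and, mem_box] at hx
    have := (mem_scratch S (aux x.1.1 _ hx.1) (aux x.1.2 _ hx.2)).1
    exact bdd_step _ (hl (mem_scratch S hx.1 hx.2).1) this this

theorem bdd_mul (l : ℕ) : (mul S l).Bdd (scratch S l) (mulTime S l) := by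
  induction l with
  | zero =>
    have := mem_scratch S (l := 0) (i := 0) (j := 0) (by simp) (by simp)
    exact bdd_step _ this.2.1 this.2.2 this.1
  | succ l ih =>
    obtain ⟨h1, h2⟩ := bdd_mul_parts S l
    have ih := ih.mono (coe_subset.2 (scratch_mono S (Nat.le_succ l))) le_rfl
    refine (h1.andThen (bdd_forAll _ fun t _ => (h2 t).1.andThen ((h2 t).2.1.andThen
      (ih.andThen (h2 t).2.2)))).mono subset_rfl ?_
    simp only [card_univ, Fintype.card_fin, mulTime, mulOverhead]
    apply le_of_eq
    ring

/-- The same `Comp` is compiled in a way that depends on the level: in fast memory if it fits, and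
otherwise by streaming around recursively compiled calls. -/
theorem cost_mul {M : ℕ} (hM : 3 ≤ M) (l : ℕ) :
    (mul S l).Cost M (mulWords S M l) (5 * mulTime S l) := by
  induction l with
  | zero => exact (bdd_mul S 0).cost_slow hM
  | succ l ih =>
    rw [mulWords]
    split_ifs with hfit
    · exact (bdd_mul S (l + 1)).cost_fast hfit
    · obtain ⟨h1, h2⟩ := bdd_mul_parts S l
      refine ((h1.cost_slow hM).andThen (cost_forAll _ fun t _ =>
        ((h2 t).1.cost_slow hM).andThen (((h2 t).2.1.cost_slow hM).andThen
        (ih.andThen ((h2 t).2.2.cost_slow hM))))).mono ?_ ?_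
      · simp only [card_univ, Fintype.card_fin, mulOverhead]
        apply le_of_eq
        ring
      · simp only [card_univ, Fintype.card_fin, mulTime, mulOverhead]
        apply le_of_eq
        ring

/-! ### Rectangular multiplication -/

/-- Copy an `h × w` matrix, padding it by zeros to size `K × K`. -/
def gather (K h w : ℕ) (A D : ℕ → ℕ → Addr) : Comp Unit :=
  forAll (box K K) fun x =>
    if x.1 < h ∧ x.2 < w then step (.lin 1 0) (A x.1 x.2) (A x.1 x.2) (D x.1 x.2)
    else step (.const 0) (D x.1 x.2) (D x.1 x.2) (D x.1 x.2)

theorem fin_gather (K h w : ℕ) (A D : ℕ → ℕ → Addr)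
    (hD : ∀ i j i' j', D i j = D i' j' → i = i' ∧ j = j')
    (hDA : ∀ i j i' j', i < h → j < w → A i j ≠ D i' j') (st : Store) :
    (∀ i j, i < K → j < K → (gather K h w A D).fin st (D i j) =
      if i < h ∧ j < w then st (A i j) else 0) ∧
    (∀ a, (∀ i j, a ≠ D i j) → (gather K h w A D).fin st a = st a) := by
  obtain ⟨h1, h2⟩ := forAll_parallel (box K K) (fun x =>
    if x.1 < h ∧ x.2 < w then step (.lin 1 0) (A x.1 x.2) (A x.1 x.2) (D x.1 x.2)
    else step (.const 0) (D x.1 x.2) (D x.1 x.2) (D x.1 x.2)) (fun x => D x.1 x.2)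
    (fun x st => if x.1 < h ∧ x.2 < w then st (A x.1 x.2) else 0) ∅
    (fun x _ y _ h => Prod.ext (hD _ _ _ _ h).1 (hD _ _ _ _ h).2) (by simp)
    (fun x _ st => by split_ifs <;> simp [Op.eval])
    (fun x _ st a ha _ => by split_ifs <;> simp [ha])
    (fun x _ st st' hst => by
      split_ifs with hx
      · exact hst _ (by simp) fun y _ _ => hDA _ _ _ _ hx.1 hx.2
      · rfl) st
  exact ⟨fun i j hi hj => h1 (i, j) (by simp [hi, hj]),
    fun a ha => h2 a (by simp) fun x _ => ha _ _⟩

theorem bdd_gather {X : Set Addr} (K h w : ℕ) (A D : ℕ → ℕ → Addr)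
    (hA : ∀ i j, i < h → j < w → A i j ∈ X) (hD : ∀ i j, i < K → j < K → D i j ∈ X) :
    (gather K h w A D).Bdd X (K ^ 2) := by
  refine (bdd_forAll _ (n := 1) fun x hx => ?_).mono subset_rfl (by simp [sq])
  rw [mem_box] at hx
  split_ifs with h
  · exact bdd_step _ (hA _ _ h.1 h.2) (hA _ _ h.1 h.2) (hD _ _ hx.1 hx.2)
  · exact bdd_step _ (hD _ _ hx.1 hx.2) (hD _ _ hx.1 hx.2) (hD _ _ hx.1 hx.2)

/-- `C := κ C + μ A B` for an `h × q` matrix `A` and a `q × w` matrix `B`, by one multiplication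
of `k ^ l × k ^ l` matrices. -/
def mma (l : ℕ) (κ μ : ℝ) (h q w : ℕ) (A B C : ℕ → ℕ → Addr) : Comp Unit :=
  (gather (S.k ^ l) h q A (sA l)).andThen <|
  (gather (S.k ^ l) q w B (sB l)).andThen <|
  (mul S l).andThen <|
  forAll (box h w) fun x => step (.lin κ μ) (C x.1 x.2) (sC l x.1 x.2) (C x.1 x.2)

/-- The product is formed from copies in scratch memory, so C may overlap A and B; C must only have
distinct words for distinct entries. -/
theorem fin_mma (l : ℕ) (κ μ : ℝ) (h q w : ℕ) (A B C : ℕ → ℕ → Addr)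
    (hh : h ≤ S.k ^ l) (hq : q ≤ S.k ^ l) (hw : w ≤ S.k ^ l)
    (hA : ∀ i j, (A i j).1 < 10) (hB : ∀ i j, (B i j).1 < 10) (hC : ∀ i j, (C i j).1 < 10)
    (hinj : ∀ i j i' j', i < h → j < w → i' < h → j' < w → C i j = C i' j' → i = i' ∧ j = j')
    (st : Store) :
    (∀ i j, i < h → j < w → (mma S l κ μ h q w A B C).fin st (C i j) =
      st (C i j) * κ + (∑ t ∈ range q, st (A i t) * st (B t j)) * μ) ∧
    (∀ a : Addr, a.1 < 10 → (∀ i j, i < h → j < w → a ≠ C i j) →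
      (mma S l κ μ h q w A B C).fin st a = st a) := by
  have hsA : ∀ (a : Addr), a.1 < 10 → ∀ i j, a ≠ sA l i j := by
    rintro a ha i j rfl; simp only [sA] at ha; omega
  have hsB : ∀ (a : Addr), a.1 < 10 → ∀ i j, a ≠ sB l i j := by
    rintro a ha i j rfl; simp only [sB] at ha; omega
  have hsC : ∀ (a : Addr), a.1 < 10 → ∀ i j, a ≠ sC l i j := by
    rintro a ha i j rfl; simp only [sC] at ha; omega
  simp only [mma, fin_andThen]
  obtain ⟨a1, a2⟩ := fin_gather (S.k ^ l) h q A (sA l) (by simp [sA])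
    (fun i j i' j' _ _ => hsA _ (hA _ _) _ _) st
  set st₁ := (gather (S.k ^ l) h q A (sA l)).fin st
  obtain ⟨b1, b2⟩ := fin_gather (S.k ^ l) q w B (sB l) (by simp [sB])
    (fun i j i' j' _ _ => hsB _ (hB _ _) _ _) st₁
  set st₂ := (gather (S.k ^ l) q w B (sB l)).fin st₁
  obtain ⟨c1, c2⟩ := fin_mul S l st₂
  set st₃ := (mul S l).fin st₂
  obtain ⟨d1, d2⟩ := forAll_parallel (box h w)
    (fun x => step (.lin κ μ) (C x.1 x.2) (sC l x.1 x.2) (C x.1 x.2)) (fun x => C x.1 x.2)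
    (fun x st => st (C x.1 x.2) * κ + st (sC l x.1 x.2) * μ) ∅
    (fun x hx y hy e => by
      simp only [mem_coe, mem_box] at hx hy
      have := hinj _ _ _ _ hx.1 hx.2 hy.1 hy.2 e
      exact Prod.ext this.1 this.2)
    (by simp) (fun x _ st => by simp [Op.eval]) (fun x _ st a ha _ => by simp [ha])
    (fun x hx st st' hst => by
      rw [mem_box] at hx
      rw [hst (C x.1 x.2) (by simp) (fun y hy hne e => by
          rw [mem_box] at hy
          have := hinj _ _ _ _ hx.1 hx.2 hy.1 hy.2 e
          exact hne (Prod.ext this.1 this.2).symm),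
        hst (sC l x.1 x.2) (by simp) (fun y hy hne => (hsC _ (hC _ _) _ _).symm)]) st₃
  have frame : ∀ a : Addr, a.1 < 10 → st₃ a = st a := fun a ha => by
    rw [c2 a (Or.inl ha), b2 a (hsB a ha), a2 a (hsA a ha)]
  constructor
  · intro i j hi hj
    rw [d1 (i, j) (by simp [hi, hj]), frame _ (hC i j), c1 i j (by omega) (by omega)]
    congr 2
    -- The padding of B by zero rows removes the terms from q to k^l.
    rw [← sum_subset (range_mono hq) (fun t htK ht => by
      rw [mem_range] at ht htK
      rw [b1 t j htK (by omega), if_neg (by simp [ht]), mul_zero])]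
    refine sum_congr rfl fun t ht => ?_
    rw [mem_range] at ht
    rw [b1 t j (by omega) (by omega), if_pos ⟨ht, hj⟩,
      b2 _ (by intro i j; simp only [sA, sB, ne_eq, Prod.mk.injEq]; omega),
      a1 i t (by omega) (by omega), if_pos ⟨hi, ht⟩, a2 _ (hsA _ (hB _ _))]
  · intro a ha hne
    rw [d2 a (by simp) (fun x hx => by rw [mem_box] at hx; exact hne _ _ hx.1 hx.2), frame a ha]

def mmaTime (l : ℕ) : ℕ := 3 * (S.k ^ l) ^ 2 + mulTime S l

def mmaWords (M l : ℕ) : ℕ := 9 * (S.k ^ l) ^ 2 + mulWords S M l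

theorem bdd_mma {X : Set Addr} (l : ℕ) (κ μ : ℝ) (h q w : ℕ) (A B C : ℕ → ℕ → Addr)
    (hX : (scratch S l : Set Addr) ⊆ X)
    (hh : h ≤ S.k ^ l) (hw : w ≤ S.k ^ l)
    (hA : ∀ i j, i < h → j < q → A i j ∈ X) (hB : ∀ i j, i < q → j < w → B i j ∈ X)
    (hC : ∀ i j, i < h → j < w → C i j ∈ X) :
    (mma S l κ μ h q w A B C).Bdd X (mmaTime S l) := by
  refine ((bdd_gather _ _ _ A _ hA fun i j hi hj => hX (mem_scratch S hi hj).2.1).andThen <|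
    (bdd_gather _ _ _ B _ hB fun i j hi hj => hX (mem_scratch S hi hj).2.2).andThen <|
    ((bdd_mul S l).mono hX le_rfl).andThen <|
    bdd_forAll (n := 1) _ fun x hx => ?_).mono subset_rfl ?_
  · rw [mem_box] at hx
    exact bdd_step _ (hC _ _ hx.1 hx.2)
      (hX (mem_scratch S (hx.1.trans_le hh) (hx.2.trans_le hw)).1) (hC _ _ hx.1 hx.2)
  · have := Nat.mul_le_mul hh hw
    rw [card_box, mmaTime]
    nlinarith

theorem cost_mma {M : ℕ} (hM : 3 ≤ M) (l : ℕ) (κ μ : ℝ) (h q w : ℕ) (A B C : ℕ → ℕ → Addr)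
    (hh : h ≤ S.k ^ l) (hw : w ≤ S.k ^ l) :
    (mma S l κ μ h q w A B C).Cost M (mmaWords S M l) (5 * mmaTime S l) := by
  have hX : ∀ a : Addr, a ∈ (Set.univ : Set Addr) := Set.mem_univ
  refine (((bdd_gather (X := .univ) _ _ _ A _ (fun _ _ _ _ => hX _)
      fun i j hi hj => hX _).cost_slow hM).andThen <|
    ((bdd_gather (X := .univ) _ _ _ B _ (fun _ _ _ _ => hX _)
      fun i j hi hj => hX _).cost_slow hM).andThen <|
    (cost_mul S hM l).andThen <|
    ((bdd_forAll (S := .univ) (n := 1) _ fun x hx =>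
      bdd_step _ (hX _) (hX _) (hX _)).cost_slow hM)).mono ?_ ?_
  · have := Nat.mul_le_mul hh hw
    rw [card_box, mmaWords]
    nlinarith
  · have := Nat.mul_le_mul hh hw
    rw [card_box, mmaTime]
    nlinarith

/-- `C := κ C + μ A B` for an `h × q` matrix `A` and a `q × w` matrix `B`, where `h` may be large,
by multiplication of chunks of `q` rows. -/
def tallMul (l : ℕ) (κ μ : ℝ) (h q w : ℕ) (A B C : ℕ → ℕ → Addr) : Comp Unit :=
  forAll (range (h / q + 1)) fun u => mma S l κ μ (min q (h - u * q)) q w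
    (fun i t => A (u * q + i) t) B (fun i j => C (u * q + i) j)

/-- C may overlap A within the same row, since a chunk of C is written only after the same chunk of
A has been copied; this allows a rotation in place. It must avoid B, which is read again for every
chunk. -/
theorem fin_tallMul (l : ℕ) (κ μ : ℝ) (h q w : ℕ) (A B C : ℕ → ℕ → Addr) (hq0 : 0 < q)
    (hq : q ≤ S.k ^ l) (hw : w ≤ S.k ^ l)
    (hA : ∀ i j, (A i j).1 < 10) (hB : ∀ i j, (B i j).1 < 10) (hC : ∀ i j, (C i j).1 < 10)
    (hinj : ∀ i j i' j', i < h → j < w → i' < h → j' < w → C i j = C i' j' → i = i' ∧ j = j')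
    (hCA : ∀ i j i' t, i < h → j < w → i' < h → t < q → C i j = A i' t → i = i')
    (hCB : ∀ i j t j', i < h → j < w → t < q → j' < w → C i j ≠ B t j')
    (st : Store) :
    (∀ i j, i < h → j < w → (tallMul S l κ μ h q w A B C).fin st (C i j) =
      st (C i j) * κ + (∑ t ∈ range q, st (A i t) * st (B t j)) * μ) ∧
    (∀ a : Addr, a.1 < 10 → (∀ i j, i < h → j < w → a ≠ C i j) →
      (tallMul S l κ μ h q w A B C).fin st a = st a) := by
  have main := forAll_inv (fun T st' =>
    (∀ i j, i < h → j < w → i / q ∈ T → st' (C i j) =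
      st (C i j) * κ + (∑ t ∈ range q, st (A i t) * st (B t j)) * μ) ∧
    (∀ a : Addr, a.1 < 10 → (∀ i j, i < h → j < w → i / q ∈ T → a ≠ C i j) → st' a = st a))
    (fun u => mma S l κ μ (min q (h - u * q)) q w
      (fun i t => A (u * q + i) t) B (fun i j => C (u * q + i) j)) (range (h / q + 1)) st
    (by simp) ?_
  · refine ⟨fun i j hi hj => main.1 i j hi hj ?_, fun a ha hne => main.2 a ha fun i j hi hj _ =>
      hne i j hi hj⟩
    rw [mem_range, Nat.lt_succ_iff]
    exact Nat.div_le_div_right hi.le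
  · intro u hu T st' huT ⟨h1, h2⟩
    have hdiv : ∀ i, i < q → (u * q + i) / q = u := fun i hi => by
      rw [mul_comm, Nat.mul_add_div hq0, Nat.div_eq_of_lt hi, add_zero]
    obtain ⟨m1, m2⟩ := fin_mma S l κ μ (min q (h - u * q)) q w
      (fun i t => A (u * q + i) t) B (fun i j => C (u * q + i) j)
      ((min_le_left _ _).trans hq) hq hw (fun _ _ => hA _ _) hB (fun _ _ => hC _ _)
      (fun i j i' j' hi hj hi' hj' e => by
        have := hinj (u * q + i) j (u * q + i') j' (by omega) hj (by omega) hj' e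
        omega) st'
    constructor
    · intro i j hi hj hiT
      by_cases hiu : i / q = u
      · have e : i = u * q + i % q := by
          rw [← hiu]; exact (Nat.div_add_mod' i q).symm
        have hm := Nat.mod_lt i hq0
        have hlt : i % q < min q (h - u * q) := by omega
        have := m1 (i % q) j hlt hj
        simp only [← e] at this
        rw [this]
        rw [h2 _ (hC i j) fun i' j' hi' hj' hT e' => huT (by
          have := (hinj i j i' j' hi hj hi' hj' e').1
          rwa [← this, hiu] at hT)]
        congr 2
        refine sum_congr rfl fun t ht => ?_
        rw [mem_range] at ht
        rw [h2 _ (hA i t) fun i' j' hi' hj' hT e' => huT (by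
            have := hCA i' j' i t hi' hj' hi ht e'.symm
            rwa [this, hiu] at hT),
          h2 _ (hB t j) fun i' j' hi' hj' hT e' => hCB i' j' t j hi' hj' ht hj e'.symm]
      · rw [m2 _ (hC i j) fun i' j' hi' hj' e' => hiu (by
          rw [(hinj i j _ j' hi hj (by omega) hj' e').1, hdiv _ (by omega)])]
        exact h1 i j hi hj ((mem_insert.1 hiT).resolve_left hiu)
    · intro a ha hne
      rw [m2 a ha fun i j hi hj => hne _ j (by omega) hj (by rw [hdiv _ (by omega)]; simp)]
      exact h2 a ha fun i j hi hj hT => hne i j hi hj (by simp [hT])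

theorem bdd_tallMul {X : Set Addr} (l : ℕ) (κ μ : ℝ) (h q w : ℕ) (A B C : ℕ → ℕ → Addr)
    (hX : (scratch S l : Set Addr) ⊆ X) (hq : q ≤ S.k ^ l) (hw : w ≤ S.k ^ l)
    (hA : ∀ i j, i < h → j < q → A i j ∈ X) (hB : ∀ i j, i < q → j < w → B i j ∈ X)
    (hC : ∀ i j, i < h → j < w → C i j ∈ X) :
    (tallMul S l κ μ h q w A B C).Bdd X ((h / q + 1) * mmaTime S l) := by
  refine (bdd_forAll _ fun u _ => bdd_mma S l κ μ _ q w _ _ _ hX ((min_le_left _ _).trans hq) hw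
    (fun i j hi hj => hA _ _ (by omega) hj) hB (fun i j hi hj => hC _ _ (by omega) hj)).mono
    subset_rfl (by simp)

theorem cost_tallMul {M : ℕ} (hM : 3 ≤ M) (l : ℕ) (κ μ : ℝ) (h q w : ℕ) (A B C : ℕ → ℕ → Addr)
    (hq : q ≤ S.k ^ l) (hw : w ≤ S.k ^ l) :
    (tallMul S l κ μ h q w A B C).Cost M ((h / q + 1) * mmaWords S M l)
      (5 * ((h / q + 1) * mmaTime S l)) := by
  refine (cost_forAll _ fun u _ => cost_mma S hM l κ μ _ q w _ _ _
    ((min_le_left _ _).trans hq) hw).mono (by simp) ?_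
  rw [card_range]
  apply le_of_eq
  ring

/-- `C := Xᵀ X` for an `m × q` matrix `X`. -/
def gram (l m q : ℕ) (X C : ℕ → ℕ → Addr) : Comp Unit :=
  (forAll (box q q) fun x => step (.const 0) (C x.1 x.2) (C x.1 x.2) (C x.1 x.2)).andThen <|
  forAll (range (m / q + 1)) fun u => mma S l 1 1 q (min q (m - u * q)) q
    (fun i t => X (u * q + t) i) (fun t j => X (u * q + t) j) C

/-- Cutting X into chunks X_u of q rows gives XᵀX = ∑ X_uᵀ X_u. Each term is a product within size
q, accumulated in C. -/
theorem fin_gram (l m q : ℕ) (X C : ℕ → ℕ → Addr) (hq0 : 0 < q) (hq : q ≤ S.k ^ l)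
    (hX : ∀ i j, (X i j).1 < 10) (hC : ∀ i j, (C i j).1 < 10)
    (hinj : ∀ i j i' j', C i j = C i' j' → i = i' ∧ j = j')
    (hCX : ∀ i j i' j', C i j ≠ X i' j') (st : Store) :
    (∀ i j, i < q → j < q → (gram S l m q X C).fin st (C i j) =
      ∑ t ∈ range m, st (X t i) * st (X t j)) ∧
    (∀ a : Addr, a.1 < 10 → (∀ i j, a ≠ C i j) → (gram S l m q X C).fin st a = st a) := by
  rw [gram, fin_andThen]
  obtain ⟨h1, h2⟩ := forAll_parallel (box q q) (fun x =>
    step (.const 0) (C x.1 x.2) (C x.1 x.2) (C x.1 x.2)) (fun x => C x.1 x.2) (fun _ _ => 0) ∅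
    (fun x _ y _ h => Prod.ext (hinj _ _ _ _ h).1 (hinj _ _ _ _ h).2) (by simp)
    (fun x _ st => by simp [Op.eval]) (fun x _ st a ha _ => by simp [ha])
    (fun _ _ _ _ _ => rfl) st
  have main := forAll_inv (fun T st' =>
    (∀ i j, i < q → j < q → st' (C i j) = ∑ u ∈ T, ∑ t ∈ range (min q (m - u * q)),
      st (X (u * q + t) i) * st (X (u * q + t) j)) ∧
    (∀ a : Addr, a.1 < 10 → (∀ i j, a ≠ C i j) → st' a = st a))
    (fun u => mma S l 1 1 q (min q (m - u * q)) q
      (fun i t => X (u * q + t) i) (fun t j => X (u * q + t) j) C) (range (m / q + 1)) _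
    ⟨fun i j hi hj => by rw [sum_empty]; exact h1 (i, j) (by simp [hi, hj]),
      fun a _ ha => h2 a (by simp) fun x _ => ha _ _⟩ ?_
  · refine ⟨fun i j hi hj => ?_, main.2⟩
    rw [main.1 i j hi hj, sum_range_chunk m q hq0 fun t => st (X t i) * st (X t j)]
  · intro u hu T st' huT ⟨h1, h2⟩
    obtain ⟨m1, m2⟩ := fin_mma S l 1 1 q (min q (m - u * q)) q
      (fun i t => X (u * q + t) i) (fun t j => X (u * q + t) j) C hq
      ((min_le_left _ _).trans hq) hq (fun _ _ => hX _ _) (fun _ _ => hX _ _) hC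
      (fun i j i' j' _ _ _ _ => hinj i j i' j') st'
    constructor
    · intro i j hi hj
      rw [m1 i j hi hj, h1 i j hi hj, sum_insert huT, mul_one, mul_one, add_comm]
      congr 1
      refine sum_congr rfl fun t _ => ?_
      rw [h2 _ (hX _ _) fun i j => (hCX _ _ _ _).symm, h2 _ (hX _ _) fun i j => (hCX _ _ _ _).symm]
    · intro a ha hne
      rw [m2 a ha fun i j _ _ => hne i j, h2 a ha hne]

theorem cost_gram {M : ℕ} (hM : 3 ≤ M) (l m q : ℕ) (X C : ℕ → ℕ → Addr) (hq : q ≤ S.k ^ l) :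
    (gram S l m q X C).Cost M (3 * q ^ 2 + (m / q + 1) * mmaWords S M l)
      (5 * (q ^ 2 + (m / q + 1) * mmaTime S l)) := by
  have hX : ∀ a : Addr, a ∈ (Set.univ : Set Addr) := Set.mem_univ
  refine (((bdd_forAll (S := .univ) (n := 1) _ fun x hx =>
      bdd_step _ (hX _) (hX _) (hX _)).cost_slow hM).andThen <|
    cost_forAll _ fun u _ => cost_mma S hM l 1 1 q _ q _ _ _ hq hq).mono ?_ ?_
  · rw [card_box, card_range]
    apply le_of_eq
    ring
  · rw [card_box, card_range]
    apply le_of_eq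
    ring

end Mul
/-! ### Gaussian elimination on a panel of columns -/

/-- The rows `i ∈ [c, p)` of the columns `j ∈ [c, e)` of `y` have an LU factorization with
multipliers bounded by `1`, and `T` eliminates the rows from `e` on: `T L₁ = L₂` where `L₁`, `L₂`
are the upper and the lower part of `L`. -/
def Elim (c e p : ℕ) (y T : ℕ → ℕ → ℝ) : Prop :=
  ∃ L U : ℕ → ℕ → ℝ,
    (∀ i j, c ≤ i → i < p → c ≤ j → j < e → y i j = ∑ t ∈ Ico c e, L i t * U t j) ∧
    (∀ t, c ≤ t → t < e → L t t = 1) ∧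
    (∀ i t, i < t → t < e → L i t = 0) ∧
    (∀ i t, c ≤ i → i < p → c ≤ t → t < e → |L i t| ≤ 1) ∧
    (∀ t j, j < t → U t j = 0) ∧
    (∀ i j, e ≤ i → i < p → c ≤ j → j < e → ∑ t ∈ Ico c e, T i t * L t j = L i j)

/-- Pivoting in later columns permutes only rows beyond e. Permuting the rows of L and T accordingly
preserves every relation, since the unit triangular top of L and the factor U are unaffected. -/
theorem Elim.perm {c e p : ℕ} {y T : ℕ → ℕ → ℝ} (h : Elim c e p y T) (hce : c ≤ e) (τ : ℕ → ℕ)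
    (h1 : ∀ i, i < e → τ i = i) (h2 : ∀ i, e ≤ i → i < p → e ≤ τ i ∧ τ i < p) :
    Elim c e p (fun i => y (τ i)) (fun i => T (τ i)) := by
  obtain ⟨L, U, hy, hd, hz, hb, hU, hT⟩ := h
  have h3 : ∀ i, c ≤ i → i < p → c ≤ τ i ∧ τ i < p := fun i hc hp => by
    rcases lt_or_ge i e with he | he
    · rw [h1 i he]; exact ⟨hc, hp⟩
    · exact ⟨hce.trans (h2 i he hp).1, (h2 i he hp).2⟩
  refine ⟨fun i => L (τ i), U, fun i j a b => hy _ j (h3 i a b).1 (h3 i a b).2, fun t a b => ?_,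
    fun i t a b => ?_, fun i t a b => hb _ t (h3 i a b).1 (h3 i a b).2, hU,
    fun i j a b c' d => ?_⟩
  · simpa only [h1 t b] using hd t a b
  · simpa only [h1 i (a.trans b)] using hz i t a b
  · dsimp only
    rw [← hT (τ i) j (h2 i a b).1 (h2 i a b).2 c' d]
    refine sum_congr rfl fun t ht => ?_
    rw [h1 t (mem_Ico.1 ht).2]

/-- Forward substitution. -/
theorem exists_solution_unitLower (c d : ℕ) (L : ℕ → ℕ → ℝ) (hd : ∀ t, c ≤ t → t < d → L t t = 1)
    (hz : ∀ i t, i < t → t < d → L i t = 0) (f : ℕ → ℝ) :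
    ∃ u : ℕ → ℝ, ∀ i, c ≤ i → i < d → f i = ∑ t ∈ Ico c d, L i t * u t := by
  obtain ⟨n, rfl | hn⟩ : ∃ n, d = c + n ∨ d < c :=
    ⟨d - c, by omega⟩
  swap
  · exact ⟨0, fun i _ _ => by omega⟩
  induction n with
  | zero => exact ⟨0, fun i _ _ => by omega⟩
  | succ n ih =>
    obtain ⟨u, hu⟩ := ih (fun t h h' => hd t h (by omega)) (fun i t h h' => hz i t h (by omega))
    refine ⟨Function.update u (c + n) (f (c + n) - ∑ t ∈ Ico c (c + n), L (c + n) t * u t),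
      fun i hi hi' => ?_⟩
    rw [← add_assoc, sum_Ico_succ_top (by omega), Function.update_self]
    have : ∀ i, ∑ t ∈ Ico c (c + n), L i t * Function.update u (c + n)
        (f (c + n) - ∑ t ∈ Ico c (c + n), L (c + n) t * u t) t =
        ∑ t ∈ Ico c (c + n), L i t * u t := fun i =>
      sum_congr rfl fun t ht => by
        rw [Function.update_of_ne]
        exact (mem_Ico.1 ht).2.ne
    rw [this]
    by_cases h : i = c + n
    · subst h
      rw [hd _ (by omega) (by omega)]
      ring
    · rw [hz i (c + n) (by omega) (by omega), hu i hi (by omega)]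
      ring

/-- Block LU without triangular solves. Let V be the solution of L₁ V = y on the rows [c, d); it is
the upper right block of U, and only its existence matters. Below, L₁ V = T₁ L₁ V = T₁ y, where T₁
multiplies the rows [c, d), so the Schur complement is computable from T₁ and y. The combined
multipliers are T₂ on the columns [d, e) and T₁ − T₂ T₁ on [c, d): multiplied by the lower
triangular factor, the latter leave L₁ because T₁ L₁ reproduces L₁ in the rows [d, e) as well. -/
theorem Elim.combine {c d e p : ℕ} {y y₂ T T₁ T₂ : ℕ → ℕ → ℝ} (hcd : c ≤ d) (hde : d ≤ e)
    (h₁ : Elim c d p y T₁) (h₂ : Elim d e p y₂ T₂)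
    (hy₂ : ∀ i j, d ≤ i → i < p → d ≤ j → j < e →
      y₂ i j = y i j - ∑ t ∈ Ico c d, T₁ i t * y t j)
    (hT₁ : ∀ i j, e ≤ i → i < p → c ≤ j → j < d →
      T i j = T₁ i j - ∑ t ∈ Ico d e, T₂ i t * T₁ t j)
    (hT₂ : ∀ i j, e ≤ i → i < p → d ≤ j → j < e → T i j = T₂ i j) (hep : e ≤ p) :
    Elim c e p y T := by
  obtain ⟨L₁, U₁, hy1, hd1, hz1, hb1, hU1, hS1⟩ := h₁
  obtain ⟨L₂, U₂, hy2, hd2, hz2, hb2, hU2, hS2⟩ := h₂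
  choose V hV using fun j => exists_solution_unitLower c d L₁ hd1 hz1 (fun i => y i j)
  let L : ℕ → ℕ → ℝ := fun i t => if t < d then L₁ i t else if i < d then 0 else L₂ i t
  let U : ℕ → ℕ → ℝ := fun t j => if t < d then if j < d then U₁ t j else V j t
    else if j < d then 0 else U₂ t j
  have split : ∀ f : ℕ → ℝ, ∑ t ∈ Ico c e, f t = ∑ t ∈ Ico c d, f t + ∑ t ∈ Ico d e, f t :=
    fun f => (sum_Ico_consecutive f hcd hde).symm
  have lo : ∀ f g : ℕ → ℝ, (∀ t, c ≤ t → t < d → f t = g t) →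
      ∑ t ∈ Ico c d, f t = ∑ t ∈ Ico c d, g t := fun f g h =>
    sum_congr rfl fun t ht => h t (mem_Ico.1 ht).1 (mem_Ico.1 ht).2
  have hi' : ∀ f g : ℕ → ℝ, (∀ t, d ≤ t → t < e → f t = g t) →
      ∑ t ∈ Ico d e, f t = ∑ t ∈ Ico d e, g t := fun f g h =>
    sum_congr rfl fun t ht => h t (mem_Ico.1 ht).1 (mem_Ico.1 ht).2
  refine ⟨L, U, ?_, ?_, ?_, ?_, ?_, ?_⟩
  · intro i j hci hip hcj hje
    rw [split]
    by_cases hjd : j < d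
    · rw [hy1 i j hci hip hcj hjd, lo _ _ fun t _ ht => show L i t * U t j = L₁ i t * U₁ t j by
          simp [L, U, ht, hjd],
        hi' _ (fun _ => 0) fun t ht _ => by simp [U, not_lt.2 ht, hjd]]
      simp
    · rw [lo _ _ fun t _ ht => show L i t * U t j = L₁ i t * V j t by simp [L, U, ht, hjd]]
      by_cases hid : i < d
      · rw [hi' _ (fun _ => 0) fun t ht _ => by simp [L, not_lt.2 ht, hid],
          ← hV j i hci hid]
        simp
      · rw [not_lt] at hid hjd
        rw [hi' _ _ fun t ht _ => show L i t * U t j = L₂ i t * U₂ t j by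
          simp [L, U, not_lt.2 ht, not_lt.2 hid, not_lt.2 hjd], ← hy2 i j hid hip hjd hje,
          hy₂ i j hid hip hjd hje]
        -- L₂₁ V = (T₁ L₁₁) V = T₁ (L₁₁ V) = T₁ y.
        have : ∑ t ∈ Ico c d, L₁ i t * V j t = ∑ t ∈ Ico c d, T₁ i t * y t j := by
          calc ∑ t ∈ Ico c d, L₁ i t * V j t
              = ∑ t ∈ Ico c d, ∑ r ∈ Ico c d, T₁ i r * L₁ r t * V j t :=
                lo _ _ fun t hct htd => by rw [← hS1 i t hid hip hct htd, sum_mul]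
            _ = ∑ r ∈ Ico c d, T₁ i r * y r j := by
                rw [sum_comm]
                refine lo _ _ fun r hcr hrd => ?_
                rw [hV j r hcr hrd, mul_sum]
                exact sum_congr rfl fun t _ => mul_assoc _ _ _
        rw [this]
        ring
  · intro t hct hte
    by_cases htd : t < d
    · simpa [L, htd] using hd1 t hct htd
    · simpa [L, htd] using hd2 t (not_lt.1 htd) hte
  · intro i t hit hte
    by_cases htd : t < d
    · simpa [L, htd] using hz1 i t hit htd
    · by_cases hid : i < d
      · simp [L, htd, hid]
      · simpa [L, htd, hid] using hz2 i t hit hte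
  · intro i t hci hip hct hte
    by_cases htd : t < d
    · simpa [L, htd] using hb1 i t hci hip hct htd
    · by_cases hid : i < d
      · simp [L, htd, hid]
      · simpa [L, htd, hid] using hb2 i t (not_lt.1 hid) hip (not_lt.1 htd) hte
  · intro t j hjt
    by_cases htd : t < d
    · simpa [U, htd, hjt.trans htd] using hU1 t j hjt
    · by_cases hjd : j < d
      · simp [U, htd, hjd]
      · simpa [U, htd, hjd] using hU2 t j hjt
  · intro i j hei hip hcj hje
    rw [split]
    by_cases hjd : j < d
    · have e1 : L i j = L₁ i j := by simp [L, hjd]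
      -- The product of T₂ with the part of L in the rows [d, e) cancels the correction subtracted
      -- in `hT₁`.
      rw [e1, ← hS1 i j (hde.trans hei) hip hcj hjd,
        lo _ (fun t => T₁ i t * L₁ t j - ∑ r ∈ Ico d e, T₂ i r * (T₁ r t * L₁ t j))
          fun t hct htd => by
            simp only [L, hjd, if_true, hT₁ i t hei hip hct htd, sub_mul, sum_mul, mul_assoc],
        hi' _ (fun r => ∑ t ∈ Ico c d, T₂ i r * (T₁ r t * L₁ t j)) fun r hdr hre => by
          rw [← mul_sum, hS1 r j hdr (hre.trans_le hep) hcj hjd, hT₂ i r hei hip hdr hre]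
          simp [L, hjd],
        sum_sub_distrib, sum_comm]
      ring
    · have hdi : ¬ i < d := by omega
      have e1 : L i j = L₂ i j := by simp [L, hjd, hdi]
      rw [e1, ← hS2 i j hei hip (not_lt.1 hjd) hje,
        lo _ (fun _ => 0) fun t _ htd => by simp [L, hjd, htd],
        hi' _ (fun t => T₂ i t * L₂ t j) fun t hdt hte => by
          rw [hT₂ i t hei hip hdt hte]; simp [L, hjd, not_lt.2 hdt]]
      simp

/-- L is the column divided by its pivot, with 1 in the pivot row, and U is the pivot. A zero pivot
of largest modulus means a zero column; division by zero then gives zero multipliers, which is a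
valid factorization. -/
theorem elim_column {c p : ℕ} {y T : ℕ → ℕ → ℝ}
    (hmax : ∀ i, c ≤ i → i < p → |y i c| ≤ |y c c|)
    (hT : ∀ i, c < i → i < p → T i c = y i c / y c c) : Elim c (c + 1) p y T := by
  have ico : Ico c (c + 1) = {c} := by ext; simp
  refine ⟨fun i t => if i < t then 0 else if i = c then 1 else y i c / y c c,
    fun t j => if j < t then 0 else y c c, ?_, ?_, ?_, ?_, ?_, ?_⟩
  · intro i j hci hip hcj hje
    obtain rfl : j = c := by omega
    rw [ico, sum_singleton]
    simp only [not_lt.2 hci, lt_irrefl, if_false]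
    split_ifs with h
    · rw [h, one_mul]
    · by_cases h0 : y j j = 0
      · have := hmax i hci hip
        rw [h0, abs_zero, abs_nonpos_iff] at this
        simp [h0, this]
      · field_simp
  · intro t hct hte
    obtain rfl : t = c := by omega
    simp
  · intro i t hit _
    simp [hit]
  · intro i t hci hip _ _
    dsimp only
    split_ifs
    · simp
    · simp
    · rw [abs_div]
      exact div_le_one_of_le₀ (hmax i hci hip) (abs_nonneg _)
  · intro t j hjt
    simp [hjt]
  · intro i j hci hip hcj hje
    obtain rfl : j = c := by omega
    rw [ico, sum_singleton]
    simp [hT i hci hip, show ¬ i < j by omega, show i ≠ j by omega]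

/-! ### The pivot search -/

def tmp₀ : Addr := (7, 0, 0)
def tmp₁ : Addr := (7, 0, 1)

/-- Search for a word of largest modulus; `tmp₀` holds the square of the best word so far. -/
def search {ι : Type} (y : ι → Addr) : List ι → ι → Comp ι
  | [], j => .pure j
  | i :: l, j => .op (.bin .mul) (y i) (y i) tmp₁ <| .branch tmp₀ tmp₁
      (.op (.lin 1 0) tmp₁ tmp₁ tmp₀ (search y l i)) (search y l j)

/-- Squares replace moduli, for which the machine has no instruction. The hypothesis `h0` is the
loop invariant: `tmp₀` holds the square belonging to the current candidate j, and the candidate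
itself lives in the control flow. -/
theorem search_spec {ι : Type} (y : ι → Addr) (hy₀ : ∀ i, y i ≠ tmp₀) (hy₁ : ∀ i, y i ≠ tmp₁)
    (l : List ι) (j : ι) (st : Store) (h0 : st tmp₀ = st (y j) ^ 2) :
    (∀ i, (i ∈ l ∨ i = j) → st (y i) ^ 2 ≤ st (y ((search y l j).val st)) ^ 2) ∧
    (∀ a, a ≠ tmp₀ → a ≠ tmp₁ → (search y l j).fin st a = st a) := by
  have ht : tmp₀ ≠ tmp₁ := by simp [tmp₀, tmp₁]
  induction l generalizing j st with
  | nil => exact ⟨fun i hi => by simp at hi; simp [search, hi], fun a _ _ => rfl⟩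
  | cons i l ih =>
    set st₁ := Function.update st tmp₁ (st (y i) * st (y i)) with hst₁
    have e1 : ∀ i, st₁ (y i) = st (y i) := fun i => by simp [st₁, hy₁ i]
    have e0 : st₁ tmp₀ = st (y j) ^ 2 := by simp [st₁, ht, h0]
    have e2 : st₁ tmp₁ = st (y i) ^ 2 := by simp [st₁, sq]
    by_cases hlt : st₁ tmp₀ < st₁ tmp₁
    · set st₂ := Function.update st₁ tmp₀ (st₁ tmp₁ * 1 + st₁ tmp₁ * 0) with hst₂
      have f1 : ∀ i, st₂ (y i) = st (y i) := fun i => by simp [st₂, hy₀ i, e1]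
      have hex : (search y (i :: l) j).exec st = (search y l i).exec st₂ := by
        change (if st₁ tmp₀ < st₁ tmp₁ then _ else _) = _
        rw [if_pos hlt]; rfl
      obtain ⟨h1, h2⟩ := ih i st₂ (by simp [st₂, e2, hy₀, e1])
      simp only [f1] at h1
      constructor
      · intro i' hi'
        rw [Comp.val, hex]
        rw [e0, e2] at hlt
        rcases hi' with hi' | rfl
        · exact h1 i' (by simpa [or_comm] using hi')
        · exact hlt.le.trans (h1 i (by simp))
      · intro a ha₀ ha₁
        rw [Comp.fin, hex]
        exact (h2 a ha₀ ha₁).trans (by simp [st₂, st₁, ha₀, ha₁])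
    · have hex : (search y (i :: l) j).exec st = (search y l j).exec st₁ := by
        change (if st₁ tmp₀ < st₁ tmp₁ then _ else _) = _
        rw [if_neg hlt]; rfl
      obtain ⟨h1, h2⟩ := ih j st₁ (by rw [e0, e1])
      simp only [e1] at h1
      constructor
      · intro i' hi'
        rw [Comp.val, hex]
        rw [e0, e2, not_lt] at hlt
        simp only [List.mem_cons] at hi'
        rcases hi' with (rfl | hi') | rfl
        · exact hlt.trans (h1 j (by simp))
        · exact h1 i' (by simp [hi'])
        · exact h1 _ (by simp)
      · intro a ha₀ ha₁
        rw [Comp.fin, hex]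
        exact (h2 a ha₀ ha₁).trans (by simp [st₁, ha₁])

theorem bdd_search {ι : Type} {X : Set Addr} (y : ι → Addr) (hy : ∀ i, y i ∈ X) (h₀ : tmp₀ ∈ X)
    (h₁ : tmp₁ ∈ X) (l : List ι) (j : ι) : (search y l j).Bdd X (3 * l.length) := by
  induction l generalizing j with
  | nil => trivial
  | cons i l ih =>
    exact ⟨hy i, hy i, h₁, h₀, h₁, ⟨h₁, h₁, h₀, ih i⟩,
      (ih j).mono subset_rfl (by simp)⟩

/-! ### Recursive LU factorization with partial pivoting -/

/-- The row that the permutation `σ` puts in place `i`. -/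
def row {p : ℕ} (σ : Equiv.Perm (Fin p)) (i : ℕ) : ℕ := if h : i < p then σ ⟨i, h⟩ else i

theorem row_lt {p : ℕ} (σ : Equiv.Perm (Fin p)) {i : ℕ} (h : i < p) : row σ i < p := by
  simp [row, h]

theorem row_val {p : ℕ} (σ : Equiv.Perm (Fin p)) (i : Fin p) : row σ i = σ i := by
  simp [row]

theorem row_mul {p : ℕ} (σ τ : Equiv.Perm (Fin p)) (i : ℕ) : row (σ * τ) i = row σ (row τ i) := by
  by_cases h : i < p <;> simp [row, h]

theorem row_inj {p : ℕ} (σ : Equiv.Perm (Fin p)) {i j : ℕ} (h : row σ i = row σ j) : i = j := by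
  have key : ∀ i, row σ⁻¹ (row σ i) = i := fun i => by
    rw [← row_mul, inv_mul_cancel]
    simp [row]
  rw [← key i, h, key j]

/-- The word in place `(i, j)` of the row-permuted matrix in array `6`. -/
def yA {p : ℕ} (σ : Equiv.Perm (Fin p)) (i j : ℕ) : Addr := (6, row σ i, j)

/-- Pivot search in column `c`, and computation of the multipliers. -/
def pivotColumn {p : ℕ} (c : ℕ) (σ : Equiv.Perm (Fin p)) : Comp (Equiv.Perm (Fin p)) :=
  if h : c < p then
    (step (.bin .mul) (yA σ c c) (yA σ c c) tmp₀).andThen <|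
    (search (fun i : {i : Fin p // c ≤ i} => yA σ i c) univ.toList ⟨⟨c, h⟩, le_rfl⟩).bind fun j =>
    (forAll (Ioo c p) fun i => step (.bin .div) (yA (σ * Equiv.swap ⟨c, h⟩ j.1) i c)
      (yA (σ * Equiv.swap ⟨c, h⟩ j.1) c c) (yA (σ * Equiv.swap ⟨c, h⟩ j.1) i c)).andThen <|
    .pure (σ * Equiv.swap ⟨c, h⟩ j.1)
  else .pure σ

/-- The exchange of rows happens only in the permutation. Both the old panel and the multipliers are
read through the new permutation, and only column c of array 6 and the temporaries are written. -/
theorem pivotColumn_spec {p : ℕ} (c : ℕ) (hc : c < p) (σ : Equiv.Perm (Fin p)) (st : Store) :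
    (∀ i, i < c → row ((pivotColumn c σ).val st) i = row σ i) ∧
    Elim c (c + 1) p (fun i j => st (yA ((pivotColumn c σ).val st) i j))
      (fun i j => (pivotColumn c σ).fin st (yA ((pivotColumn c σ).val st) i j)) ∧
    (∀ a : Addr, a.1 ≠ 7 → ¬ (a.1 = 6 ∧ a.2.2 = c) → (pivotColumn c σ).fin st a = st a) := by
  simp only [pivotColumn, hc, dif_pos, fin_andThen, val_andThen, fin_bind, val_bind, val_pure,
    fin_pure]
  set st₁ := (step (.bin .mul) (yA σ c c) (yA σ c c) tmp₀).fin st with hst₁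
  have e1 : ∀ a : Addr, a.1 ≠ 7 → st₁ a = st a := fun a ha => by
    have : a ≠ tmp₀ := by rintro rfl; exact ha rfl
    simp [st₁, this]
  obtain ⟨s1, s2⟩ := search_spec (fun i : {i : Fin p // c ≤ i} => yA σ i c)
    (by simp [yA, tmp₀]) (by simp [yA, tmp₁]) univ.toList ⟨⟨c, hc⟩, le_rfl⟩ st₁ (by
      rw [e1 (yA σ c c) (by simp [yA])]
      simp [st₁, Op.eval, BinOp.eval, sq])
  set S := search (fun i : {i : Fin p // c ≤ i} => yA σ i c) univ.toList ⟨⟨c, hc⟩, le_rfl⟩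
  set j := S.val st₁
  set st₂ := S.fin st₁
  set σ' := σ * Equiv.swap ⟨c, hc⟩ j.1 with hσ'
  have e2 : ∀ a : Addr, a.1 ≠ 7 → st₂ a = st a := fun a ha => by
    rw [s2 a (by rintro rfl; exact ha rfl) (by rintro rfl; exact ha rfl), e1 a ha]
  obtain ⟨d1, d2⟩ := forAll_parallel (Ioo c p)
    (fun i => step (.bin .div) (yA σ' i c) (yA σ' c c) (yA σ' i c)) (fun i => yA σ' i c)
    (fun i st => st (yA σ' i c) / st (yA σ' c c)) ∅
    (fun i _ i' _ e => row_inj σ' (by simpa [yA] using e)) (by simp)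
    (fun i _ st => by simp [Op.eval, BinOp.eval])
    (fun i _ st a ha _ => by simp [ha])
    (fun i hi st st' h => by
      rw [h _ (by simp) fun i' _ hne e => hne (row_inj σ' (by simpa [yA] using e)).symm,
        h (yA σ' c c) (by simp) fun i' hi' hne e => by
          have := row_inj σ' (i := c) (j := i') (by simpa [yA] using e)
          simp at hi'
          omega]) st₂
  refine ⟨fun i hi => ?_, elim_column (fun i hci hip => ?_) fun i hci hip => ?_, fun a h7 h6 => ?_⟩
  · rw [hσ', row_mul]
    congr 1
    have hne : (⟨i, hi.trans hc⟩ : Fin p) ≠ ⟨c, hc⟩ := by simp [hi.ne]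
    have hne' : (⟨i, hi.trans hc⟩ : Fin p) ≠ j := by
      intro e
      have := congrArg Fin.val e
      have := j.2
      simp at *
      omega
    have := row_val (Equiv.swap ⟨c, hc⟩ (j : Fin p)) ⟨i, hi.trans hc⟩
    rwa [Equiv.swap_apply_of_ne_of_ne hne hne'] at this
  · rw [← sq_le_sq]
    have hcc : yA σ' c c = yA σ j c := by
      have := row_val (Equiv.swap ⟨c, hc⟩ (j : Fin p)) ⟨c, hc⟩
      rw [Equiv.swap_apply_left] at this
      simp only [yA, hσ', row_mul]
      rw [this]
    -- The transposition exchanges c with some j ≥ c, so the row now in place i ≥ c was one of the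
    -- candidates searched.
    obtain ⟨i', hi'⟩ : ∃ i' : {i : Fin p // c ≤ i}, yA σ' i c = yA σ i' c := by
      have e := row_val (Equiv.swap ⟨c, hc⟩ (j : Fin p)) ⟨i, hip⟩
      refine ⟨⟨Equiv.swap ⟨c, hc⟩ (j : Fin p) ⟨i, hip⟩, ?_⟩, ?_⟩
      · rw [Equiv.swap_apply_def]
        split_ifs
        · exact j.2
        · exact le_rfl
        · exact hci
      · simp only [yA, hσ', row_mul]
        rw [e]
    have := s1 i' (by simp)
    rw [hcc, hi']
    rwa [e1 _ (by simp [yA]), e1 _ (by simp [yA])] at this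
  · rw [d1 i (by simp [hci, hip]), e2 _ (by simp [yA]), e2 _ (by simp [yA])]
  · rw [d2 a (by simp) fun i _ e => h6 (by simp [e, yA]), e2 a h7]

theorem bdd_pivotColumn {p : ℕ} {X : Set Addr} (c : ℕ) (σ : Equiv.Perm (Fin p))
    (hX : ∀ i, i < p → (6, i, c) ∈ X) (h₀ : tmp₀ ∈ X) (h₁ : tmp₁ ∈ X) :
    (pivotColumn c σ).Bdd X (1 + 4 * p) := by
  rw [pivotColumn]
  split_ifs with hc
  · have hy : ∀ (σ : Equiv.Perm (Fin p)) i, i < p → yA σ i c ∈ X := fun σ i hi =>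
      hX _ (row_lt σ hi)
    refine ((bdd_step _ (hy σ c hc) (hy σ c hc) h₀).andThen <|
      (bdd_search (fun i : {i : Fin p // c ≤ i} => yA σ i c) (fun i => hy σ i i.1.2) h₀ h₁ _
        _).bind (n' := p) fun j => ?_).mono subset_rfl (?_ : _ ≤ 1 + 4 * p)
    · refine ((bdd_forAll (n := 1) _ fun i hi => ?_).andThen (bdd_pure _)).mono subset_rfl ?_
      · rw [mem_Ioo] at hi
        exact bdd_step _ (hy _ i hi.2) (hy _ c hc) (hy _ i hi.2)
      · simp; omega
    · have := Fintype.card_subtype_le fun i : Fin p => c ≤ i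
      simp only [length_toList, card_univ, Fintype.card_fin] at this ⊢
      omega
  · trivial

section

variable (S : StrassenLike)

/-- The least level of scratch memory that holds matrices of size `q × q`. -/
def level (q : ℕ) : ℕ := Nat.clog S.k q

theorem le_pow_level (q : ℕ) : q ≤ S.k ^ level S q := Nat.le_pow_clog S.two_le_k q

/-- Recursive elimination in columns `[c, c + 2 ^ s)`: the words of the unused rows are replaced by
the multipliers that eliminate these rows. The result is the new permutation of the rows. -/
def eliminate {p : ℕ} : ℕ → ℕ → Equiv.Perm (Fin p) → Comp (Equiv.Perm (Fin p))
  | 0, c, σ => pivotColumn c σ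
  | s + 1, c, σ =>
    (eliminate s c σ).bind fun σ₁ =>
    (tallMul S (level S (2 ^ s)) 1 (-1) (p - (c + 2 ^ s)) (2 ^ s) (2 ^ s)
      (fun i t => yA σ₁ (c + 2 ^ s + i) (c + t)) (fun t j => yA σ₁ (c + t) (c + 2 ^ s + j))
      (fun i j => yA σ₁ (c + 2 ^ s + i) (c + 2 ^ s + j))).andThen <|
    (eliminate s (c + 2 ^ s) σ₁).bind fun σ₂ =>
    (tallMul S (level S (2 ^ s)) 1 (-1) (p - (c + 2 ^ s + 2 ^ s)) (2 ^ s) (2 ^ s)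
      (fun i t => yA σ₂ (c + 2 ^ s + 2 ^ s + i) (c + 2 ^ s + t))
      (fun t j => yA σ₂ (c + 2 ^ s + t) (c + j))
      (fun i j => yA σ₂ (c + 2 ^ s + 2 ^ s + i) (c + j))).andThen <|
    .pure σ₂

/-- The second half changes the permutation σ₁ to σ₂ = σ₁τ with τ fixing the rows above d. Hence
`Elim.perm` carries the first half over to the final row order, and `Elim.combine` joins the halves.
The first product forms the Schur complement, the second the combined multipliers. -/
theorem eliminate_spec {p : ℕ} (s c : ℕ) (hp : c + 2 ^ s ≤ p) (σ : Equiv.Perm (Fin p))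
    (st : Store) :
    (∀ i, i < c → row ((eliminate S s c σ).val st) i = row σ i) ∧
    Elim c (c + 2 ^ s) p (fun i j => st (yA ((eliminate S s c σ).val st) i j))
      (fun i j => (eliminate S s c σ).fin st (yA ((eliminate S s c σ).val st) i j)) ∧
    (∀ a : Addr, a.1 < 10 → a.1 ≠ 7 → ¬ (a.1 = 6 ∧ c ≤ a.2.2 ∧ a.2.2 < c + 2 ^ s) →
      (eliminate S s c σ).fin st a = st a) := by
  induction s generalizing c σ st with
  | zero =>
    obtain ⟨h1, h2, h3⟩ := pivotColumn_spec c (by simp at hp; omega) σ st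
    refine ⟨h1, h2, fun a _ h7 h6 => h3 a h7 fun e => h6 ?_⟩
    simp [e.1, e.2]
  | succ s ih =>
    have hw : 2 ^ (s + 1) = 2 ^ s + 2 ^ s := by ring
    rw [hw] at hp ⊢
    have hl := le_pow_level S (2 ^ s)
    have hw0 : 0 < 2 ^ s := by positivity
    simp only [eliminate, fin_andThen, val_andThen, fin_bind, val_bind, val_pure, fin_pure]
    set w := 2 ^ s
    set d := c + w with hd
    rw [← add_assoc] at hp ⊢
    rw [← hd] at hp ⊢
    obtain ⟨a1, a2, a3⟩ := ih c (by omega) σ st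
    set σ₁ := (eliminate S s c σ).val st
    set st₁ := (eliminate S s c σ).fin st
    obtain ⟨m1, m2⟩ := fin_tallMul S (level S w) 1 (-1) (p - d) w w
      (fun i t => yA σ₁ (d + i) (c + t)) (fun t j => yA σ₁ (c + t) (d + j))
      (fun i j => yA σ₁ (d + i) (d + j)) hw0 hl hl (by simp [yA]) (by simp [yA]) (by simp [yA])
      (fun i j i' j' _ _ _ _ e => by
        simp only [yA, Prod.mk.injEq, true_and] at e
        have := row_inj σ₁ e.1
        omega)
      (fun i j i' j' _ _ _ _ e => by
        simp only [yA, Prod.mk.injEq, true_and] at e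
        have := row_inj σ₁ e.1
        omega)
      (fun i j i' j' _ _ _ _ e => by
        simp only [yA, Prod.mk.injEq, true_and] at e
        have := row_inj σ₁ e.1
        omega) st₁
    set st₂ := (tallMul S (level S w) 1 (-1) (p - d) w w
      (fun i t => yA σ₁ (d + i) (c + t)) (fun t j => yA σ₁ (c + t) (d + j))
      (fun i j => yA σ₁ (d + i) (d + j))).fin st₁
    obtain ⟨b1, b2, b3⟩ := ih d (by omega) σ₁ st₂
    set σ₂ := (eliminate S s d σ₁).val st₂
    set st₃ := (eliminate S s d σ₁).fin st₂
    obtain ⟨n1, n2⟩ := fin_tallMul S (level S w) 1 (-1) (p - (d + w)) w w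
      (fun i t => yA σ₂ (d + w + i) (d + t)) (fun t j => yA σ₂ (d + t) (c + j))
      (fun i j => yA σ₂ (d + w + i) (c + j)) hw0 hl hl (by simp [yA]) (by simp [yA]) (by simp [yA])
      (fun i j i' j' _ _ _ _ e => by
        simp only [yA, Prod.mk.injEq, true_and] at e
        have := row_inj σ₂ e.1
        omega)
      (fun i j i' j' _ _ _ _ e => by
        simp only [yA, Prod.mk.injEq, true_and] at e
        have := row_inj σ₂ e.1
        omega)
      (fun i j i' j' _ _ _ _ e => by
        simp only [yA, Prod.mk.injEq, true_and] at e
        have := row_inj σ₂ e.1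
        omega) st₃
    set st₄ := (tallMul S (level S w) 1 (-1) (p - (d + w)) w w
      (fun i t => yA σ₂ (d + w + i) (d + t)) (fun t j => yA σ₂ (d + t) (c + j))
      (fun i j => yA σ₂ (d + w + i) (c + j))).fin st₃
    -- τ = σ₁⁻¹σ₂ fixes the rows before d, hence maps the remaining rows among themselves.
    have hτ : ∀ i, row σ₂ i = row σ₁ (row (σ₁⁻¹ * σ₂) i) := fun i => by
      rw [← row_mul, mul_inv_cancel_left]
    have hτ1 : ∀ i, i < d → row (σ₁⁻¹ * σ₂) i = i := fun i hi =>
      row_inj σ₁ ((hτ i).symm.trans (b1 i hi))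
    have hτ2 : ∀ i, d ≤ i → i < p → d ≤ row (σ₁⁻¹ * σ₂) i ∧ row (σ₁⁻¹ * σ₂) i < p :=
      fun i hi hip => by
        refine ⟨?_, row_lt _ hip⟩
        by_contra! hlt
        have := row_inj (σ₁⁻¹ * σ₂) (hτ1 _ hlt)
        omega
    have hyA : ∀ i j, yA σ₁ (row (σ₁⁻¹ * σ₂) i) j = yA σ₂ i j := fun i j => by
      rw [yA, yA, hτ]
    -- columns on the left are untouched by the second half, those on the right by the first
    have fr2 : ∀ i j, j < d → st₂ (yA σ₂ i j) = st₁ (yA σ₂ i j) := fun i j hj =>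
      m2 _ (by simp [yA]) fun i' j' _ _ e => by
        simp only [yA, Prod.mk.injEq, true_and] at e
        omega
    have fr3 : ∀ i j, j < d → st₃ (yA σ₂ i j) = st₁ (yA σ₂ i j) := fun i j hj => by
      rw [b3 _ (by simp [yA]) (by simp [yA]) (by simp [yA]; omega), fr2 i j hj]
    have fr1 : ∀ i j, d ≤ j → st₁ (yA σ₂ i j) = st (yA σ₂ i j) := fun i j hj =>
      a3 _ (by simp [yA]) (by simp [yA]) (by simp [yA]; omega)
    refine ⟨fun i hi => (b1 i (by omega)).trans (a1 i hi), ?_, ?_⟩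
    · have E1 := a2.perm (by omega) (row (σ₁⁻¹ * σ₂)) hτ1 hτ2
      simp only [hyA] at E1
      refine Elim.combine (d := d) (by omega) (by omega) E1 b2 ?_ ?_ ?_ (by omega)
      · intro i j hdi hip hdj hje
        obtain ⟨h1, h2⟩ := hτ2 i hdi hip
        have := m1 (row (σ₁⁻¹ * σ₂) i - d) (j - d) (by omega) (by omega)
        simp only [Nat.add_sub_cancel' h1, Nat.add_sub_cancel' hdj, hyA] at this
        rw [this, sum_Ico_eq_sum_range, fr1 i j hdj, Nat.add_sub_cancel_left]
        rw [mul_one, mul_neg_one, ← sub_eq_add_neg]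
        congr 1
        refine sum_congr rfl fun t ht => ?_
        rw [mem_range] at ht
        rw [← fr1 _ j hdj, ← hyA (c + t), hτ1 _ (by omega)]
      · intro i j hei hip hcj hjd
        have := n1 (i - (d + w)) (j - c) (by omega) (by omega)
        simp only [Nat.add_sub_cancel' hei, Nat.add_sub_cancel' hcj] at this
        rw [this, sum_Ico_eq_sum_range, fr3 i j hjd, show d + w - d = w by omega]
        rw [mul_one, mul_neg_one, ← sub_eq_add_neg]
        congr 1
        refine sum_congr rfl fun t ht => ?_
        rw [fr3 _ j hjd]
      · intro i j hei hip hdj hje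
        exact n2 _ (by simp [yA]) fun i' j' _ _ e => by
          simp only [yA, Prod.mk.injEq, true_and] at e
          omega
    · intro a h10 h7 h6
      rw [n2 a h10 fun i j _ _ e => h6 ?_, b3 a h10 h7 fun e => h6 ?_,
        m2 a h10 fun i j _ _ e => h6 ?_, a3 a h10 h7 fun e => h6 ?_]
      · exact ⟨e.1, by omega, by omega⟩
      · simp only [e, yA, true_and]; omega
      · exact ⟨e.1, by omega, by omega⟩
      · simp only [e, yA, true_and]; omega

/-- The words used by the elimination in columns `[c, c + 2 ^ s)`. -/
def panel (p s c : ℕ) : Finset Addr :=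
  {6} ×ˢ (range p ×ˢ Ico c (c + 2 ^ s)) ∪ {tmp₀, tmp₁} ∪ scratch S (level S (2 ^ s))

def panelSize (p s : ℕ) : ℕ := p * 2 ^ s + 2 + 4 * S.k ^ (2 * level S (2 ^ s))

theorem card_panel (p s c : ℕ) : (panel S p s c).card ≤ panelSize S p s := by
  refine (card_union_le _ _).trans (add_le_add ((card_union_le _ _).trans
    (add_le_add ?_ card_le_two)) (card_scratch S _))
  simp

theorem panel_subset (p s c c' : ℕ) (h : c ≤ c') (h' : c' + 2 ^ s ≤ c + 2 ^ (s + 1)) :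
    panel S p s c' ⊆ panel S p (s + 1) c := by
  refine union_subset_union (union_subset_union (product_subset_product le_rfl
    (product_subset_product le_rfl (Ico_subset_Ico h h'))) le_rfl) (scratch_mono S ?_)
  exact Nat.clog_mono_right _ (Nat.pow_le_pow_right (by norm_num) (by omega))

def elimTime (p : ℕ) : ℕ → ℕ
  | 0 => 1 + 4 * p
  | s + 1 => 2 * elimTime p s + 2 * ((p / 2 ^ s + 1) * mmaTime S (level S (2 ^ s)))

/-- As for multiplication, a panel that fits into fast memory together with its scratch words is
factored there. A single column is streamed even if it is too long for fast memory. -/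
def elimWords (M p : ℕ) : ℕ → ℕ
  | 0 => 3 * (1 + 4 * p)
  | s + 1 => if panelSize S p (s + 1) + 2 ≤ M then 2 * panelSize S p (s + 1) else
      2 * elimWords M p s + 2 * ((p / 2 ^ s + 1) * mmaWords S M (level S (2 ^ s)))

theorem mem_panel {p s c i j : ℕ} (σ : Equiv.Perm (Fin p)) (hi : i < p) (hc : c ≤ j)
    (hj : j < c + 2 ^ s) : yA σ i j ∈ (panel S p s c : Set Addr) := by
  simp [panel, yA, row_lt σ hi, hc, hj]

theorem bdd_eliminate {p : ℕ} (s c : ℕ) (hp : c + 2 ^ s ≤ p) (σ : Equiv.Perm (Fin p)) :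
    (eliminate S s c σ).Bdd (panel S p s c) (elimTime S p s) := by
  induction s generalizing c σ with
  | zero =>
    exact bdd_pivotColumn c σ (fun i hi => by simp [panel, hi]) (by simp [panel]) (by simp [panel])
  | succ s ih =>
    have hw : 2 ^ (s + 1) = 2 ^ s + 2 ^ s := by ring
    have hw0 : 0 < 2 ^ s := by positivity
    have hl := le_pow_level S (2 ^ s)
    have hX : (scratch S (level S (2 ^ s)) : Set Addr) ⊆ panel S p (s + 1) c :=
      coe_subset.2 ((scratch_mono S (Nat.clog_mono_right _
        (Nat.pow_le_pow_right (by norm_num) (by omega)))).trans subset_union_right)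
    have hm : ∀ h ≤ p, (h / 2 ^ s + 1) * mmaTime S (level S (2 ^ s)) ≤
        (p / 2 ^ s + 1) * mmaTime S (level S (2 ^ s)) := fun h hh =>
      Nat.mul_le_mul_right _ (Nat.succ_le_succ (Nat.div_le_div_right hh))
    refine (((ih c (by omega) σ).mono (coe_subset.2 (panel_subset S p s c c le_rfl (by omega)))
      le_rfl).bind fun σ₁ => ((bdd_tallMul S _ _ _ _ _ _ _ _ _ hX hl hl ?_ ?_ ?_).mono subset_rfl
      (hm _ (Nat.sub_le _ _))).andThen (((ih (c + 2 ^ s) (by omega) σ₁).mono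
      (coe_subset.2 (panel_subset S p s c _ (by omega) (by omega))) le_rfl).bind fun σ₂ =>
      ((bdd_tallMul S _ _ _ _ _ _ _ _ _ hX hl hl ?_ ?_ ?_).mono subset_rfl
      (hm _ (Nat.sub_le _ _))).andThen (bdd_pure σ₂))).mono subset_rfl ?_
    any_goals
      intro i j hi hj
      exact mem_panel S _ (by omega) (by omega) (by omega)
    rw [elimTime]
    omega

theorem cost_eliminate {M p : ℕ} (hM : 3 ≤ M) (s c : ℕ) (hp : c + 2 ^ s ≤ p)
    (σ : Equiv.Perm (Fin p)) :
    (eliminate S s c σ).Cost M (elimWords S M p s) (5 * elimTime S p s) := by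
  induction s generalizing c σ with
  | zero => exact (bdd_eliminate S 0 c hp σ).cost_slow hM
  | succ s ih =>
    rw [elimWords]
    split_ifs with hfit
    · have := card_panel S p (s + 1) c
      exact ((bdd_eliminate S (s + 1) c hp σ).cost_fast (by omega)).mono (by omega) le_rfl
    · have hw : 2 ^ (s + 1) = 2 ^ s + 2 ^ s := by ring
      have hw0 : 0 < 2 ^ s := by positivity
      have hl := le_pow_level S (2 ^ s)
      have hm : ∀ x, ∀ h ≤ p, (h / 2 ^ s + 1) * x ≤ (p / 2 ^ s + 1) * x := fun x h hh =>
        Nat.mul_le_mul_right _ (Nat.succ_le_succ (Nat.div_le_div_right hh))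
      refine ((ih c (by omega) σ).bind fun σ₁ =>
        ((cost_tallMul S hM _ _ _ _ _ _ _ _ _ hl hl).mono (hm _ _ (Nat.sub_le _ _))
          (Nat.mul_le_mul_left 5 (hm _ _ (Nat.sub_le _ _)))).andThen
        ((ih (c + 2 ^ s) (by omega) σ₁).bind fun σ₂ =>
        ((cost_tallMul S hM _ _ _ _ _ _ _ _ _ hl hl).mono (hm _ _ (Nat.sub_le _ _))
          (Nat.mul_le_mul_left 5 (hm _ _ (Nat.sub_le _ _)))).andThen (cost_pure σ₂))).mono ?_ ?_
      · omega
      · rw [elimTime]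
        omega

end

/-- From elimination to an LU factorization with partial pivoting. -/
theorem Elim.isLUPP {p q e : ℕ} {y T : ℕ → ℕ → ℝ} {σ : Equiv.Perm (Fin p)}
    (A : Matrix (Fin p) (Fin q) ℝ) (h : Elim 0 e p y T) (hqe : q ≤ e)
    (hA : ∀ i j, A (σ i) j = y i j) : ∃ L U, IsLUPP A σ L U := by
  obtain ⟨L, U, hy, hd, hz, hb, hU, -⟩ := h
  refine ⟨Matrix.of fun i j => L i j, Matrix.of fun i j => U i j, ?_, ?_, ?_, ?_, ?_⟩
  · ext i j
    obtain ⟨i, rfl⟩ := σ.surjective i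
    have h1 : ((σ.permMatrix ℝ)ᵀ * Matrix.of fun (i : Fin p) (j : Fin q) => L i j) (σ i) =
        fun j : Fin q => L i j := by
      funext j
      simp only [Matrix.mul_apply, Matrix.transpose_apply, Matrix.of_apply]
      rw [Finset.sum_eq_single i]
      · simp [Equiv.Perm.permMatrix, PEquiv.toMatrix_apply]
      · intro l _ hl
        simp [Equiv.Perm.permMatrix, PEquiv.toMatrix_apply, hl]
      · simp
    rw [hA, hy i j (by simp) i.2 (by simp) (j.2.trans_le hqe), Matrix.mul_apply]
    simp only [h1, Matrix.of_apply]
    rw [Fin.sum_univ_eq_sum_range fun t => L i t * U t j, Nat.Ico_zero_eq_range]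
    -- The panel may be wider than the matrix. The surplus columns of L do not contribute, as U is
    -- upper triangular.
    symm
    apply sum_subset (range_mono hqe)
    intro t _ ht
    rw [hU t j (by simp at ht; omega), mul_zero]
  · intro i j hij
    simpa [hij] using hd j (by simp) (j.2.trans_le hqe)
  · intro i j hij
    exact hz i j hij (j.2.trans_le hqe)
  · intro i j
    exact hb i j (by simp) i.2 (by simp) (j.2.trans_le hqe)
  · intro i j hij
    exact hU i j hij

/-! ### Solution of the recurrences -/

/-- Below the cut-off, W is at most c q^l. Above it, W ≤ A q^l (q^l/μ)^ε − B q^l: the main term is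
multiplied by exactly q^(1+ε) per level, which r does not exceed, and the subtracted term absorbs
the overhead. The constant is chosen before μ and W, so it is uniform in the size of fast memory. -/
theorem mul_recurrence (q ε c r : ℝ) (hq : 1 < q) (hε : 0 < ε) (hc : 1 ≤ c)
    (hr : r ≤ q ^ (1 + ε)) :
    ∃ A : ℝ, 0 < A ∧ ∀ (μ : ℝ) (W : ℕ → ℝ), 0 < μ → W 0 ≤ c →
      (∀ l, W (l + 1) ≤ c * q ^ (l + 1) ∨
        (μ ≤ c * q ^ (l + 1) ∧ W (l + 1) ≤ c * q ^ (l + 1) + r * W l)) →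
      (∀ l, 0 ≤ W l) →
      ∀ l, W l ≤ A * (q ^ l * (1 + (q ^ l / μ) ^ ε)) := by
  have hq0 : 0 < q := by linarith
  have hqε : 1 < q ^ ε := Real.one_lt_rpow hq hε
  -- B solves B q^ε = B + c, so the subtracted term pays for the overhead c q^(l+1) of one level.
  set B := c / (q ^ ε - 1) with hB
  have hB0 : 0 < B := div_pos (by linarith) (by linarith)
  have hBc : B * q ^ ε - B = c := by
    rw [hB]; field_simp [show q ^ ε - 1 ≠ 0 by linarith]
  have hcε : 0 < c ^ ε := Real.rpow_pos_of_pos (by linarith) _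
  set A := c ^ ε * (B + c * (1 + q ^ ε)) with hA
  have hA0 : 0 < A := by positivity
  have hR : q ^ (1 + ε) = q * q ^ ε := by rw [Real.rpow_add hq0, Real.rpow_one]
  refine ⟨A + c, by linarith, fun μ W hμ h0 hrec hW l => ?_⟩
  have hql : ∀ l : ℕ, 0 < q ^ l := fun l => pow_pos hq0 l
  have hy0 : ∀ l : ℕ, 0 ≤ (q ^ l / μ) ^ ε := fun l =>
    Real.rpow_nonneg (div_nonneg (hql l).le hμ.le) _
  have hys : ∀ l : ℕ, (q ^ (l + 1) / μ) ^ ε = q ^ ε * (q ^ l / μ) ^ ε := fun l => by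
    rw [← Real.mul_rpow hq0.le (div_nonneg (hql l).le hμ.le)]
    congr 1
    ring
  have main : ∀ l, W l ≤ c * q ^ l ∨ W l ≤ A * (q ^ l * (q ^ l / μ) ^ ε) - B * q ^ l := by
    intro l
    induction l with
    | zero => left; simpa using h0
    | succ l ih =>
      rcases hrec l with h | ⟨hμc, h⟩
      · exact Or.inl h
      · right
        have hrW : r * W l ≤ q * q ^ ε * W l := by
          rw [← hR]; exact mul_le_mul_of_nonneg_right hr (hW l)
        have hqε0 : 0 < q * q ^ ε := by positivity
        rcases ih with h' | h'
        -- Transition at the cut-off: μ ≤ c q^(l+1) gives 1 ≤ c^ε (q^(l+1)/μ)^ε, so a bound linear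
        -- in q^(l+1) may be traded for the power term. This fixes A.
        · have h1 : q * q ^ ε * W l ≤ q * q ^ ε * (c * q ^ l) :=
            mul_le_mul_of_nonneg_left h' hqε0.le
          have hy : 1 ≤ c ^ ε * (q ^ (l + 1) / μ) ^ ε := by
            rw [← Real.mul_rpow (by linarith) (div_nonneg (hql _).le hμ.le)]
            apply Real.one_le_rpow _ hε.le
            rw [← mul_div_assoc, one_le_div hμ]
            exact hμc
          have h2 : q ^ (l + 1) * (B + c * (1 + q ^ ε)) ≤ q ^ (l + 1) * (B + c * (1 + q ^ ε)) *
              (c ^ ε * (q ^ (l + 1) / μ) ^ ε) :=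
            le_mul_of_one_le_right (by have := hql (l + 1); positivity) hy
          have e1 : q * q ^ ε * (c * q ^ l) = c * q ^ ε * q ^ (l + 1) := by ring
          have e2 : q ^ (l + 1) * (B + c * (1 + q ^ ε)) * (c ^ ε * (q ^ (l + 1) / μ) ^ ε) =
            A * (q ^ (l + 1) * (q ^ (l + 1) / μ) ^ ε) := by rw [hA]; ring
          rw [e1] at h1
          rw [e2] at h2
          nlinarith
        · have h1 : q * q ^ ε * W l ≤
              q * q ^ ε * (A * (q ^ l * (q ^ l / μ) ^ ε) - B * q ^ l) :=
            mul_le_mul_of_nonneg_left h' hqε0.le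
          have e1 : q * q ^ ε * (A * (q ^ l * (q ^ l / μ) ^ ε) - B * q ^ l) =
              A * (q ^ (l + 1) * (q ^ (l + 1) / μ) ^ ε) - (B * q ^ ε) * q ^ (l + 1) := by
            rw [hys]; ring
          have e2 : B * q ^ ε = B + c := by linarith
          rw [e1, e2] at h1
          linarith
  have hA' : 0 ≤ A * q ^ l := mul_nonneg hA0.le (hql l).le
  have hc' : 0 ≤ c * q ^ l := mul_nonneg (by linarith) (hql l).le
  have e : (A + c) * (q ^ l * (1 + (q ^ l / μ) ^ ε)) = A * q ^ l + c * q ^ l +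
      A * (q ^ l * (q ^ l / μ) ^ ε) + c * q ^ l * (q ^ l / μ) ^ ε := by ring
  have h3 : 0 ≤ A * (q ^ l * (q ^ l / μ) ^ ε) :=
    mul_nonneg hA0.le (mul_nonneg (hql l).le (hy0 l))
  have h4 := mul_nonneg hc' (hy0 l)
  have h5 := mul_nonneg hB0.le (hql l).le
  rw [e]
  rcases main l with h | h <;> linarith

/-- Doubling the width multiplies p 2^s (p 2^s/μ)^ε by 2 · 2^ε, more than the factor 2 of the two
recursive calls. The surplus A(2^ε − 1) absorbs the products, whose cost is of the same form because
4^s ≤ p 2^(s+1). Hence the last level dominates and no logarithm appears. -/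
theorem elim_recurrence (ε c a : ℝ) (hε : 0 < ε) (hc : 1 ≤ c) (ha : 0 ≤ a) :
    ∃ A : ℝ, 0 < A ∧ ∀ (μ p : ℝ) (g : ℕ → ℝ), 0 < μ → 1 ≤ p → g 0 ≤ c * p →
      (∀ s : ℕ, (2 : ℝ) ^ (s + 1) ≤ p → g (s + 1) ≤ c * (p * 2 ^ (s + 1)) ∨
        (μ ≤ c * (p * 2 ^ (s + 1)) ∧
          g (s + 1) ≤ 2 * g s + a * (p * 2 ^ s * (1 + (4 ^ s / μ) ^ ε)))) →
      ∀ s : ℕ, (2 : ℝ) ^ s ≤ p → g s ≤ A * (p * 2 ^ s * (1 + (p * 2 ^ s / μ) ^ ε)) := by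
  have h2ε : 1 < (2 : ℝ) ^ ε := Real.one_lt_rpow (by norm_num) hε
  have hcε : 0 < c ^ ε := Real.rpow_pos_of_pos (by linarith) _
  set D := a * (1 + c ^ ε) with hD
  have hD0 : 0 ≤ D := by positivity
  set A := c + D * 2 ^ ε / (2 ^ ε - 1) with hA
  have hfr : 0 ≤ D * 2 ^ ε / ((2 : ℝ) ^ ε - 1) := div_nonneg (by positivity) (by linarith)
  have hA0 : 0 < A := by linarith
  have hAD : D * 2 ^ ε ≤ A * (2 ^ ε - 1) := by
    rw [hA, add_mul, div_mul_cancel₀ _ (by linarith)]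
    nlinarith
  refine ⟨A, hA0, fun μ p g hμ hp h0 hrec s hs => ?_⟩
  have hp0 : 0 < p := by linarith
  have hx0 : ∀ s : ℕ, 0 ≤ (p * 2 ^ s / μ) ^ ε := fun s => by positivity
  have hxs : ∀ s : ℕ, (p * 2 ^ (s + 1) / μ) ^ ε = 2 ^ ε * (p * 2 ^ s / μ) ^ ε := fun s => by
    rw [← Real.mul_rpow (by norm_num) (by positivity)]
    congr 1
    ring
  induction s with
  | zero =>
    have h1 : c * p ≤ A * p := mul_le_mul_of_nonneg_right (by linarith) hp0.le
    have h2 := mul_nonneg (mul_nonneg hA0.le hp0.le) (hx0 0)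
    rw [pow_zero, mul_one] at h2 ⊢
    linarith
  | succ s ih =>
    have hs' : (2 : ℝ) ^ s ≤ p := le_trans (pow_le_pow_right₀ (by norm_num) (by omega)) hs
    have ih := ih hs'
    set x := (p * 2 ^ s / μ) ^ ε with hx
    have hp2 : 0 < p * 2 ^ s := by positivity
    rcases hrec s hs with h | ⟨hμc, h⟩
    · have h1 : c * (p * 2 ^ (s + 1)) ≤ A * (p * 2 ^ (s + 1)) :=
        mul_le_mul_of_nonneg_right (by linarith) (by positivity)
      have h2 : 0 ≤ A * (p * 2 ^ (s + 1)) * (p * 2 ^ (s + 1) / μ) ^ ε :=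
        mul_nonneg (by positivity) (hx0 _)
      linarith
    · have h4 : ((4 : ℝ) ^ s / μ) ^ ε ≤ 2 ^ ε * x := by
        rw [← hxs]
        apply Real.rpow_le_rpow (by positivity) _ hε.le
        apply div_le_div_of_nonneg_right _ hμ.le
        rw [show (4 : ℝ) = 2 * 2 by norm_num, mul_pow, pow_succ]
        nlinarith [pow_pos (show (0 : ℝ) < 2 by norm_num) s]
      -- Past the cut-off the power term is bounded below, so the linear part of the cost of the
      -- products is absorbed too.
      have h1 : 1 ≤ c ^ ε * (2 ^ ε * x) := by
        rw [← hxs, ← Real.mul_rpow (by linarith) (by positivity)]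
        apply Real.one_le_rpow _ hε.le
        rw [← mul_div_assoc, one_le_div hμ]
        exact hμc
      have h5 : a * (p * 2 ^ s * (1 + (4 ^ s / μ) ^ ε)) ≤ p * 2 ^ s * x * (D * 2 ^ ε) :=
        calc a * (p * 2 ^ s * (1 + (4 ^ s / μ) ^ ε))
            ≤ a * (p * 2 ^ s * (c ^ ε * (2 ^ ε * x) + 2 ^ ε * x)) := by gcongr
          _ = p * 2 ^ s * x * (D * 2 ^ ε) := by rw [hD]; ring
      have h6 : p * 2 ^ s * x * (D * 2 ^ ε) ≤ p * 2 ^ s * x * (A * (2 ^ ε - 1)) :=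
        mul_le_mul_of_nonneg_left hAD (mul_nonneg hp2.le (hx0 s))
      have h7 : 0 ≤ p * 2 ^ s * x * (A * (2 ^ ε - 1)) :=
        mul_nonneg (mul_nonneg hp2.le (hx0 s)) (mul_nonneg hA0.le (by linarith))
      rw [hxs, ← hx, pow_succ]
      linarith

/-! ### Closed bounds for multiplication and elimination -/

section

variable (S : StrassenLike)

/-- Padding to a power of k enlarges the size by a factor of at most k, which costs only a constant.
-/
theorem pow_level_le {q : ℕ} (hq : 0 < q) : S.k ^ level S q ≤ S.k * q := by
  have := S.two_le_k
  rcases Nat.lt_or_ge 1 q with h | h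
  · have h1 := Nat.pow_pred_clog_lt_self (b := S.k) this h
    have h2 := Nat.clog_pos this h
    rw [level, ← Nat.succ_pred_eq_of_pos h2, pow_succ, mul_comm]
    exact Nat.mul_le_mul_left _ h1.le
  · obtain rfl : q = 1 := by omega
    simp [level]
    omega

/-- Both counts satisfy `mul_recurrence` with q = k², where r ≤ k^ω₀ reads r ≤ q^(1+ε). Operations
are the case μ = 1, in which every level counts as lying above the cut-off. -/
theorem mul_bounds (ε : ℝ) (hε : 0 < ε) (hr : (S.r : ℝ) ≤ ((S.k : ℝ) ^ 2) ^ (1 + ε)) :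
    ∃ A : ℝ, 0 < A ∧ (∀ M l : ℕ, 0 < M → (mulWords S M l : ℝ) ≤
        A * (((S.k : ℝ) ^ 2) ^ l * (1 + (((S.k : ℝ) ^ 2) ^ l / M) ^ ε))) ∧
      ∀ l : ℕ, (mulTime S l : ℝ) ≤
        A * (((S.k : ℝ) ^ 2) ^ l * (1 + (((S.k : ℝ) ^ 2) ^ l / 1) ^ ε)) := by
  have hk : (2 : ℝ) ≤ S.k := by exact_mod_cast S.two_le_k
  have hq : 1 < (S.k : ℝ) ^ 2 := by nlinarith
  -- The 8 covers moving up to 4q^l scratch words in and out; the rest is three words for each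
  -- operation of `mulOverhead`.
  set c : ℝ := 8 + 3 * (1 + S.r * (2 + 3 * (S.k : ℝ) ^ 2)) with hc
  have hc1 : 8 ≤ c := by
    have : 0 ≤ 3 * (1 + S.r * (2 + 3 * (S.k : ℝ) ^ 2)) := by positivity
    linarith
  obtain ⟨A, hA, h⟩ := mul_recurrence ((S.k : ℝ) ^ 2) ε c S.r hq hε (by linarith) hr
  have hover : ∀ l, 3 * (mulOverhead S l : ℝ) ≤ c * ((S.k : ℝ) ^ 2) ^ (l + 1) := fun l => by
    have h1 : (0 : ℝ) < ((S.k : ℝ) ^ 2) ^ l := by positivity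
    have h2 : ((S.k : ℝ) ^ 2) ^ l ≤ ((S.k : ℝ) ^ 2) ^ (l + 1) :=
      pow_le_pow_right₀ hq.le (by omega)
    have h3 : (S.r : ℝ) * ((2 + 3 * (S.k : ℝ) ^ 2) * ((S.k : ℝ) ^ 2) ^ l) ≤
        S.r * ((2 + 3 * (S.k : ℝ) ^ 2) * ((S.k : ℝ) ^ 2) ^ (l + 1)) := by gcongr
    have e : (mulOverhead S l : ℝ) = ((S.k : ℝ) ^ 2) ^ (l + 1) +
        S.r * ((2 + 3 * (S.k : ℝ) ^ 2) * ((S.k : ℝ) ^ 2) ^ l) := by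
      simp only [mulOverhead]
      push_cast
      ring
    rw [e, hc]
    nlinarith
  refine ⟨A, hA, fun M l hM => ?_, fun l => ?_⟩
  · refine h M (fun l => mulWords S M l) (by exact_mod_cast hM) (by simp [mulWords]; linarith)
      (fun l => ?_) (fun l => by positivity) l
    have hcard : ((scratch S (l + 1)).card : ℝ) ≤ 4 * ((S.k : ℝ) ^ 2) ^ (l + 1) := by
      rw [← pow_mul]; exact_mod_cast card_scratch S (l + 1)
    have h1 : 1 ≤ ((S.k : ℝ) ^ 2) ^ (l + 1) := one_le_pow₀ hq.le
    rw [mulWords]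
    split_ifs with hfit
    · left
      push_cast
      nlinarith
    · right
      rw [not_le] at hfit
      have hfit' : (M : ℝ) < (scratch S (l + 1)).card + 2 := by exact_mod_cast hfit
      refine ⟨by nlinarith, ?_⟩
      push_cast
      have := hover l
      linarith
  · refine h 1 (fun l => mulTime S l) one_pos (by simp [mulTime]; linarith)
      (fun l => Or.inr ⟨?_, ?_⟩) (fun l => by positivity) l
    · have h1 : 1 ≤ ((S.k : ℝ) ^ 2) ^ (l + 1) := one_le_pow₀ hq.le
      nlinarith
    · have := hover l
      have h0 : (0 : ℝ) ≤ mulOverhead S l := by positivity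
      simp only [mulTime]
      push_cast
      linarith

theorem mma_bounds (ε : ℝ) (hε : 0 < ε) (hr : (S.r : ℝ) ≤ ((S.k : ℝ) ^ 2) ^ (1 + ε)) :
    ∃ A : ℝ, 0 < A ∧ (∀ M q : ℕ, 0 < M → 0 < q → (mmaWords S M (level S q) : ℝ) ≤
        A * ((q : ℝ) ^ 2 * (1 + ((q : ℝ) ^ 2 / M) ^ ε))) ∧
      ∀ q : ℕ, 0 < q → (mmaTime S (level S q) : ℝ) ≤
        A * ((q : ℝ) ^ 2 * (1 + ((q : ℝ) ^ 2 / 1) ^ ε)) := by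
  obtain ⟨A, hA, hW, hT⟩ := mul_bounds S ε hε hr
  have hk : (2 : ℝ) ≤ S.k := by exact_mod_cast S.two_le_k
  have hk1 : 1 ≤ ((S.k : ℝ) ^ 2) ^ ε := Real.one_le_rpow (by nlinarith) hε.le
  have key : ∀ (μ : ℝ) (q : ℕ), 0 < μ → 0 < q →
      (((S.k : ℝ) ^ 2) ^ level S q * (1 + (((S.k : ℝ) ^ 2) ^ level S q / μ) ^ ε)) ≤
        (S.k : ℝ) ^ 2 * ((S.k : ℝ) ^ 2) ^ ε * ((q : ℝ) ^ 2 * (1 + ((q : ℝ) ^ 2 / μ) ^ ε)) := by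
    intro μ q hμ hq
    have hK : ((S.k : ℝ) ^ 2) ^ level S q ≤ (S.k : ℝ) ^ 2 * (q : ℝ) ^ 2 := by
      rw [← pow_mul, mul_comm 2, pow_mul, ← mul_pow]
      exact pow_le_pow_left₀ (by positivity) (by exact_mod_cast pow_level_le S hq) 2
    calc ((S.k : ℝ) ^ 2) ^ level S q * (1 + (((S.k : ℝ) ^ 2) ^ level S q / μ) ^ ε)
        ≤ (S.k : ℝ) ^ 2 * (q : ℝ) ^ 2 * (1 + ((S.k : ℝ) ^ 2 * (q : ℝ) ^ 2 / μ) ^ ε) := by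
          gcongr
      _ = (S.k : ℝ) ^ 2 * (q : ℝ) ^ 2 *
          (1 + ((S.k : ℝ) ^ 2) ^ ε * ((q : ℝ) ^ 2 / μ) ^ ε) := by
          rw [mul_div_assoc, Real.mul_rpow (by positivity) (by positivity)]
      _ ≤ (S.k : ℝ) ^ 2 * (q : ℝ) ^ 2 *
          (((S.k : ℝ) ^ 2) ^ ε + ((S.k : ℝ) ^ 2) ^ ε * ((q : ℝ) ^ 2 / μ) ^ ε) := by gcongr
      _ = _ := by ring
  have key1 : ∀ (μ : ℝ) (l : ℕ), 0 < μ →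
      ((S.k : ℝ) ^ l) ^ 2 ≤ (((S.k : ℝ) ^ 2) ^ l * (1 + (((S.k : ℝ) ^ 2) ^ l / μ) ^ ε)) := by
    intro μ l hμ
    rw [← pow_mul, mul_comm l, pow_mul]
    exact le_mul_of_one_le_right (by positivity) (by
      have : 0 ≤ (((S.k : ℝ) ^ 2) ^ l / μ) ^ ε := by positivity
      linarith)
  refine ⟨(9 + A) * ((S.k : ℝ) ^ 2 * ((S.k : ℝ) ^ 2) ^ ε), by positivity, fun M q hM hq => ?_,
    fun q hq => ?_⟩
  · have hM' : (0 : ℝ) < M := by exact_mod_cast hM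
    have h1 := key M q hM' hq
    have h2 := key1 M (level S q) hM'
    have h3 := hW M (level S q) hM
    rw [mmaWords, mul_assoc]
    push_cast
    nlinarith
  · have h1 := key 1 q one_pos hq
    have h2 := key1 1 (level S q) one_pos
    have h3 := hT (level S q)
    have h4 : 0 ≤ ((S.k : ℝ) ^ level S q) ^ 2 := by positivity
    rw [mmaTime, mul_assoc]
    push_cast
    nlinarith

/-- The bound in p 2^s from the recurrence is relaxed to p². This loses only a constant in the
sweep, where p = 2b and 2^s ≥ b. -/
theorem elim_bounds (ε : ℝ) (hε : 0 < ε) (hr : (S.r : ℝ) ≤ ((S.k : ℝ) ^ 2) ^ (1 + ε)) :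
    ∃ A : ℝ, 0 < A ∧ (∀ M p s : ℕ, 0 < M → 2 ^ s ≤ p → (elimWords S M p s : ℝ) ≤
        A * ((p : ℝ) ^ 2 * (1 + ((p : ℝ) ^ 2 / M) ^ ε))) ∧
      ∀ p s : ℕ, 2 ^ s ≤ p → (elimTime S p s : ℝ) ≤
        A * ((p : ℝ) ^ 2 * (1 + ((p : ℝ) ^ 2 / 1) ^ ε)) := by
  obtain ⟨B, hB, hW, hT⟩ := mma_bounds S ε hε hr
  have hk : (2 : ℝ) ≤ S.k := by exact_mod_cast S.two_le_k
  -- 15 covers the single column, 3(1 + 4p) ≤ 15p, and 8k² covers moving the scratch words of a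
  -- panel in and out.
  set c : ℝ := 15 + 8 * (S.k : ℝ) ^ 2 with hc
  have hc1 : 15 ≤ c := by nlinarith
  -- In 4B one factor 2 counts the products per level, the other bounds p / 2^s + 1 chunks by
  -- 2p/2^s.
  obtain ⟨A, hA, h⟩ := elim_recurrence ε c (4 * B) hε (by linarith) (by linarith)
  have hsize : ∀ p s : ℕ, 2 ^ s ≤ p → 2 * (panelSize S p s : ℝ) + 4 ≤ c * ((p : ℝ) * 2 ^ s) := by
    intro p s hs
    have hs' : (2 : ℝ) ^ s ≤ p := by exact_mod_cast hs
    have h1 : (1 : ℝ) ≤ 2 ^ s := one_le_pow₀ (by norm_num)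
    have h2 : (S.k : ℝ) ^ (2 * level S (2 ^ s)) ≤ (S.k : ℝ) ^ 2 * (2 ^ s * 2 ^ s) := by
      rw [mul_comm 2, pow_mul, ← sq, ← mul_pow]
      exact pow_le_pow_left₀ (by positivity)
        (by exact_mod_cast pow_level_le S (q := 2 ^ s) (by positivity)) 2
    have h3 : (2 : ℝ) ^ s * 2 ^ s ≤ p * 2 ^ s := by gcongr
    have h4 : (S.k : ℝ) ^ 2 * (2 ^ s * 2 ^ s) ≤ (S.k : ℝ) ^ 2 * (p * 2 ^ s) := by gcongr
    have h5 : (1 : ℝ) ≤ p * 2 ^ s := by nlinarith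
    rw [panelSize, hc]
    push_cast
    nlinarith
  have hchunk : ∀ (p s : ℕ), 2 ^ s ≤ p → ((p / 2 ^ s : ℕ) + 1 : ℝ) * (2 ^ s * 2 ^ s) ≤
      2 * (p * 2 ^ s) := by
    intro p s hs
    have h1 : ((p / 2 ^ s : ℕ) : ℝ) * 2 ^ s ≤ p := by
      exact_mod_cast Nat.div_mul_le_self p (2 ^ s)
    have hs' : (2 : ℝ) ^ s ≤ p := by exact_mod_cast hs
    have h2 : (0 : ℝ) < 2 ^ s := by positivity
    nlinarith
  have hstep : ∀ (μ x : ℝ) (p s : ℕ), 0 < μ → 2 ^ s ≤ p →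
      x ≤ B * (((2 ^ s : ℕ) : ℝ) ^ 2 * (1 + (((2 ^ s : ℕ) : ℝ) ^ 2 / μ) ^ ε)) →
      2 * (((p / 2 ^ s : ℕ) + 1 : ℝ) * x) ≤ 4 * B * (p * 2 ^ s * (1 + (4 ^ s / μ) ^ ε)) := by
    intro μ x p s hμ hs hx
    have e : ((2 ^ s : ℕ) : ℝ) ^ 2 = 4 ^ s := by
      push_cast
      rw [← pow_mul, mul_comm, pow_mul]
      norm_num
    have e' : (4 : ℝ) ^ s = 2 ^ s * 2 ^ s := by rw [← mul_pow]; norm_num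
    rw [e] at hx
    have h0 : 0 ≤ 1 + ((4 : ℝ) ^ s / μ) ^ ε := by positivity
    calc 2 * (((p / 2 ^ s : ℕ) + 1 : ℝ) * x)
        ≤ 2 * (((p / 2 ^ s : ℕ) + 1 : ℝ) * (B * (4 ^ s * (1 + (4 ^ s / μ) ^ ε)))) := by gcongr
      _ = 2 * B * ((((p / 2 ^ s : ℕ) + 1 : ℝ) * (2 ^ s * 2 ^ s)) * (1 + (4 ^ s / μ) ^ ε)) := by
        rw [e']; ring
      _ ≤ 2 * B * (2 * (p * 2 ^ s) * (1 + (4 ^ s / μ) ^ ε)) :=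
        mul_le_mul_of_nonneg_left (mul_le_mul_of_nonneg_right (hchunk p s hs) h0) (by linarith)
      _ = _ := by ring
  have hfin : ∀ (μ : ℝ) (p s : ℕ), 0 < μ → 2 ^ s ≤ p →
      A * (p * 2 ^ s * (1 + (p * 2 ^ s / μ) ^ ε)) ≤
        A * ((p : ℝ) ^ 2 * (1 + ((p : ℝ) ^ 2 / μ) ^ ε)) := by
    intro μ p s hμ hs
    have hs' : (2 : ℝ) ^ s ≤ p := by exact_mod_cast hs
    have : (p : ℝ) * 2 ^ s ≤ (p : ℝ) ^ 2 := by rw [sq]; gcongr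
    gcongr
  have hp1 : ∀ p s : ℕ, 2 ^ s ≤ p → (1 : ℝ) ≤ p := fun p s hs => by
    exact_mod_cast (Nat.one_le_two_pow).trans hs
  refine ⟨A, hA, fun M p s hM hs => ?_, fun p s hs => ?_⟩
  · have hM' : (0 : ℝ) < M := by exact_mod_cast hM
    have hp := hp1 p s hs
    refine (h M p (fun s => elimWords S M p s) hM' hp ?_ (fun s hs => ?_) s
      (by exact_mod_cast hs)).trans (hfin M p s hM' hs)
    · simp only [elimWords]
      push_cast
      nlinarith
    · have hs1 : 2 ^ (s + 1) ≤ p := by exact_mod_cast hs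
      have hs0 : 2 ^ s ≤ p := (Nat.pow_le_pow_right (by norm_num) (Nat.le_succ s)).trans hs1
      have hz := hsize p (s + 1) hs1
      simp only [elimWords]
      split_ifs with hfit
      · left
        push_cast
        linarith
      · right
        rw [not_le] at hfit
        have hfit' : (M : ℝ) < panelSize S p (s + 1) + 2 := by exact_mod_cast hfit
        have h0 : (0 : ℝ) ≤ panelSize S p (s + 1) := by positivity
        refine ⟨by linarith, ?_⟩
        have := hstep M _ p s hM' hs0 (hW M (2 ^ s) hM (by positivity))
        push_cast at this ⊢
        linarith
  · have hp := hp1 p s hs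
    refine (h 1 p (fun s => elimTime S p s) one_pos hp ?_ (fun s hs => ?_) s
      (by exact_mod_cast hs)).trans (hfin 1 p s one_pos hs)
    · simp only [elimTime]
      push_cast
      nlinarith
    · have hs1 : 2 ^ (s + 1) ≤ p := by exact_mod_cast hs
      have hs0 : 2 ^ s ≤ p := (Nat.pow_le_pow_right (by norm_num) (Nat.le_succ s)).trans hs1
      right
      constructor
      · have h1 : (1 : ℝ) ≤ 2 ^ (s + 1) := one_le_pow₀ (by norm_num)
        have h2 : (1 : ℝ) ≤ p * 2 ^ (s + 1) := by nlinarith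
        nlinarith
      · have := hstep 1 _ p s one_pos hs0 (hT (2 ^ s) (by positivity))
        simp only [elimTime]
        push_cast at this ⊢
        linarith

end
/-! ### One pass through the main loop -/

/-- The matrix `X` is stored in array `a`. -/
def HoldsAt {p q : ℕ} (st : Store) (a : ℕ) (X : Matrix (Fin p) (Fin q) ℝ) : Prop :=
  ∀ (i : Fin p) (j : Fin q), st (a, i, j) = X i j

/-- Slow memory after overwriting array `a` by an `N × N` matrix. -/
def writeStore {N : ℕ} (st : Store) (a : ℕ) (X : Matrix (Fin N) (Fin N) ℝ) : Store := fun x =>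
  if h : x.1 = a ∧ x.2.1 < N ∧ x.2.2 < N then X ⟨x.2.1, h.2.1⟩ ⟨x.2.2, h.2.2⟩ else st x

theorem memOf_write {M N : ℕ} (f : Fin M → ℝ) (st : Store) (a : ℕ)
    (X : Matrix (Fin N) (Fin N) ℝ) :
    (memOf f st).write a X = memOf (fun _ => 0) (writeStore st a X) := rfl

/-- The word in row `i` of array `a`, in column `t` of the block columns `I` and `J`. -/
def colA (b a I J i t : ℕ) : Addr := (a, i, if t < b then I * b + t else J * b + (t - b))

theorem colA_inj {b a I J i t i' t' : ℕ} (hIJ : I ≠ J) (ht : t < 2 * b) (ht' : t' < 2 * b)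
    (h : colA b a I J i t = colA b a I J i' t') : i = i' ∧ t = t' := by
  simp only [colA, Prod.mk.injEq, true_and] at h
  refine ⟨h.1, ?_⟩
  have h := h.2
  split_ifs at h with h1 h2 h2
  · exact (block_index_inj h1 h2 h).2
  · exact absurd (block_index_inj h1 (by omega) h).1 hIJ
  · exact absurd (block_index_inj (by omega) h2 h).1 hIJ.symm
  · have := (block_index_inj (by omega) (by omega) h).2
    omega

theorem colA_eq {n b : ℕ} (a : ℕ) (I J : Fin (n / b)) (i : ℕ) (t : Fin (2 * b)) :
    colA b a I J i t = (a, i, (pairCol I J t : ℕ)) := rfl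

section

variable (S : StrassenLike)

/-- Multiply block columns `I` and `J` of array `a` by the matrix in array `5`, with its columns
permuted by `σ`. -/
def rotate (b a h I J : ℕ) (σ : Equiv.Perm (Fin (2 * b))) : Comp Unit :=
  tallMul S (level S (2 * b)) 0 1 h (2 * b) (2 * b) (colA b a I J) (fun t j => (5, t, row σ j))
    (colA b a I J)

/-- The permuted matrix Q Pᵀ is never formed: its columns are addressed through σ. Each chunk of
rows is updated in place. -/
theorem rotate_spec {n b h : ℕ} (hb : 0 < b) (a : ℕ) (ha : a < 5) {I J : Fin (n / b)} (hIJ : I < J)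
    (σ : Equiv.Perm (Fin (2 * b))) (X : Matrix (Fin h) (Fin n) ℝ)
    (Q : Matrix (Fin (2 * b)) (Fin (2 * b)) ℝ) (st : Store) (hX : HoldsAt st a X)
    (hQ : HoldsAt st 5 Q) :
    MulBlockCols I J (Q.submatrix id σ) X
      (Matrix.of fun i j => (rotate S b a h I J σ).fin st (a, i, j)) ∧
    ∀ x : Addr, x.1 < 10 → x.1 ≠ a → (rotate S b a h I J σ).fin st x = st x := by
  have hne : (I : ℕ) ≠ J := (Fin.lt_def.1 hIJ).ne
  obtain ⟨h1, h2⟩ := fin_tallMul S (level S (2 * b)) 0 1 h (2 * b) (2 * b) (colA b a I J)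
    (fun t j => (5, t, row σ j)) (colA b a I J) (by omega) (le_pow_level S _) (le_pow_level S _)
    (fun i j => by simp only [colA]; omega) (by simp) (fun i j => by simp only [colA]; omega)
    (fun i j i' j' _ hj _ hj' e => colA_inj hne hj hj' e)
    (fun i j i' j' _ hj _ hj' e => (colA_inj hne hj hj' e).1)
    (fun i j t j' _ _ _ _ e => by
      simp only [colA, Prod.mk.injEq] at e
      omega) st
  refine ⟨⟨?_, fun j hj i => ?_⟩, fun x hx hxa => h2 x hx fun i j _ _ e => hxa (by simp [e, colA])⟩
  · ext i j
    have := h1 i j i.2 j.2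
    rw [colA_eq] at this
    simp only [Matrix.submatrix_apply, Matrix.of_apply, Matrix.mul_apply, id]
    rw [rotate, this, mul_zero, zero_add, mul_one, sum_range]
    refine sum_congr rfl fun t _ => ?_
    rw [colA_eq, hX, row_val, hQ]
  · rw [Matrix.of_apply, ← hX]
    refine h2 _ (by simp only; omega) fun i' t _ ht e => hj ⟨⟨t, ht⟩, ?_⟩
    have := colA_eq a I J i' ⟨t, ht⟩
    simp only at this
    rw [this] at e
    simp only [Prod.mk.injEq, true_and] at e
    exact Fin.ext e.2.symm

/-- The block rotation: optional pivoting, and multiplication of `G` and `V`. -/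
def rotateBoth (b m n I J : ℕ) (pivot : Bool) : Comp Unit :=
  (if pivot then
    (forAll (box (2 * b) b) fun x => step (.lin 1 0) (5, x.2, x.1) (5, x.2, x.1) (6, x.1, x.2)).andThen
      (eliminate S (Nat.clog 2 b) 0 1)
  else .pure 1 : Comp (Equiv.Perm (Fin (2 * b)))).bind fun σ =>
  (rotate S b 0 m I J σ).andThen (rotate S b 1 n I J σ)

/-- The panel width is b rounded up to a power of two; it must not exceed the height 2b of the
panel. -/
theorem two_pow_clog_le {b : ℕ} (hb : 0 < b) : 2 ^ Nat.clog 2 b ≤ 2 * b := by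
  rcases Nat.lt_or_ge 1 b with h | h
  · have h1 := Nat.pow_pred_clog_lt_self (b := 2) one_lt_two h
    have h2 := Nat.clog_pos one_lt_two h
    rw [← Nat.succ_pred_eq_of_pos h2, pow_succ]
    omega
  · obtain rfl : b = 1 := by omega
    simp

theorem mul_transpose_permMatrix {N : ℕ} (Q : Matrix (Fin N) (Fin N) ℝ)
    (σ : Equiv.Perm (Fin N)) : Q * (σ.permMatrix ℝ)ᵀ = Q.submatrix id σ := by
  ext i j
  rw [Matrix.mul_apply, Finset.sum_eq_single (σ j)]
  · simp [Equiv.Perm.permMatrix, PEquiv.toMatrix_apply]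
  · intro l _ hl
    simp [Equiv.Perm.permMatrix, PEquiv.toMatrix_apply, hl.symm]
  · simp

/-- Pivoting works on a transposed copy in array 6, so G, V and the eigenvectors survive it. The
columns of the panel from b on hold arbitrary values, which is harmless by `Elim.isLUPP`. -/
theorem rotateBoth_spec {m n b : ℕ} (hb : 0 < b) {I J : Fin (n / b)} (hIJ : I < J) (pivot : Bool)
    (D : Diagonalizer (2 * b)) (A : Matrix (Fin (2 * b)) (Fin (2 * b)) ℝ)
    (G : Matrix (Fin m) (Fin n) ℝ) (V : Matrix (Fin n) (Fin n) ℝ) (st : Store)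
    (hG : HoldsAt st 0 G) (hV : HoldsAt st 1 V) (hQ : HoldsAt st 5 (D.vecs A)) :
    ∃ W, IsRotation D pivot A W ∧
      MulBlockCols I J W G
        (Matrix.of fun i j => (rotateBoth S b m n I J pivot).fin st (0, i, j)) ∧
      MulBlockCols I J W V
        (Matrix.of fun i j => (rotateBoth S b m n I J pivot).fin st (1, i, j)) := by
  have key : ∀ (σ : Equiv.Perm (Fin (2 * b))) (st' : Store),
      (∀ x : Addr, x.1 < 6 → st' x = st x) →
      MulBlockCols I J ((D.vecs A).submatrix id σ) G (Matrix.of fun i j =>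
        ((rotate S b 0 m I J σ).andThen (rotate S b 1 n I J σ)).fin st' (0, i, j)) ∧
      MulBlockCols I J ((D.vecs A).submatrix id σ) V (Matrix.of fun i j =>
        ((rotate S b 0 m I J σ).andThen (rotate S b 1 n I J σ)).fin st' (1, i, j)) := by
    intro σ st' hst'
    obtain ⟨a1, a2⟩ := rotate_spec S hb 0 (by norm_num) hIJ σ G (D.vecs A) st'
      (fun i j => (hst' _ (by simp)).trans (hG i j))
      (fun i j => (hst' _ (by simp)).trans (hQ i j))
    obtain ⟨b1, b2⟩ := rotate_spec S hb 1 (by norm_num) hIJ σ V (D.vecs A)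
      ((rotate S b 0 m I J σ).fin st')
      (fun i j => (a2 _ (by simp) (by simp)).trans ((hst' _ (by simp)).trans (hV i j)))
      (fun i j => (a2 _ (by simp) (by simp)).trans ((hst' _ (by simp)).trans (hQ i j)))
    rw [fin_andThen]
    refine ⟨?_, b1⟩
    have e : ∀ (i : Fin m) (j : Fin n), (rotate S b 1 n I J σ).fin
        ((rotate S b 0 m I J σ).fin st') (0, i, j) = (rotate S b 0 m I J σ).fin st' (0, i, j) :=
      fun i j => b2 _ (by simp) (by simp)
    simpa only [e] using a1
  cases pivot with
  | false =>
    refine ⟨D.vecs A, by simp [IsRotation], ?_⟩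
    simpa [rotateBoth] using key 1 st fun _ _ => rfl
  | true =>
    simp only [rotateBoth, if_true, fin_bind, fin_andThen, val_andThen]
    obtain ⟨c1, c2⟩ := forAll_parallel (box (2 * b) b)
      (fun x => step (.lin 1 0) (5, x.2, x.1) (5, x.2, x.1) (6, x.1, x.2))
      (fun x => ((6, x.1, x.2) : Addr)) (fun x st => st (5, x.2, x.1)) ∅
      (fun x _ y _ h => by simpa [Prod.ext_iff] using h) (by simp)
      (fun x _ st => by simp [Op.eval]) (fun x _ st a ha _ => by simp [ha])
      (fun x _ st st' h => h _ (by simp) (by simp)) st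
    set st₁ := (forAll (box (2 * b) b) fun x =>
      step (.lin 1 0) (5, x.2, x.1) (5, x.2, x.1) (6, x.1, x.2)).fin st
    obtain ⟨-, e2, e3⟩ := eliminate_spec S (p := 2 * b) (Nat.clog 2 b) 0
      (by rw [zero_add]; exact two_pow_clog_le hb) 1 st₁
    set σ := (eliminate S (p := 2 * b) (Nat.clog 2 b) 0 1).val st₁
    rw [zero_add] at e2
    obtain ⟨L, U, hLU⟩ := e2.isLUPP ((D.vecs A).submatrix (Fin.castLE (by omega : b ≤ 2 * b)) id)ᵀ
      (Nat.le_pow_clog one_lt_two b) (fun i j => by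
        rw [yA, row_val, c1 (σ i, j) (by simp)]
        exact (hQ (Fin.castLE (by omega) j) (σ i)).symm)
    simp only [fin_andThen] at key
    refine ⟨(D.vecs A).submatrix id σ, ?_, ?_⟩
    · rw [IsRotation, if_pos rfl]
      exact ⟨σ, L, U, hLU, (mul_transpose_permMatrix _ _).symm⟩
    · refine key σ _ fun x hx => ?_
      rw [e3 x (by omega) (by omega) (by omega), c2 x (by simp) ?_]
      rintro y - rfl
      simp at hx

def rotateWords (M b m n : ℕ) : ℕ :=
  3 * (2 * b * b) + elimWords S M (2 * b) (Nat.clog 2 b) +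
    (m / (2 * b) + 1) * mmaWords S M (level S (2 * b)) +
    (n / (2 * b) + 1) * mmaWords S M (level S (2 * b))

def rotateTime (b m n : ℕ) : ℕ :=
  2 * b * b + elimTime S (2 * b) (Nat.clog 2 b) +
    (m / (2 * b) + 1) * mmaTime S (level S (2 * b)) +
    (n / (2 * b) + 1) * mmaTime S (level S (2 * b))

theorem cost_rotateBoth {M : ℕ} (hM : 3 ≤ M) {b : ℕ} (hb : 0 < b) (m n I J : ℕ) (pivot : Bool) :
    (rotateBoth S b m n I J pivot).Cost M (rotateWords S M b m n) (5 * rotateTime S b m n) := by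
  have h2 : ∀ σ, ((rotate S b 0 m I J σ).andThen (rotate S b 1 n I J σ)).Cost M _ _ := fun σ =>
    (cost_tallMul S hM _ _ _ _ _ _ _ _ _ (le_pow_level S _) (le_pow_level S _)).andThen
    (cost_tallMul S hM _ _ _ _ _ _ _ _ _ (le_pow_level S _) (le_pow_level S _))
  have h1 : (if pivot then
      (forAll (box (2 * b) b) fun x =>
        step (.lin 1 0) (5, x.2, x.1) (5, x.2, x.1) (6, x.1, x.2)).andThen
        (eliminate S (Nat.clog 2 b) 0 1)
      else .pure 1 : Comp (Equiv.Perm (Fin (2 * b)))).Cost M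
      (3 * (2 * b * b) + elimWords S M (2 * b) (Nat.clog 2 b))
      (5 * (2 * b * b) + 5 * elimTime S (2 * b) (Nat.clog 2 b)) := by
    split_ifs
    · refine ((bdd_forAll (S := Set.univ) (n := 1) _ fun x _ => bdd_step _ trivial trivial
        trivial).mono subset_rfl (by simp)).cost_slow hM |>.andThen
        (cost_eliminate S hM _ 0 (by rw [zero_add]; exact two_pow_clog_le hb) 1)
    · exact (cost_pure _).mono (by omega) (by omega)
  refine (h1.bind h2).mono ?_ ?_
  · rw [rotateWords]; omega
  · rw [rotateTime]; omega

/-- Words moved and operations for one pair of block columns, outside the black boxes. -/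
def stepWords (M b m n : ℕ) : ℕ :=
  3 * (2 * b) ^ 2 + (m / (2 * b) + 1) * mmaWords S M (level S (2 * b)) + (2 * b) ^ 2 +
    rotateWords S M b m n

def stepTime (b m n : ℕ) : ℕ :=
  (2 * b) ^ 2 + (m / (2 * b) + 1) * mmaTime S (level S (2 * b)) + rotateTime S b m n

/-- The black-box calls destroy fast memory, which no compiled piece relies on. The continuation `k`
follows both outcomes of the test. The bound `d` enters only the cost estimate, after the program
has been fixed; the method is called on a Gram matrix, which is symmetric. -/
theorem exists_step {M m n b : ℕ} (hM : 3 ≤ M) (hb : 0 < b) (p : Fin (n / b) × Fin (n / b))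
    (hp : p.1 < p.2) (pivot : Bool) :
    ∃ stp : Prog M → Prog M, ∀ (D : Diagonalizer (2 * b))
      (far : Matrix (Fin (2 * b)) (Fin (2 * b)) ℝ → Prop) (k : Prog M) (f : Fin M → ℝ)
      (st : Store) (G : Matrix (Fin m) (Fin n) ℝ) (V : Matrix (Fin n) (Fin n) ℝ),
      HoldsAt st 0 G → HoldsAt st 1 V →
      ∃ (f' : Fin M → ℝ) (st' : Store) (T : Matrix (Fin m) (Fin n) ℝ × Matrix (Fin n) (Fin n) ℝ)
        (w t : ℕ), (stp k).run D far (memOf f st) =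
          (k.run D far (memOf f' st')).charge w t ∧
        Step D far pivot p (G, V) T ∧ HoldsAt st' 0 T.1 ∧ HoldsAt st' 1 T.2 ∧
        t ≤ 5 * stepTime S b m n ∧
        ∀ d : ℝ, (∀ A, A.IsSymm → (D.words A : ℝ) ≤ d) → (w : ℝ) ≤ stepWords S M b m n + d := by
  obtain ⟨I, J⟩ := p
  have hIJ : I < J := hp
  obtain ⟨comp₁, h₁⟩ := cost_gram S hM (level S (2 * b)) m (2 * b) (colA b 0 I J)
    (fun i j => (4, i, j)) (le_pow_level S _)
  obtain ⟨comp₂, h₂⟩ := cost_rotateBoth S hM hb m n I J pivot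
  refine ⟨fun k => comp₁ fun _ => .test 4 (.diag 4 5 (comp₂ fun _ => k)) k,
    fun D far k f st G V hG hV => ?_⟩
  obtain ⟨w₁, hw₁, t₁, ht₁, f₁, hr₁⟩ := h₁ D far
    (fun _ => .test 4 (.diag 4 5 (comp₂ fun _ => k)) k) f st
  obtain ⟨g1, g2⟩ := fin_gram S (level S (2 * b)) m (2 * b) (colA b 0 I J)
    (fun i j => (4, i, j)) (by omega) (le_pow_level S _) (by simp [colA]) (by simp)
    (by simp) (by simp [colA]) st
  set st₁ := (gram S (level S (2 * b)) m (2 * b) (colA b 0 I J) (fun i j => (4, i, j))).fin st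
  set X := G.submatrix id (pairCol I J) with hX
  have hread : ∀ g : Fin M → ℝ, (memOf g st₁).read (2 * b) 4 = Xᵀ * X := fun g => by
    ext i j
    rw [Mem.read, Matrix.of_apply, Matrix.mul_apply]
    refine (g1 i j i.2 j.2).trans ?_
    rw [sum_range]
    refine sum_congr rfl fun t _ => ?_
    rw [colA_eq, colA_eq, hG, hG]
    rfl
  have hsymm : (Xᵀ * X).IsSymm := by
    rw [Matrix.IsSymm, Matrix.transpose_mul, Matrix.transpose_transpose]
  have hG₁ : HoldsAt st₁ 0 G := fun i j => (g2 _ (by simp) (by simp)).trans (hG i j)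
  have hV₁ : HoldsAt st₁ 1 V := fun i j => (g2 _ (by simp) (by simp)).trans (hV i j)
  rw [hr₁, Prog.run, hread]
  by_cases hfar : far (Xᵀ * X)
  · rw [if_pos hfar]
    change ∃ (f' : Fin M → ℝ) (st' : Store)
      (T : Matrix (Fin m) (Fin n) ℝ × Matrix (Fin n) (Fin n) ℝ) (w t : ℕ),
      Outcome.charge w₁ t₁ (Outcome.charge ((2 * b) ^ 2) 0 ((Prog.diag 4 5 (comp₂ fun _ => k)).run
        D far (memOf (fun _ => 0) st₁))) = _ ∧ _
    rw [Prog.run, hread, memOf_write]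
    set st₂ := writeStore st₁ 5 (D.vecs (Xᵀ * X)) with hst₂
    have hne : ∀ x : Addr, x.1 ≠ 5 → st₂ x = st₁ x := fun x hx => by
      simp [st₂, writeStore, hx]
    obtain ⟨w₂, hw₂, t₂, ht₂, f₂, hr₂⟩ := h₂ D far (fun _ => k) (fun _ => 0) st₂
    obtain ⟨W, hW, hWG, hWV⟩ := rotateBoth_spec S hb hIJ pivot D (Xᵀ * X) G V st₂
      (fun i j => (hne _ (by simp)).trans (hG₁ i j)) (fun i j => (hne _ (by simp)).trans (hV₁ i j))
      (fun i j => by simp [st₂, writeStore])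
    refine ⟨f₂, _, (_, _), w₁ + (2 * b) ^ 2 + D.words (Xᵀ * X) + w₂, t₁ + 0 + 0 + t₂, ?_,
      Or.inl ⟨hfar, W, hW, hWG, hWV⟩, fun i j => rfl, fun i j => rfl, ?_, fun d hd => ?_⟩
    · rw [hr₂, charge_charge, charge_charge, charge_charge]
      rfl
    · rw [stepTime]; omega
    · have h := hd _ hsymm
      have : w₁ + (2 * b) ^ 2 + w₂ ≤ stepWords S M b m n := by rw [stepWords]; omega
      have : ((w₁ + (2 * b) ^ 2 + w₂ : ℕ) : ℝ) ≤ stepWords S M b m n := by exact_mod_cast this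
      push_cast at this ⊢
      linarith
  · rw [if_neg hfar]
    refine ⟨fun _ => 0, st₁, (G, V), w₁ + (2 * b) ^ 2, t₁ + 0, ?_, Or.inr ⟨hfar, rfl⟩, hG₁, hV₁,
      ?_, fun d hd => ?_⟩
    · rw [charge_charge]; rfl
    · rw [stepTime]; omega
    · have h := hd _ hsymm
      -- Without a call of the method, only d ≥ 0 is needed.
      have h0 : (0 : ℝ) ≤ D.words (Xᵀ * X) := by positivity
      have : w₁ + (2 * b) ^ 2 ≤ stepWords S M b m n := by rw [stepWords]; omega
      have : ((w₁ + (2 * b) ^ 2 : ℕ) : ℝ) ≤ stepWords S M b m n := by exact_mod_cast this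
      linarith

theorem exists_sweep {M m n b : ℕ} (hM : 3 ≤ M) (hb : 0 < b)
    (pivot : Fin (n / b) × Fin (n / b) → Bool) (ps : List (Fin (n / b) × Fin (n / b)))
    (hps : ∀ p ∈ ps, p.1 < p.2) :
    ∃ stp : Prog M → Prog M, ∀ (D : Diagonalizer (2 * b))
      (far : Matrix (Fin (2 * b)) (Fin (2 * b)) ℝ → Prop) (k : Prog M) (f : Fin M → ℝ)
      (st : Store) (G : Matrix (Fin m) (Fin n) ℝ) (V : Matrix (Fin n) (Fin n) ℝ),
      HoldsAt st 0 G → HoldsAt st 1 V →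
      ∃ (f' : Fin M → ℝ) (st' : Store) (T : Matrix (Fin m) (Fin n) ℝ × Matrix (Fin n) (Fin n) ℝ)
        (w t : ℕ), (stp k).run D far (memOf f st) =
          (k.run D far (memOf f' st')).charge w t ∧
        Sweep D far pivot ps (G, V) T ∧ HoldsAt st' 0 T.1 ∧ HoldsAt st' 1 T.2 ∧
        t ≤ ps.length * (5 * stepTime S b m n) ∧
        ∀ d : ℝ, (∀ A, A.IsSymm → (D.words A : ℝ) ≤ d) →
          (w : ℝ) ≤ ps.length * (stepWords S M b m n + d) := by
  induction ps with
  | nil =>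
    refine ⟨fun k => k, fun D far k f st G V hG hV => ⟨f, st, (G, V), 0, 0, (charge_zero _).symm,
      rfl, hG, hV, by simp, by simp⟩⟩
  | cons p ps ih =>
    obtain ⟨stp, h⟩ := ih fun p hp => hps p (by simp [hp])
    obtain ⟨stp₁, h₁⟩ := exists_step S (m := m) hM hb p (hps p (by simp)) (pivot p)
    refine ⟨fun k => stp₁ (stp k), fun D far k f st G V hG hV => ?_⟩
    obtain ⟨f₁, st₁, T₁, w₁, t₁, hr₁, hs₁, hG₁, hV₁, ht₁, hw₁⟩ := h₁ D far (stp k) f st G V hG hV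
    obtain ⟨f₂, st₂, T₂, w₂, t₂, hr₂, hs₂, hG₂, hV₂, ht₂, hw₂⟩ := h D far k f₁ st₁ T₁.1 T₁.2 hG₁ hV₁
    refine ⟨f₂, st₂, T₂, w₁ + w₂, t₁ + t₂, by rw [hr₁, hr₂, charge_charge], ⟨T₁, hs₁, hs₂⟩, hG₂,
      hV₂, ?_, fun d hd => ?_⟩
    · rw [List.length_cons, Nat.succ_mul]; omega
    · have e1 := hw₁ d hd
      have e2 := hw₂ d hd
      push_cast [List.length_cons]
      linarith

end

/-! ### The factors `U` and `Σ` -/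

/-- Compute `U` and `Σ` in arrays `2` and `3`. -/
def finalize (m n : ℕ) : Comp Unit :=
  (forAll (box m n) fun x => step (.bin .mul) (0, x.1, x.2) (0, x.1, x.2) (2, x.1, x.2)).andThen <|
  (forAll (box n n) fun x => step (.const 0) (3, x.1, x.2) (3, x.1, x.2) (3, x.1, x.2)).andThen <|
  (forAll (range n) fun j =>
    (lincomb (3, j, j) (range m) (fun _ => 1) (fun i => (2, i, j))).andThen
      (step .sqrt (3, j, j) (3, j, j) (3, j, j))).andThen <|
  forAll (box m n) fun x => step (.bin .div) (0, x.1, x.2) (3, x.2, x.2) (2, x.1, x.2)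

/-- Array 2 first holds the squares of the entries and is overwritten by U at the end. For a zero
column, x / 0 = 0 agrees with the pseudoinverse. -/
theorem finalize_spec {m n : ℕ} (st : Store) (G : Matrix (Fin m) (Fin n) ℝ)
    (hG : HoldsAt st 0 G) :
    HoldsAt ((finalize m n).fin st) 2 (leftFactor G) ∧
    HoldsAt ((finalize m n).fin st) 3 (sigmaFactor G) ∧
    ∀ x : Addr, x.1 < 2 → (finalize m n).fin st x = st x := by
  simp only [finalize, fin_andThen]
  obtain ⟨a1, a2⟩ := forAll_parallel (box m n)
    (fun x => step (.bin .mul) (0, x.1, x.2) (0, x.1, x.2) (2, x.1, x.2))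
    (fun x => ((2, x.1, x.2) : Addr)) (fun x st => st (0, x.1, x.2) * st (0, x.1, x.2)) ∅
    (fun x _ y _ h => by simpa [Prod.ext_iff] using h) (by simp)
    (fun x _ st => by simp [Op.eval, BinOp.eval]) (fun x _ st a ha _ => by simp [ha])
    (fun x _ st st' h => by rw [h (0, x.1, x.2) (by simp) (by simp)]) st
  set st₁ := (forAll (box m n) fun x =>
    step (.bin .mul) (0, x.1, x.2) (0, x.1, x.2) (2, x.1, x.2)).fin st
  obtain ⟨b1, b2⟩ := forAll_parallel (box n n)
    (fun x => step (.const 0) (3, x.1, x.2) (3, x.1, x.2) (3, x.1, x.2))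
    (fun x => ((3, x.1, x.2) : Addr)) (fun x st => 0) ∅
    (fun x _ y _ h => by simpa [Prod.ext_iff] using h) (by simp)
    (fun x _ st => by simp [Op.eval]) (fun x _ st a ha _ => by simp [ha])
    (fun x _ st st' h => rfl) st₁
  set st₂ := (forAll (box n n) fun x =>
    step (.const 0) (3, x.1, x.2) (3, x.1, x.2) (3, x.1, x.2)).fin st₁
  obtain ⟨c1, c2⟩ := forAll_parallel (range n)
    (fun j => (lincomb (3, j, j) (range m) (fun _ => 1) (fun i => (2, i, j))).andThen
      (step .sqrt (3, j, j) (3, j, j) (3, j, j)))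
    (fun j => ((3, j, j) : Addr)) (fun j st => Real.sqrt (∑ i ∈ range m, 1 * st (2, i, j))) ∅
    (fun x _ y _ h => by simpa using h) (by simp)
    (fun j _ st => by
      rw [fin_andThen, fin_step, Function.update_self, Op.eval, fin_lincomb _ _ _ _ (by simp)])
    (fun j _ st a ha _ => by
      rw [fin_andThen, fin_step, Function.update_of_ne ha, fin_lincomb_of_ne _ _ _ _ _ ha])
    (fun j _ st st' h => by
      congr 1
      refine sum_congr rfl fun i _ => ?_
      rw [h (2, i, j) (by simp) (by simp)]) st₂
  set st₃ := (forAll (range n) fun j =>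
    (lincomb (3, j, j) (range m) (fun _ => 1) (fun i => (2, i, j))).andThen
      (step .sqrt (3, j, j) (3, j, j) (3, j, j))).fin st₂
  obtain ⟨d1, d2⟩ := forAll_parallel (box m n)
    (fun x => step (.bin .div) (0, x.1, x.2) (3, x.2, x.2) (2, x.1, x.2))
    (fun x => ((2, x.1, x.2) : Addr)) (fun x st => st (0, x.1, x.2) / st (3, x.2, x.2)) ∅
    (fun x _ y _ h => by simpa [Prod.ext_iff] using h) (by simp)
    (fun x _ st => by simp [Op.eval, BinOp.eval]) (fun x _ st a ha _ => by simp [ha])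
    (fun x _ st st' h => by
      rw [h (0, x.1, x.2) (by simp) (by simp), h (3, x.2, x.2) (by simp) (by simp)]) st₃
  have fr : ∀ x : Addr, x.1 < 2 → st₃ x = st x := fun x hx => by
    rw [c2 x (by simp) (by rintro i - rfl; simp at hx),
      b2 x (by simp) (by rintro i - rfl; simp at hx),
      a2 x (by simp) (by rintro i - rfl; simp at hx)]
  have hnorm : ∀ j : Fin n, st₃ (3, j, j) = colNorm G j := fun j => by
    rw [c1 j (by simp), colNorm, sum_range]
    congr 1
    refine sum_congr rfl fun i _ => ?_
    rw [b2 _ (by simp) (by simp), a1 (i, j) (by simp)]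
    rw [hG, one_mul, sq]
  refine ⟨fun i j => ?_, fun i j => ?_, fun x hx => ?_⟩
  · refine (d1 (i, j) (by simp)).trans ?_
    rw [fr _ (by simp), hG, hnorm, leftFactor, Matrix.mul_diagonal, div_eq_mul_inv]
  · rw [d2 _ (by simp) (by simp), sigmaFactor]
    by_cases hij : i = j
    · rw [hij, hnorm, Matrix.diagonal_apply_eq]
    · rw [Matrix.diagonal_apply_ne _ hij, c2 _ (by simp) (by
        rintro l - e
        simp only [Prod.mk.injEq, true_and] at e
        exact hij (Fin.ext (e.1.trans e.2.symm)))]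
      exact b1 (i, j) (by simp)
  · rw [d2 x (by simp) (by rintro i - rfl; simp at hx), fr x hx]

theorem cost_finalize {M : ℕ} (hM : 3 ≤ M) {m n : ℕ} (hnm : n ≤ m) :
    (finalize m n).Cost M (18 * (m * n)) (30 * (m * n)) := by
  have hB : (finalize m n).Bdd Set.univ (6 * (m * n)) := by
    have hX : ∀ a : Addr, a ∈ (Set.univ : Set Addr) := Set.mem_univ
    refine ((bdd_forAll (n := 1) _ fun x _ => bdd_step _ (hX _) (hX _) (hX _)).andThen <|
      (bdd_forAll (n := 1) _ fun x _ => bdd_step _ (hX _) (hX _) (hX _)).andThen <|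
      (bdd_forAll _ fun j _ => (bdd_lincomb (hX _) fun _ _ => hX _).andThen
        (bdd_step _ (hX _) (hX _) (hX _))).andThen <|
      bdd_forAll (n := 1) _ fun x _ => bdd_step _ (hX _) (hX _) (hX _)).mono subset_rfl ?_
    simp only [card_box, card_range]
    rcases Nat.eq_zero_or_pos n with rfl | hn
    · simp
    · have h1 := Nat.mul_le_mul_right n hnm
      have h2 := Nat.mul_le_mul_right n (hn.trans_le hnm : 1 ≤ m)
      nlinarith
  exact (hB.cost_slow hM).mono (by omega) (by omega)

/-! ### The total cost -/

/-- Since (2b)² ≥ μ, the power z = ((2b)²/μ)^ε is at least 1, so 1 + z ≤ 2z. Both n and m are cut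
into at most m/b chunks, and L b² ≤ n² then gives a total of order (m n²/b) z. The factor (2²)^ε
converts (2b)² to b². The final term in mn is absorbed because b ≤ n. Words are the case μ = M,
operations μ = 1. -/
theorem sweep_bound (ε A : ℝ) (hε : 0 < ε) (hA : 0 < A) :
    ∃ C : ℝ, 0 < C ∧ ∀ (μ mm el : ℝ) (m n b L : ℕ), 0 < μ → μ ≤ (2 * b : ℝ) ^ 2 → 0 < b →
      n ≤ m → b ≤ n ∨ n = 0 → (L : ℝ) * b ^ 2 ≤ (n : ℝ) ^ 2 → (L = 0 ∨ 2 * b ≤ n) →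
      mm ≤ A * ((2 * b : ℝ) ^ 2 * (1 + ((2 * b : ℝ) ^ 2 / μ) ^ ε)) →
      el ≤ A * ((2 * b : ℝ) ^ 2 * (1 + ((2 * b : ℝ) ^ 2 / μ) ^ ε)) →
      L * (10 * (2 * b : ℝ) ^ 2 + el + 2 * (((m / (2 * b) : ℕ) + 1 : ℝ) * mm) +
        ((n / (2 * b) : ℕ) + 1 : ℝ) * mm) + 18 * (m * n) ≤
      C * (m * (n : ℝ) ^ 2 * (b : ℝ) ^ (2 * ε - 1) / μ ^ ε) := by
  have h2ε : 0 < ((2 : ℝ) ^ 2) ^ ε := by positivity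
  refine ⟨(8 * (10 + 7 * A) + 18) * ((2 : ℝ) ^ 2) ^ ε, by positivity,
    fun μ mm el m n b L hμ hμb hb hnm hbn hL hL' hmm hel => ?_⟩
  have hb' : (0 : ℝ) < b := by exact_mod_cast hb
  have hnm' : (n : ℝ) ≤ m := by exact_mod_cast hnm
  have hm0 : (0 : ℝ) ≤ m := by positivity
  have hn0 : (0 : ℝ) ≤ n := by positivity
  set z := ((2 * b : ℝ) ^ 2 / μ) ^ ε with hz
  have hz1 : 1 ≤ z := by
    apply Real.one_le_rpow _ hε.le
    rwa [one_le_div hμ]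
  set E := (m : ℝ) * (n : ℝ) ^ 2 / b * z with hE
  have hrhs : (m * (n : ℝ) ^ 2 * (b : ℝ) ^ (2 * ε - 1) / μ ^ ε) * ((2 : ℝ) ^ 2) ^ ε = E := by
    rw [hE, hz, Real.div_rpow (by positivity) hμ.le, mul_pow, Real.mul_rpow (by positivity)
      (by positivity), Real.rpow_sub hb', Real.rpow_one, ← Real.rpow_natCast (b : ℝ) 2,
      ← Real.rpow_mul hb'.le]
    push_cast
    ring
  have hE0 : 0 ≤ E := by positivity
  have h18 : (m : ℝ) * n ≤ E := by
    rcases hbn with hbn | rfl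
    · have hbn' : (b : ℝ) ≤ n := by exact_mod_cast hbn
      have h1 : 1 ≤ (n : ℝ) / b := by rwa [one_le_div hb']
      have h2 : 1 ≤ (n : ℝ) / b * z := by nlinarith
      calc (m : ℝ) * n ≤ m * n * (n / b * z) := le_mul_of_one_le_right (by positivity) h2
        _ = E := by rw [hE]; ring
    · simpa using hE0
  have hmain : (L : ℝ) * (10 * (2 * b : ℝ) ^ 2 + el + 2 * (((m / (2 * b) : ℕ) + 1 : ℝ) * mm) +
        ((n / (2 * b) : ℕ) + 1 : ℝ) * mm) ≤ 8 * (10 + 7 * A) * E := by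
    rcases hL' with rfl | h2b
    · have : 0 ≤ 8 * (10 + 7 * A) * E := by positivity
      simpa using this
    set Φ := (2 * b : ℝ) ^ 2 * (1 + z) with hΦ
    have hΦ0 : 0 ≤ Φ := by positivity
    have hm2 : 2 * (b : ℝ) ≤ m := by
      have : 2 * b ≤ m := h2b.trans hnm
      exact_mod_cast this
    set v := (m : ℝ) / b with hv
    -- A pair of distinct blocks forces 2b ≤ n ≤ m, so the extra chunk from rounding is at most v/2.
    have hv2 : 2 ≤ v := by rw [hv, le_div_iff₀ hb']; linarith
    have hchunk : ∀ x : ℕ, x ≤ m → ((x / (2 * b) : ℕ) + 1 : ℝ) ≤ v := by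
      intro x hx
      have h1 : ((x / (2 * b) : ℕ) : ℝ) ≤ (x : ℝ) / ((2 * b : ℕ) : ℝ) := Nat.cast_div_le
      have h2 : (x : ℝ) / ((2 * b : ℕ) : ℝ) ≤ v / 2 := by
        rw [hv, div_div, mul_comm (b : ℝ) 2]
        push_cast
        gcongr
      linarith
    have e1 : (2 * b : ℝ) ^ 2 ≤ Φ := by
      rw [hΦ]
      exact le_mul_of_one_le_right (by positivity) (by linarith)
    have hAΦ : 0 ≤ A * Φ := by positivity
    have e2 : ∀ x : ℕ, x ≤ m → ((x / (2 * b) : ℕ) + 1 : ℝ) * mm ≤ v * (A * Φ) := fun x hx =>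
      (mul_le_mul_of_nonneg_left hmm (by positivity)).trans
        (mul_le_mul_of_nonneg_right (hchunk x hx) hAΦ)
    have e3 := e2 m le_rfl
    have e4 := e2 n hnm
    have hsum : 10 * (2 * b : ℝ) ^ 2 + el + 2 * (((m / (2 * b) : ℕ) + 1 : ℝ) * mm) +
        ((n / (2 * b) : ℕ) + 1 : ℝ) * mm ≤ v * Φ * (10 + 7 * A) := by
      have h1 : Φ ≤ v * Φ := le_mul_of_one_le_left hΦ0 (by linarith)
      have h2 : A * Φ ≤ v * (A * Φ) := le_mul_of_one_le_left hAΦ (by linarith)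
      have h3 : 0 ≤ v * (A * Φ) := by positivity
      linarith
    have hLv : (L : ℝ) * (v * Φ) ≤ 8 * E :=
      calc (L : ℝ) * (v * Φ) = 4 * (L * b ^ 2) * (m / b) * (1 + z) := by
            rw [hΦ, hv]; ring
        _ ≤ 4 * (n : ℝ) ^ 2 * (m / b) * (z + z) := by gcongr
        _ = 8 * E := by rw [hE]; ring
    calc (L : ℝ) * (10 * (2 * b : ℝ) ^ 2 + el + 2 * (((m / (2 * b) : ℕ) + 1 : ℝ) * mm) +
          ((n / (2 * b) : ℕ) + 1 : ℝ) * mm)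
        ≤ L * (v * Φ * (10 + 7 * A)) := by gcongr
      _ = L * (v * Φ) * (10 + 7 * A) := by ring
      _ ≤ 8 * E * (10 + 7 * A) := by gcongr
      _ = 8 * (10 + 7 * A) * E := by ring
  have : (8 * (10 + 7 * A) + 18) * ((2 : ℝ) ^ 2) ^ ε *
      (m * (n : ℝ) ^ 2 * (b : ℝ) ^ (2 * ε - 1) / μ ^ ε) = (8 * (10 + 7 * A) + 18) * E := by
    rw [← hrhs]; ring
  rw [this]
  linarith

end JacobiIO

end

/-! ### Assembly of the main theorem -/

open JacobiIO in
theorem mainTheorem10 (S : StrassenLike) (ω₀ : ℝ) (hω₂ : 2 < ω₀) (hω₃ : ω₀ ≤ 3)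
    (hS : (S.r : ℝ) ≤ (S.k : ℝ) ^ ω₀) (cU : ℝ) (hcU : 0 < cU) :
    ∃ C : ℝ, 0 < C ∧
      ∀ M m n b : ℕ, 3 ≤ M → Real.sqrt M / 2 < b → b ∣ n → n ≤ m →
      ∀ (order : List (Fin (n / b) × Fin (n / b))) (pivot : Fin (n / b) × Fin (n / b) → Bool),
        IsSweepOrder order →
      ∃ P : Prog M,
        ∀ (U : ℕ → ℝ) (D : Diagonalizer (2 * b))
          (far : Matrix (Fin (2 * b)) (Fin (2 * b)) ℝ → Prop),
          (∀ A : Matrix (Fin (2 * b)) (Fin (2 * b)) ℝ, A.IsSymm →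
            (D.words A : ℝ) ≤ cU * U (2 * b)) →
        ∀ (G : Matrix (Fin m) (Fin n) ℝ) (V : Matrix (Fin n) (Fin n) ℝ) (s : Mem M),
          s.Holds 0 G → s.Holds 1 V →
          (P.run D far s).IsSweep D far pivot order G V ∧
          ((P.run D far s).flops : ℝ) ≤ C * (m * (n : ℝ) ^ 2 * (b : ℝ) ^ (ω₀ - 3)) ∧
          ((P.run D far s).words : ℝ) ≤
            C * (m * (n : ℝ) ^ 2 * (b : ℝ) ^ (ω₀ - 3) / (M : ℝ) ^ (ω₀ / 2 - 1) +
              (⌈(n : ℝ) / b⌉₊ : ℝ) ^ 2 * U (2 * b)) := by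
  -- With this ε, k^ω₀ = (k²)^(1+ε), b^(ω₀−3) = b^(2ε−1) and M^(ω₀/2−1) = M^ε.
  set ε : ℝ := ω₀ / 2 - 1 with hε
  have hε0 : 0 < ε := by rw [hε]; linarith
  have hr : (S.r : ℝ) ≤ ((S.k : ℝ) ^ 2) ^ (1 + ε) := by
    refine hS.trans (le_of_eq ?_)
    rw [← Real.rpow_natCast (S.k : ℝ) 2, ← Real.rpow_mul (by positivity)]
    congr 1
    rw [hε]
    push_cast
    ring
  obtain ⟨A₁, hA₁, hmw, hmt⟩ := mma_bounds S ε hε0 hr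
  obtain ⟨A₂, hA₂, hew, het⟩ := elim_bounds S ε hε0 hr
  obtain ⟨C, hC, hbound⟩ := sweep_bound ε (A₁ + A₂) hε0 (by positivity)
  -- The 5 is the number of machine instructions per elementary operation; cU pays for the
  -- diagonalization method.
  refine ⟨5 * C + cU, by positivity, fun M m n b hM hMb hbn hnm order pivot hord => ?_⟩
  have hb' : (0 : ℝ) < b := lt_of_le_of_lt (by positivity) hMb
  have hb : 0 < b := by exact_mod_cast hb'
  have hM' : (0 : ℝ) < M := by
    have : 0 < M := by omega
    exact_mod_cast this
  -- The hypothesis on b in the form used for the words: two block columns give a 2b × 2b matrix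
  -- with at least M entries.
  have hMb2 : (M : ℝ) ≤ (2 * b : ℝ) ^ 2 := by
    have h1 : Real.sqrt M ≤ 2 * b := by linarith
    calc (M : ℝ) = Real.sqrt M ^ 2 := (Real.sq_sqrt hM'.le).symm
      _ ≤ (2 * b : ℝ) ^ 2 := pow_le_pow_left₀ (Real.sqrt_nonneg _) h1 2
  have hb1 : (1 : ℝ) ≤ (2 * b : ℝ) ^ 2 := by
    have : (1 : ℝ) ≤ b := by exact_mod_cast hb
    nlinarith
  have hbn' : b ≤ n ∨ n = 0 := by
    rcases Nat.eq_zero_or_pos n with h | h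
    · exact Or.inr h
    · exact Or.inl (Nat.le_of_dvd h hbn)
  have hlen : order.length ≤ (n / b) ^ 2 := by
    simpa [sq] using hord.1.length_le_card
  have hL : (order.length : ℝ) * b ^ 2 ≤ (n : ℝ) ^ 2 := by
    have : order.length * b ^ 2 ≤ n ^ 2 := by
      calc order.length * b ^ 2 ≤ (n / b) ^ 2 * b ^ 2 := Nat.mul_le_mul_right _ hlen
        _ = n ^ 2 := by rw [← mul_pow, Nat.div_mul_cancel hbn]
    exact_mod_cast this
  have hL' : order.length = 0 ∨ 2 * b ≤ n := by
    rcases order with _ | ⟨p, ps⟩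
    · exact Or.inl rfl
    · right
      have h1 : p.1 < p.2 := (hord.2 p).1 (by simp)
      have h2 : 2 ≤ n / b := by
        have := p.2.2
        rw [Fin.lt_def] at h1
        omega
      exact (Nat.mul_le_mul_right b h2).trans (Nat.div_mul_le_self n b)
  have hΦ : ∀ μ : ℝ, 0 < μ → 0 ≤ (2 * b : ℝ) ^ 2 * (1 + ((2 * b : ℝ) ^ 2 / μ) ^ ε) :=
    fun μ hμ => by positivity
  obtain ⟨stp, hstp⟩ := exists_sweep S (m := m) hM hb pivot order fun p hp => (hord.2 p).1 hp
  obtain ⟨comp, hcomp⟩ := cost_finalize hM hnm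
  refine ⟨stp (comp fun _ => .halt), fun U D far hD G V s hG hV => ?_⟩
  obtain ⟨f₁, st₁, T, w₁, t₁, hr₁, hs₁, hG₁, hV₁, ht₁, hw₁⟩ := hstp D far (comp fun _ => .halt)
    s.fast (fun a => s.slow a.1 a.2.1 a.2.2) G V hG hV
  obtain ⟨w₂, hw₂, t₂, ht₂, f₂, hr₂⟩ := hcomp D far (fun _ => .halt) f₁ st₁
  obtain ⟨hUf, hSf, hfr⟩ := finalize_spec st₁ T.1 hG₁
  have hrun : (stp (comp fun _ => .halt)).run D far s =
      ⟨memOf f₂ ((finalize m n).fin st₁), w₁ + w₂, t₁ + t₂⟩ := by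
    refine hr₁.trans ?_
    rw [hr₂, Prog.run]
    simp [Outcome.charge]
  rw [hrun]
  refine ⟨⟨T.1, T.2, hs₁, fun i j => (hfr _ (by simp)).trans (hG₁ i j),
    fun i j => (hfr _ (by simp)).trans (hV₁ i j), hUf, hSf⟩, ?_, ?_⟩
  · have hmt := (hmt (2 * b) (by omega))
    have het := het (2 * b) (Nat.clog 2 b) (two_pow_clog_le hb)
    push_cast at hmt het
    -- Operations are counted as words with μ = 1.
    have key := hbound 1 _ _ m n b order.length one_pos hb1 hb hnm hbn' hL hL'
      (hmt.trans (mul_le_mul_of_nonneg_right (by linarith) (hΦ 1 one_pos)))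
      (het.trans (mul_le_mul_of_nonneg_right (by linarith) (hΦ 1 one_pos)))
    rw [Real.one_rpow, div_one, show 2 * ε - 1 = ω₀ - 3 by rw [hε]; ring] at key
    have h1 : ((t₁ + t₂ : ℕ) : ℝ) ≤
        ((order.length * (5 * stepTime S b m n) + 30 * (m * n) : ℕ) : ℝ) := by
      exact_mod_cast Nat.add_le_add ht₁ ht₂
    have h2 : (stepTime S b m n : ℝ) ≤ 10 * (2 * b : ℝ) ^ 2 +
        elimTime S (2 * b) (Nat.clog 2 b) +
        2 * (((m / (2 * b) : ℕ) + 1 : ℝ) * mmaTime S (level S (2 * b))) +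
        ((n / (2 * b) : ℕ) + 1 : ℝ) * mmaTime S (level S (2 * b)) := by
      simp only [stepTime, rotateTime]
      push_cast
      nlinarith
    have h3 := mul_le_mul_of_nonneg_left h2 (Nat.cast_nonneg (α := ℝ) order.length)
    have h4 : 0 ≤ cU * (m * (n : ℝ) ^ 2 * (b : ℝ) ^ (ω₀ - 3)) := by positivity
    have h5 : (0 : ℝ) ≤ m * n := by positivity
    push_cast at h1 ⊢
    linarith
  · have hmw := (hmw M (2 * b) (by omega) (by omega))
    have hew := hew M (2 * b) (Nat.clog 2 b) (by omega) (two_pow_clog_le hb)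
    push_cast at hmw hew
    have key := hbound M _ _ m n b order.length hM' hMb2 hb hnm hbn' hL hL'
      (hmw.trans (mul_le_mul_of_nonneg_right (by linarith) (hΦ M hM')))
      (hew.trans (mul_le_mul_of_nonneg_right (by linarith) (hΦ M hM')))
    rw [show 2 * ε - 1 = ω₀ - 3 by rw [hε]; ring] at key
    have h1 := hw₁ (cU * U (2 * b)) hD
    have hw₂' : (w₂ : ℝ) ≤ 18 * (m * n) := by exact_mod_cast hw₂
    have h2 : (stepWords S M b m n : ℝ) ≤ 10 * (2 * b : ℝ) ^ 2 +
        elimWords S M (2 * b) (Nat.clog 2 b) +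
        2 * (((m / (2 * b) : ℕ) + 1 : ℝ) * mmaWords S M (level S (2 * b))) +
        ((n / (2 * b) : ℕ) + 1 : ℝ) * mmaWords S M (level S (2 * b)) := by
      simp only [stepWords, rotateWords]
      push_cast
      nlinarith
    have h3 := mul_le_mul_of_nonneg_left h2 (Nat.cast_nonneg (α := ℝ) order.length)
    -- The sign of U is not assumed; it follows from the bound for the zero matrix, as a number of
    -- words is nonnegative.
    have hU0 : 0 ≤ U (2 * b) := by
      have h := hD 0 Matrix.isSymm_zero
      have h' : (0 : ℝ) ≤ cU * U (2 * b) := le_trans (Nat.cast_nonneg _) h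
      exact nonneg_of_mul_nonneg_right h' hcU
    have hceil : (order.length : ℝ) ≤ (⌈(n : ℝ) / b⌉₊ : ℝ) ^ 2 := by
      have h4 : ((n / b : ℕ) : ℝ) ≤ ⌈(n : ℝ) / b⌉₊ := Nat.cast_div_le.trans (Nat.le_ceil _)
      calc (order.length : ℝ) ≤ ((n / b : ℕ) : ℝ) ^ 2 := by exact_mod_cast hlen
        _ ≤ _ := pow_le_pow_left₀ (by positivity) h4 2
    have h5 := mul_le_mul_of_nonneg_right hceil (mul_nonneg hcU.le hU0)
    have h6 : 0 ≤ m * (n : ℝ) ^ 2 * (b : ℝ) ^ (ω₀ - 3) / (M : ℝ) ^ ε := by positivity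
    have h7 : 0 ≤ (⌈(n : ℝ) / b⌉₊ : ℝ) ^ 2 * U (2 * b) := by positivity
    have h8 := mul_nonneg hC.le h6
    have h9 := mul_nonneg hC.le h7
    have h10 := mul_nonneg hcU.le h6
    push_cast
    linarith
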